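/- Let $M$ be a complete smooth Riemannian manifold with a filtration $0=H^0\subseteq H^1\subseteq\cdots\subseteq H^n=TM$ ($n\ge 1$) by smooth subbundles such that $[\Gamma(H^i),\Gamma(H^j)]\subseteq\Gamma(H^{i+j})$, where $H^i=TM$ for $i>n$. Let a Lie group $G$ with Lie algebra $\mathfrak g$ act on $M$ smoothly, properly, by isometries and preserving each $H^i$, and fix a $G$-invariant Riemannian metric on the bundle $M\times\mathfrak g$ (with $g\cdot(x,v)=(gx,\mathrm{Ad}_g v)$). For $x\in M$ let $f'_x:\mathfrak g\to T_xM$ be the derivative at $e$ of $g\mapsto gx$, and $\mathfrak m_x=\ker f'_x$. The orbital Dirac operator $\mathcal D_G$ on complex differential forms is defined by $$(\mathcal D_G s)(x)=-i\sum_k(\mathrm{ext}(e_k)+\mathrm{int}(e_k))\,\frac{\partial}{\partial v_k}\Big|_{g=e}\,g^{-1}\cdot s(gx),$$ where $(v_k)$ is an orthonormal basis of $\mathfrak m_x^\perp$ for the metric at $x$ and $e_k$ is the image of $v_k$ under the isometry $(f'_xf_x'^*)^{-1/2}f'_x$ of $\mathfrak m_x^\perp$ onto $T_x(Gx)\subseteq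 T_xM$. Fix $x\in M$. Let $gr(H)_x=\bigoplus_{i=1}^nH^i_x/H^{i-1}_x$ be the graded nilpotent Lie algebra with bracket induced by the bracket of vector fields, $Gr(H)_x$ its simply connected Lie group, $C^*(Gr(H)_x)$ its group $C^*$-algebra, and let $E=C^*(Gr(H)_x)\otimes\Lambda^*_x(M)$, with $\Lambda^*_x(M)$ the complex exterior algebra of $T^*_xM$, regarded as a Hilbert $C^*(Gr(H)_x)$-module. Suppose that near $x$ the operator $\mathcal D_G$ has H-order at most $k$, where $1\le k\le n$, that is, $\mathcal D_G=\sum_j\Phi_j\nabla_{X_j}+\Psi$ near $x$ with a connection $\nabla$ on $\Lambda^*(M)$, smooth sections $X_j$ of $H^k$ and bundle endomorphisms $\Phi_j,\Psi$. Its H-cosymbol at $x$ is $$\sigma_H(\mathcal D_G,x)=\sum_j[X_j(x)]\otimes\Phi_j(x)\in gr(H)_x\otimes\mathrm{End}(\Lambda^*_x(M)),\qquad [X_j(x)]\in H^k_x/H^{k-1}_x .$$ Regard $\sigma_H(\mathcal D_G,x)$ as a left-invariant differential operator on $Gr(H)_x$, and so as an unbounded operator on $E$ with domain $C_c^\infty(Gr(H)_x)\otimes\Lambda^*_x(M)$.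 Then there is $\lambda_0\ge 1$ such that for all real $\lambda\ge\lambda_0$ the images of $\sigma_H(\mathcal D_G,x)+i\lambda$ and of $\sigma_H(\mathcal D_G,x)-i\lambda$ are dense in $E$. Moreover $\sigma_H(\mathcal D_G,x)$ is closable, and its closure $T$ is self-adjoint and a regular operator on the Hilbert $C^*(Gr(H)_x)$-module $E$: it is closed, $C^*(Gr(H)_x)$-linear and densely defined, has densely defined adjoint, and $1+T^*T$ has dense range. -/

import Mathlib

open scoped ContDiff Manifold CompactlySupported TensorProduct InnerProductSpace Topology Bundle

noncomputable section

/-! ### Nilpotent groups in exponential coordinates and their C*-algebras -/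

namespace GradedLie
variable {V : Type*} [NormedAddCommGroup V] [NormedSpace ℝ V] [FiniteDimensional ℝ V]

/-- The representation `Y ↦ [X, Y]`, `δ ↦ - δ X` of a graded Lie algebra `V` (bracket `B`, degree
derivation `δ`) on its one-dimensional extension `V × ℝ`, the second factor being spanned by the
derivation. It is faithful, as `δ` is injective, and acts by nilpotent endomorphisms. -/
def extAd (B : V →ₗ[ℝ] V →ₗ[ℝ] V) (δ : V →ₗ[ℝ] V) (X : V) : Module.End ℝ (V × ℝ) :=
  (B X ∘ₗ LinearMap.fst ℝ V ℝ - (LinearMap.snd ℝ V ℝ).smulRight (δ X)).prod 0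

/-- The exponential of the nilpotent endomorphism `extAd B δ X` of a space of dimension `dim V + 1`. -/
def unipExp (B : V →ₗ[ℝ] V →ₗ[ℝ] V) (δ : V →ₗ[ℝ] V) (X : V) : Module.End ℝ (V × ℝ) :=
  ∑ m ∈ Finset.range (Module.finrank ℝ V + 1), ((m.factorial : ℝ)⁻¹) • extAd B δ X ^ m

/-- The group law, in exponential coordinates, of the simply connected nilpotent Lie group with graded
Lie algebra `(V, B, δ)`, i.e. the Baker-Campbell-Hausdorff product: `unipExp` is a bijection from `V`
onto a group of unipotent automorphisms, and the law is transported from there. The unit is `0`,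
the inverse of `X` is `-X`, the one-parameter groups are `t ↦ t • X`. -/
def mul (B : V →ₗ[ℝ] V →ₗ[ℝ] V) (δ : V →ₗ[ℝ] V) (X Y : V) : V :=
  Function.invFun (unipExp B δ) (unipExp B δ X * unipExp B δ Y)

/-- Lebesgue measure: in exponential coordinates it is a two-sided Haar measure of the nilpotent group. -/
def haar (V : Type*) [NormedAddCommGroup V] [NormedSpace ℝ V] [FiniteDimensional ℝ V] :
    @MeasureTheory.Measure V (borel V) :=
  letI : MeasurableSpace V := borel V
  haveI : BorelSpace V := ⟨rfl⟩
  MeasureTheory.Measure.addHaar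

/-- Convolution `(f * g)(x) = ∫ f(y) g(y⁻¹ x) dy` for a group law `m` on `V` with `y⁻¹ = -y`. -/
def conv (m : V → V → V) (f g : V → ℂ) (x : V) : ℂ :=
  letI : MeasurableSpace V := borel V
  ∫ y, f y * g (m (-y) x) ∂(haar V)

/-- The `L¹` norm. -/
def norm1 (f : V → ℂ) : ℝ :=
  letI : MeasurableSpace V := borel V
  ∫ y, ‖f y‖ ∂(haar V)

/-- A nondegenerate `*`-representation of the convolution algebra `C_c` of the group on a Hilbert
space, bounded for the `L¹` norm; the involution is `f^*(x) = conj (f(x⁻¹))`. The group being separable,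
Hilbert spaces in the lowest universe suffice to compute the norms. -/
structure Rep (m : V → V → V) where
  H : Type
  [instN : NormedAddCommGroup H]
  [instI : InnerProductSpace ℂ H]
  [instC : CompleteSpace H]
  toFun : C_c(V, ℂ) →ₗ[ℂ] (H →L[ℂ] H)
  map_conv : ∀ f g h : C_c(V, ℂ), (∀ x, h x = conv m f g x) → toFun h = toFun f * toFun g
  map_star : ∀ f g : C_c(V, ℂ), (∀ x, g x = star (f (-x))) → toFun g = star (toFun f)
  norm_le : ∀ f : C_c(V, ℂ), ‖toFun f‖ ≤ norm1 f
  nondeg : Dense (Submodule.span ℂ {v : H | ∃ f w, v = toFun f w} : Set H)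

attribute [instance] Rep.instN Rep.instI Rep.instC

/-- The direct sum of all nondegenerate representations. -/
def universalRep (m : V → V → V) (f : C_c(V, ℂ)) :
    lp (fun r : Rep m => r.H →L[ℂ] r.H) ⊤ :=
  ⟨fun r => r.toFun f, memℓp_infty ⟨norm1 f, by rintro _ ⟨r, rfl⟩; exact r.norm_le f⟩⟩

/-- The (full) group C*-algebra: the completion of `C_c` for the supremum of the norms `‖π(f)‖` over
all nondegenerate representations `π`, realised as the closure of the image of `C_c`. -/
def CStarSub (m : V → V → V) :
    NonUnitalStarSubalgebra ℂ (lp (fun r : Rep m => r.H →L[ℂ] r.H) ⊤) :=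
  (NonUnitalStarAlgebra.adjoin ℂ (Set.range (universalRep m))).topologicalClosure

instance (m : V → V → V) :
    IsClosed (CStarSub m : Set (lp (fun r : Rep m => r.H →L[ℂ] r.H) ⊤)) :=
  NonUnitalStarSubalgebra.isClosed_topologicalClosure _

/-- The group C*-algebra, as a type. -/
def CStar (m : V → V → V) : Type _ := CStarSub m

instance (m : V → V → V) : NonUnitalCStarAlgebra (CStar m) :=
  inferInstanceAs (NonUnitalCStarAlgebra (CStarSub m))
instance (m : V → V → V) : PartialOrder (CStar m) := CStarAlgebra.spectralOrder _
instance (m : V → V → V) : StarOrderedRing (CStar m) := CStarAlgebra.spectralOrderedRing _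

/-- The canonical map from `C_c` to the group C*-algebra. -/
def incl (m : V → V → V) (f : C_c(V, ℂ)) : CStar m :=
  (⟨universalRep m f, NonUnitalStarSubalgebra.le_topologicalClosure _
    (NonUnitalStarAlgebra.subset_adjoin ℂ _ ⟨f, rfl⟩)⟩ : CStarSub m)

/-- The Hilbert C*-module `C*(m) ⊗ ℂ^J`: the standard module of `J`-tuples, with `C*(m)` acting on
the left and `⟪x, y⟫ = ∑ j, y j * star (x j)`. -/
abbrev Mod (m : V → V → V) (J : Type) : Type _ := WithCStarModule (CStar m) (J → CStar m)

/-- The left-invariant vector field `(X f)(y) = d/dt f(y · exp (t X))` at `t = 0`. -/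
def leftDeriv (m : V → V → V) (X : V) (f : V → ℂ) (y : V) : ℂ :=
  fderiv ℝ (fun Z => f (m y Z)) 0 X

/-- The left-invariant operator of `σ = ∑ X ⊗ A` on `J`-tuples of functions:
`∑ A (X f)`, with value the entry `S` at the point `y`. -/
def leftOp (m : V → V → V) {J : Type} [Fintype J] (f : J → V → ℂ) (S : J) (y : V) :
    V ⊗[ℝ] Matrix J J ℂ →ₗ[ℝ] ℂ :=
  TensorProduct.lift (LinearMap.mk₂ ℝ
    (fun X A => ∑ S', A S S' * leftDeriv m X (f S') y)
    (fun X X' A => by simp [leftDeriv, mul_add, Finset.sum_add_distrib])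
    (fun c X A => by
      simp only [leftDeriv, map_smul, Complex.real_smul, Finset.mul_sum]
      exact Finset.sum_congr rfl fun _ _ => by ring)
    (fun X A A' => by simp [add_mul, Finset.sum_add_distrib])
    (fun c X A => by
      simp only [Matrix.smul_apply, Complex.real_smul, Finset.mul_sum]
      exact Finset.sum_congr rfl fun _ _ => by ring))

/-- The element of `C*(m) ⊗ ℂ^J` given by a tuple of functions in `C_c`. -/
def toMod (m : V → V → V) {J : Type} (f : J → C_c(V, ℂ)) : Mod m J :=
  (WithCStarModule.equiv (CStar m) (J → CStar m)).symm fun S => incl m (f S)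

/-- The graph, in the Hilbert C*-module, of the left-invariant operator of `σ` with domain
the smooth compactly supported functions. -/
def opGraph (m : V → V → V) {J : Type} [Fintype J] (σ : V ⊗[ℝ] Matrix J J ℂ) :
    Set (Mod m J × Mod m J) :=
  {p | ∃ f g : J → C_c(V, ℂ), (∀ S, ContDiff ℝ ∞ (f S)) ∧
    (∀ S y, g S y = leftOp m (fun S' => f S') S y σ) ∧ p = (toMod m f, toMod m g)}

end GradedLie

/-! ### Unbounded operators on Hilbert C*-modules -/

namespace HilbertModule
variable (A : Type*) {E : Type*} [NonUnitalCStarAlgebra A] [PartialOrder A]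
  [NormedAddCommGroup E] [NormedSpace ℂ E] [SMul A E] [CStarModule A E]

/-- `y` is in the domain of the adjoint of `T` and `T^* y = z`. -/
def IsAdjointPair (T : E →ₗ.[ℂ] E) (y z : E) : Prop :=
  ∀ x : T.domain, inner A (T x) y = inner A (x : E) z

/-- `T = T^*`. -/
def IsSelfAdjointOp (T : E →ₗ.[ℂ] E) : Prop :=
  ∀ y z : E, IsAdjointPair A T y z ↔ (y, z) ∈ T.graph

/-- A regular operator on a Hilbert C*-module: a closed `A`-linear operator, densely defined, with
densely defined adjoint, such that `1 + T^* T` has dense range. -/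
structure IsRegularOp (T : E →ₗ.[ℂ] E) : Prop where
  map_smul : ∀ (a : A) (x : T.domain), ∃ h : a • (x : E) ∈ T.domain, T ⟨a • (x : E), h⟩ = a • T x
  isClosed : T.IsClosed
  dense_domain : Dense (T.domain : Set E)
  dense_adjoint_domain : Dense {y : E | ∃ z, IsAdjointPair A T y z}
  dense_range : Dense {w : E | ∃ (x : T.domain) (z : E), IsAdjointPair A T (T x) z ∧ w = x + z}
end HilbertModule

/-! ### Filtered manifolds and their osculating Lie algebras -/

section Manifold
variable {E : Type*} [NormedAddCommGroup E] [NormedSpace ℝ E]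
  {M : Type*} [TopologicalSpace M] [ChartedSpace E M] [IsManifold 𝓘(ℝ, E) ∞ M]

/-- `X` is a smooth vector field in a neighbourhood of `x`. -/
def SmoothVF (X : Π y : M, TangentSpace 𝓘(ℝ, E) y) (x : M) : Prop :=
  ∀ᶠ y in 𝓝 x, ContMDiffAt 𝓘(ℝ, E) 𝓘(ℝ, E).tangent ∞
    (fun z => (⟨z, X z⟩ : TangentBundle 𝓘(ℝ, E) M)) y

lemma SmoothVF.mdiffAt {X : Π y : M, TangentSpace 𝓘(ℝ, E) y} {x : M} (h : SmoothVF X x) :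
    MDifferentiableAt 𝓘(ℝ, E) 𝓘(ℝ, E).tangent (fun z => (⟨z, X z⟩ : TangentBundle 𝓘(ℝ, E) M)) x :=
  h.self_of_nhds.mdifferentiableAt (by simp)

lemma SmoothVF.add {X Y : Π y : M, TangentSpace 𝓘(ℝ, E) y} {x : M} (hX : SmoothVF X x)
    (hY : SmoothVF Y x) : SmoothVF (fun y => X y + Y y) x := by
  filter_upwards [hX, hY] with y h1 h2
  exact h1.add_section h2

lemma SmoothVF.smul {X : Π y : M, TangentSpace 𝓘(ℝ, E) y} {x : M} (c : ℝ) (hX : SmoothVF X x) :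
    SmoothVF (fun y => c • X y) x := by
  filter_upwards [hX] with y h1
  exact h1.const_smul_section

lemma SmoothVF.sum {ι : Type*} (s : Finset ι) {X : ι → Π y : M, TangentSpace 𝓘(ℝ, E) y} {x : M}
    (hX : ∀ a ∈ s, SmoothVF (X a) x) : SmoothVF (fun y => ∑ a ∈ s, X a y) x := by
  have : ∀ᶠ y in 𝓝 x, ∀ a ∈ s, ContMDiffAt 𝓘(ℝ, E) 𝓘(ℝ, E).tangent ∞
    (fun z => (⟨z, X a z⟩ : TangentBundle 𝓘(ℝ, E) M)) y := by
    rw [Filter.eventually_all_finset]; exact hX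
  filter_upwards [this] with y h1
  exact ContMDiffAt.sum_section h1

variable [FiniteDimensional ℝ E]

open VectorField in
/-- If `Z` is a local section of the span of a smooth local frame `X`, vanishing at `x`, then
`[Z, Y] x` lies in that span. -/
lemma SmoothVF.mlieBracket_mem_of_vanish {x : M} {r : ℕ} {X : Fin r → Π y : M, TangentSpace 𝓘(ℝ, E) y}
    {Z Y : Π y : M, TangentSpace 𝓘(ℝ, E) y}
    (hX : ∀ a, SmoothVF (X a) x) (hli : LinearIndependent ℝ (fun a => X a x))
    (hZ : SmoothVF Z x) (hZ0 : Z x = 0)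
    (hZX : ∀ᶠ y in 𝓝 x, Z y ∈ Submodule.span ℝ (Set.range fun a => X a y)) :
    mlieBracket 𝓘(ℝ, E) Z Y x ∈ Submodule.span ℝ (Set.range fun a => X a x) := by
  have : CompleteSpace E := FiniteDimensional.complete ℝ E
  set e := trivializationAt E (TangentSpace 𝓘(ℝ, E) : M → Type _) x with he
  have hxe : x ∈ e.baseSet := FiberBundle.mem_baseSet_trivializationAt' x
  have hmd : ∀ {W : Π y : M, TangentSpace 𝓘(ℝ, E) y}, SmoothVF W x →
      MDifferentiableAt 𝓘(ℝ, E) 𝓘(ℝ, E) (fun y => e.continuousLinearMapAt ℝ y (W y)) x := by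
    intro W hW
    have := (e.mdifferentiableAt_section_iff 𝓘(ℝ, E) W hxe).1 hW.mdiffAt
    refine this.congr_of_eventuallyEq ?_
    filter_upwards [e.open_baseSet.mem_nhds hxe] with y hy
    rw [Bundle.Trivialization.continuousLinearMapAt_apply,
      Bundle.Trivialization.coe_linearMapAt_of_mem _ hy]
  have hli' : LinearIndependent ℝ (fun a => e.continuousLinearMapAt ℝ x (X a x)) := by
    refine hli.map' (e.continuousLinearMapAt ℝ x).toLinearMap (LinearMap.ker_eq_bot.2 ?_)
    intro v w h
    refine (e.linearEquivAt ℝ x hxe).injective ?_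
    simpa [Bundle.Trivialization.coe_linearMapAt_of_mem _ hxe] using h
  obtain ⟨L, hL⟩ : ∃ L : E →L[ℝ] (Fin r → ℝ),
      ∀ a, L (e.continuousLinearMapAt ℝ x (X a x)) = Pi.single a 1 := by
    obtain ⟨L, hL⟩ := LinearMap.exists_leftInverse_of_injective
      (Fintype.linearCombination ℝ (fun a => e.continuousLinearMapAt ℝ x (X a x)))
      (LinearMap.ker_eq_bot.2 hli'.fintypeLinearCombination_injective)
    refine ⟨LinearMap.toContinuousLinearMap L, fun a => ?_⟩
    have := LinearMap.congr_fun hL (Pi.single a 1)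
    simpa [Fintype.linearCombination_apply_single] using this
  let S : Fin r → E →L[ℝ] ((Fin r → ℝ) →L[ℝ] (Fin r → ℝ)) := fun a =>
    (ContinuousLinearMap.smulRightL ℝ (Fin r → ℝ) (Fin r → ℝ)
      (ContinuousLinearMap.proj a)) ∘L L
  let g : M → ((Fin r → ℝ) →L[ℝ] (Fin r → ℝ)) := fun y =>
    ∑ a, S a (e.continuousLinearMapAt ℝ y (X a y))
  have hg : MDifferentiableAt 𝓘(ℝ, E) 𝓘(ℝ, (Fin r → ℝ) →L[ℝ] (Fin r → ℝ)) g x := by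
    have : g = ∑ a, fun y => S a (e.continuousLinearMapAt ℝ y (X a y)) := by
      ext y; simp [g]
    rw [this]
    refine MDifferentiableAt.sum fun a _ => ?_
    exact (S a).differentiableAt.comp_mdifferentiableAt (hmd (hX a))
  have hgv : ∀ y c, g y c = L (e.continuousLinearMapAt ℝ y (∑ a, c a • X a y)) := by
    intro y c
    simp [g, S, map_sum, map_smul]
  have hg1 : g x = 1 := by
    refine ContinuousLinearMap.ext fun c => ?_
    rw [hgv]
    rw [map_sum, map_sum]
    have h4 : ∀ a, L (e.continuousLinearMapAt ℝ x (c a • X a x)) = c a • Pi.single a 1 :=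
      fun a => by rw [map_smul, map_smul, hL]
    simp only [h4]
    funext b
    simp [Finset.sum_apply, Pi.single_apply]
  let f : M → (Fin r → ℝ) := fun y => Ring.inverse (g y) (L (e.continuousLinearMapAt ℝ y (Z y)))
  have hf : MDifferentiableAt 𝓘(ℝ, E) 𝓘(ℝ, Fin r → ℝ) f x := by
    refine MDifferentiableAt.clm_apply ?_ (L.differentiableAt.comp_mdifferentiableAt (hmd hZ))
    have h3 : MDifferentiableAt 𝓘(ℝ, E) 𝓘(ℝ, (Fin r → ℝ) →L[ℝ] (Fin r → ℝ))
        (Ring.inverse ∘ g) x := DifferentiableAt.comp_mdifferentiableAt ?_ hg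
    · exact h3
    exact differentiableAt_inverse (by rw [hg1]; exact isUnit_one)
  have hf0 : f x = 0 := by simp [f, hZ0]
  have hfa : ∀ a, MDifferentiableAt 𝓘(ℝ, E) 𝓘(ℝ, ℝ) (fun y => f y a) x := fun a =>
    (ContinuousLinearMap.proj (R := ℝ) (φ := fun _ : Fin r => ℝ) a).differentiableAt.comp_mdifferentiableAt hf
  have hunit : ∀ᶠ y in 𝓝 x, IsUnit (g y) := by
    apply hg.continuousAt.eventually
    rw [hg1]
    exact Units.isOpen.mem_nhds isUnit_one
  have hZeq : Z =ᶠ[𝓝 x] fun y => ∑ a, f y a • X a y := by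
    filter_upwards [hunit, hZX] with y hu hy
    obtain ⟨c, hc⟩ := (Submodule.mem_span_range_iff_exists_fun ℝ).1 hy
    have : f y = c := by
      have h1 : L (e.continuousLinearMapAt ℝ y (Z y)) = g y c := by rw [hgv, hc]
      simp only [f, h1]
      rw [← mul_apply_eq_comp, Ring.inverse_mul_cancel _ hu]
      rfl
    rw [this]; exact hc.symm
  rw [hZeq.mlieBracket_vectorField_eq (Filter.EventuallyEq.refl _ Y)]
  have key : ∀ s : Finset (Fin r),
      mlieBracket 𝓘(ℝ, E) (fun y => ∑ a ∈ s, f y a • X a y) Y x ∈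
        Submodule.span ℝ (Set.range fun a => X a x) ∧
      MDifferentiableAt 𝓘(ℝ, E) 𝓘(ℝ, E).tangent
        (fun y => (⟨y, ∑ a ∈ s, f y a • X a y⟩ : TangentBundle 𝓘(ℝ, E) M)) x := by
    intro s
    induction s using Finset.induction_on with
    | empty =>
      constructor
      · have := mlieBracket_zero_left (I := 𝓘(ℝ, E)) (W := Y)
        simp only [Finset.sum_empty]
        have h2 := congrFun this x
        change mlieBracket 𝓘(ℝ, E) 0 Y x ∈ _
        rw [h2]; exact Submodule.zero_mem _
      · exact MDifferentiableAt.sum_section (s := (∅ : Finset (Fin r))) (t := fun a y => f y a • X a y) (by simp)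
    | insert a s ha ih =>
      have h1 : MDifferentiableAt 𝓘(ℝ, E) 𝓘(ℝ, E).tangent
        (fun y => (⟨y, f y a • X a y⟩ : TangentBundle 𝓘(ℝ, E) M)) x :=
        (hfa a).smul_section (hX a).mdiffAt
      have h3 : (fun y => ∑ b ∈ insert a s, f y b • X b y) =
          (fun y => f y a • X a y) + (fun y => ∑ b ∈ s, f y b • X b y) := by
        ext y; simp [Finset.sum_insert ha]
      rw [h3]
      constructor
      · rw [mlieBracket_add_left h1 ih.2]
        refine Submodule.add_mem _ ?_ ih.1
        have := mlieBracket_smul_left (W := Y) (hfa a) (hX a).mdiffAt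
        have h5 : (fun y => f y a • X a y) = (fun y => f y a) • X a := rfl
        rw [h5, this]
        simp only [hf0, Pi.zero_apply, zero_smul, add_zero]
        exact Submodule.smul_mem _ _ (Submodule.subset_span ⟨a, rfl⟩)
      · simp only [Finset.sum_insert ha]
        exact mdifferentiableAt_add_section h1 ih.2
  exact (key Finset.univ).1

variable (E M) in
/-- A filtration `0 = H 0 ⊆ H 1 ⊆ ... ⊆ H n = TM` of the tangent bundle by smooth subbundles (spanned
near every point by a smooth local frame), with `H i = TM` for `i ≥ n`, such that brackets of
(local) sections of `H i` and `H j` are sections of `H (i + j)`. -/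
structure Filtration (n : ℕ) where
  H : ℕ → Π x : M, Submodule ℝ (TangentSpace 𝓘(ℝ, E) x)
  zero : ∀ x, H 0 x = ⊥
  top : ∀ i x, n ≤ i → H i x = ⊤
  mono : ∀ x, Monotone fun i => H i x
  subbundle : ∀ i x, ∃ (r : ℕ) (X : Fin r → Π y : M, TangentSpace 𝓘(ℝ, E) y),
    (∀ a, SmoothVF (X a) x) ∧ LinearIndependent ℝ (fun a => X a x) ∧
    ∀ᶠ y in 𝓝 x, H i y = Submodule.span ℝ (Set.range fun a => X a y)
  bracket : ∀ (i j : ℕ) (x : M) (X Y : Π y : M, TangentSpace 𝓘(ℝ, E) y), SmoothVF X x → SmoothVF Y x →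
    (∀ᶠ y in 𝓝 x, X y ∈ H i y) → (∀ᶠ y in 𝓝 x, Y y ∈ H j y) →
    VectorField.mlieBracket 𝓘(ℝ, E) X Y x ∈ H (i + j) x

namespace Filtration
variable {n : ℕ} (𝓕 : Filtration E M n)

/-- `X` is a smooth section of the subbundle `H i` near `x`. -/
def IsSection (i : ℕ) (x : M) (X : Π y : M, TangentSpace 𝓘(ℝ, E) y) : Prop :=
  SmoothVF X x ∧ ∀ᶠ y in 𝓝 x, X y ∈ 𝓕.H i y

variable {𝓕}
lemma IsSection.add {i : ℕ} {x : M} {X Y : Π y : M, TangentSpace 𝓘(ℝ, E) y}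
    (hX : 𝓕.IsSection i x X) (hY : 𝓕.IsSection i x Y) : 𝓕.IsSection i x (X + Y) :=
  ⟨hX.1.add hY.1, by filter_upwards [hX.2, hY.2] with y h1 h2 using Submodule.add_mem _ h1 h2⟩

lemma IsSection.smul {i : ℕ} {x : M} {X : Π y : M, TangentSpace 𝓘(ℝ, E) y} (c : ℝ)
    (hX : 𝓕.IsSection i x X) : 𝓕.IsSection i x (c • X) :=
  ⟨hX.1.smul c, by filter_upwards [hX.2] with y h1 using Submodule.smul_mem _ _ h1⟩

lemma IsSection.mono {i j : ℕ} {x : M} {X : Π y : M, TangentSpace 𝓘(ℝ, E) y} (h : i ≤ j)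
    (hX : 𝓕.IsSection i x X) : 𝓕.IsSection j x X :=
  ⟨hX.1, by filter_upwards [hX.2] with y h1 using 𝓕.mono y h h1⟩

lemma IsSection.mem {i : ℕ} {x : M} {X : Π y : M, TangentSpace 𝓘(ℝ, E) y}
    (hX : 𝓕.IsSection i x X) : X x ∈ 𝓕.H i x := hX.2.self_of_nhds

lemma IsSection.bracket_mem {i j : ℕ} {x : M} {X Y : Π y : M, TangentSpace 𝓘(ℝ, E) y}
    (hX : 𝓕.IsSection i x X) (hY : 𝓕.IsSection j x Y) :
    VectorField.mlieBracket 𝓘(ℝ, E) X Y x ∈ 𝓕.H (i + j) x :=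
  𝓕.bracket i j x X Y hX.1 hY.1 hX.2 hY.2

variable (𝓕)
/-- Every vector of `H i` at `x` extends to a local section, linearly. -/
lemma exists_ext (i : ℕ) (x : M) :
    ∃ ext : 𝓕.H i x →ₗ[ℝ] (Π y : M, TangentSpace 𝓘(ℝ, E) y),
      ∀ v, 𝓕.IsSection i x (ext v) ∧ ext v x = v := by
  obtain ⟨r, X, hX, hli, hspan⟩ := 𝓕.subbundle i x
  have hx := hspan.self_of_nhds
  let P : (Fin r → ℝ) →ₗ[ℝ] 𝓕.H i x :=
    (Fintype.linearCombination ℝ (fun a => X a x)).codRestrict _ (fun c => by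
      rw [hx, Fintype.linearCombination_apply]
      exact Submodule.sum_mem _ fun a _ => Submodule.smul_mem _ _ (Submodule.subset_span ⟨a, rfl⟩))
  have hP : Function.Surjective P := by
    rintro ⟨v, hv⟩
    have hv' := hv
    rw [hx] at hv'
    obtain ⟨c, hc⟩ := (Submodule.mem_span_range_iff_exists_fun ℝ).1 hv'
    exact ⟨c, Subtype.ext hc⟩
  obtain ⟨C, hC⟩ := LinearMap.exists_rightInverse_of_surjective P (LinearMap.range_eq_top.2 hP)
  refine ⟨Fintype.linearCombination ℝ X ∘ₗ C, fun v => ⟨⟨?_, ?_⟩, ?_⟩⟩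
  · have h1 : ∀ a ∈ (Finset.univ : Finset (Fin r)), SmoothVF (fun y => C v a • X a y) x :=
      fun a _ => (hX a).smul _
    have h2 := SmoothVF.sum _ h1
    convert h2 using 1
    ext y
    simp [Fintype.linearCombination_apply]
  · filter_upwards [hspan] with y hy
    rw [hy, LinearMap.comp_apply, Fintype.linearCombination_apply, Finset.sum_apply]
    exact Submodule.sum_mem _ fun a _ => Submodule.smul_mem _ _ (Submodule.subset_span ⟨a, rfl⟩)
  · have h3 := congrArg Subtype.val (LinearMap.congr_fun hC v)
    refine Eq.trans ?_ h3
    rw [LinearMap.comp_apply, Fintype.linearCombination_apply, Finset.sum_apply]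
    simp [P, Fintype.linearCombination_apply]

variable {𝓕}
lemma bracket_mem_of_vanish {i : ℕ} {x : M} {Z Y : Π y : M, TangentSpace 𝓘(ℝ, E) y}
    (hZ : 𝓕.IsSection i x Z) (hZ0 : Z x = 0) :
    VectorField.mlieBracket 𝓘(ℝ, E) Z Y x ∈ 𝓕.H i x := by
  obtain ⟨r, X, hX, hli, hspan⟩ := 𝓕.subbundle i x
  rw [hspan.self_of_nhds]
  refine SmoothVF.mlieBracket_mem_of_vanish hX hli hZ.1 hZ0 ?_
  filter_upwards [hspan, hZ.2] with y h1 h2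
  rwa [← h1]

lemma bracket_sub_mem_left {i j : ℕ} {x : M} {X X' Y : Π y : M, TangentSpace 𝓘(ℝ, E) y}
    (hX : 𝓕.IsSection (i + 1) x X) (hX' : 𝓕.IsSection (i + 1) x X')
    (hY : 𝓕.IsSection (j + 1) x Y) (h : X x - X' x ∈ 𝓕.H i x) :
    VectorField.mlieBracket 𝓘(ℝ, E) X Y x - VectorField.mlieBracket 𝓘(ℝ, E) X' Y x ∈
      𝓕.H (i + j + 1) x := by
  have : CompleteSpace E := FiniteDimensional.complete ℝ E
  obtain ⟨ext, hext⟩ := 𝓕.exists_ext i x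
  obtain ⟨hW, hWx⟩ := hext ⟨X x - X' x, h⟩
  set W := ext ⟨X x - X' x, h⟩
  have hW' := hW.mono (Nat.le_succ i)
  have hZ : 𝓕.IsSection (i + 1) x (X + (-1 : ℝ) • (X' + W)) := hX.add ((hX'.add hW').smul (-1))
  have hZ0 : (X + (-1 : ℝ) • (X' + W)) x = 0 := by
    simp only [Pi.add_apply, Pi.smul_apply, hWx]
    module
  have h1 := bracket_mem_of_vanish (Y := Y) hZ hZ0
  have h2 : X = (X + (-1 : ℝ) • (X' + W)) + (X' + W) := by
    module
  have h3 : VectorField.mlieBracket 𝓘(ℝ, E) X Y x =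
      VectorField.mlieBracket 𝓘(ℝ, E) (X + (-1 : ℝ) • (X' + W)) Y x +
        (VectorField.mlieBracket 𝓘(ℝ, E) X' Y x + VectorField.mlieBracket 𝓘(ℝ, E) W Y x) := by
    conv_lhs => rw [h2]
    rw [VectorField.mlieBracket_add_left hZ.1.mdiffAt (hX'.add hW').1.mdiffAt,
      VectorField.mlieBracket_add_left hX'.1.mdiffAt hW.1.mdiffAt]
  rw [h3]
  have h4 := hW.bracket_mem hY
  have h5 : ∀ a b c : TangentSpace 𝓘(ℝ, E) x, a + (b + c) - b = a + c := fun a b c => by abel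
  rw [h5]
  exact Submodule.add_mem _ (𝓕.mono x (by omega) h1) h4

lemma bracket_sub_mem_right {i j : ℕ} {x : M} {X Y Y' : Π y : M, TangentSpace 𝓘(ℝ, E) y}
    (hX : 𝓕.IsSection (i + 1) x X) (hY : 𝓕.IsSection (j + 1) x Y)
    (hY' : 𝓕.IsSection (j + 1) x Y') (h : Y x - Y' x ∈ 𝓕.H j x) :
    VectorField.mlieBracket 𝓘(ℝ, E) X Y x - VectorField.mlieBracket 𝓘(ℝ, E) X Y' x ∈
      𝓕.H (i + j + 1) x := by
  have h1 := bracket_sub_mem_left hY hY' hX h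
  rw [VectorField.mlieBracket_swap_apply (V := X) (W := Y),
    VectorField.mlieBracket_swap_apply (V := X) (W := Y'), add_comm i j]
  have h2 : ∀ a b : TangentSpace 𝓘(ℝ, E) x, -a - -b = -(a - b) := fun a b => by abel
  rw [h2]
  exact Submodule.neg_mem _ h1

variable (𝓕)
/-- The `i + 1`-st graded piece `H (i + 1) / H i` at `x`. -/
abbrev GrPart (x : M) (i : Fin n) : Type _ := 𝓕.H (i + 1) x ⧸ (𝓕.H i x).submoduleOf (𝓕.H (i + 1) x)

/-- The vector space `gr(H)_x = ⨁ H (i + 1) / H i`. It is given some norm (of coordinates in a basis);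
only its topology and smooth structure are used, and these do not depend on the choice. -/
def Gr (x : M) : Type _ := Π i : Fin n, 𝓕.GrPart x i
instance (x : M) : AddCommGroup (𝓕.Gr x) := inferInstanceAs (AddCommGroup (Π i : Fin n, 𝓕.GrPart x i))
instance (x : M) : Module ℝ (𝓕.Gr x) := inferInstanceAs (Module ℝ (Π i : Fin n, 𝓕.GrPart x i))
instance (x : M) : FiniteDimensional ℝ (𝓕.Gr x) :=
  have : FiniteDimensional ℝ (TangentSpace 𝓘(ℝ, E) x) := inferInstanceAs (FiniteDimensional ℝ E)
  inferInstanceAs (FiniteDimensional ℝ (Π i : Fin n, 𝓕.GrPart x i))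
instance (x : M) : NormedAddCommGroup (𝓕.Gr x) :=
  NormedAddCommGroup.induced (𝓕.Gr x) (Fin (Module.finrank ℝ (𝓕.Gr x)) → ℝ) (Module.finBasis ℝ (𝓕.Gr x)).equivFun
    (Module.finBasis ℝ (𝓕.Gr x)).equivFun.injective
instance (x : M) : NormedSpace ℝ (𝓕.Gr x) :=
  NormedSpace.induced ℝ (𝓕.Gr x) (Fin (Module.finrank ℝ (𝓕.Gr x)) → ℝ) (Module.finBasis ℝ (𝓕.Gr x)).equivFun

/-- The class in `gr(H)_x` of a vector of `H (i + 1)`. -/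
def cls (x : M) (i : Fin n) : 𝓕.H (i + 1) x →ₗ[ℝ] 𝓕.Gr x :=
  LinearMap.single ℝ (fun i : Fin n => 𝓕.GrPart x i) i ∘ₗ Submodule.mkQ _

/-- The degree derivation of `gr(H)_x`: multiplication by `i` on `H i / H (i - 1)`. -/
def degree (x : M) : 𝓕.Gr x →ₗ[ℝ] 𝓕.Gr x :=
  LinearMap.pi fun i => ((i : ℝ) + 1) • LinearMap.proj (R := ℝ) (φ := fun i : Fin n => 𝓕.GrPart x i) i

lemma cls_eq_of_sub_mem {x : M} {i : Fin n} {v w : 𝓕.H (i + 1) x}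
    (h : (v : TangentSpace 𝓘(ℝ, E) x) - w ∈ 𝓕.H i x) : 𝓕.cls x i v = 𝓕.cls x i w := by
  have h1 : (Submodule.Quotient.mk v : 𝓕.GrPart x i) = Submodule.Quotient.mk w :=
    (Submodule.Quotient.eq _).2 h
  exact congrArg (LinearMap.single ℝ (fun i : Fin n => 𝓕.GrPart x i) i) h1

variable {𝓕} in
lemma IsSection.bracket_mem' {i j : ℕ} {x : M} {X Y : Π y : M, TangentSpace 𝓘(ℝ, E) y}
    (hX : 𝓕.IsSection (i + 1) x X) (hY : 𝓕.IsSection (j + 1) x Y) :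
    VectorField.mlieBracket 𝓘(ℝ, E) X Y x ∈ 𝓕.H (i + j + 1 + 1) x := by
  have := hX.bracket_mem hY
  rwa [show i + 1 + (j + 1) = i + j + 1 + 1 by omega] at this

/-- `B` is the bracket of the osculating Lie algebra `gr(H)_x`:
`[X(x), Y(x)] = [X, Y](x) mod H (i + j - 1)` for local sections `X` of `H i` and `Y` of `H j`
(and it is zero when `i + j > n`). -/
def IsOsculatingBracket (x : M) (B : 𝓕.Gr x →ₗ[ℝ] 𝓕.Gr x →ₗ[ℝ] 𝓕.Gr x) : Prop :=
  ∀ (i j : Fin n) (X Y : Π y : M, TangentSpace 𝓘(ℝ, E) y) (hX : 𝓕.IsSection (i + 1) x X)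
    (hY : 𝓕.IsSection (j + 1) x Y),
    B (𝓕.cls x i ⟨X x, hX.mem⟩) (𝓕.cls x j ⟨Y x, hY.mem⟩) =
      if h : (i : ℕ) + j + 1 < n then
        𝓕.cls x ⟨i + j + 1, h⟩ ⟨VectorField.mlieBracket 𝓘(ℝ, E) X Y x, hX.bracket_mem' hY⟩
      else 0

lemma exists_part (x : M) (i j : Fin n) :
    ∃ D : 𝓕.GrPart x i →ₗ[ℝ] 𝓕.GrPart x j →ₗ[ℝ] 𝓕.Gr x,
      ∀ (X Y : Π y : M, TangentSpace 𝓘(ℝ, E) y) (hX : 𝓕.IsSection (i + 1) x X)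
        (hY : 𝓕.IsSection (j + 1) x Y),
        D (Submodule.Quotient.mk ⟨X x, hX.mem⟩) (Submodule.Quotient.mk ⟨Y x, hY.mem⟩) =
          if h : (i : ℕ) + j + 1 < n then
            𝓕.cls x ⟨i + j + 1, h⟩ ⟨VectorField.mlieBracket 𝓘(ℝ, E) X Y x, hX.bracket_mem' hY⟩
          else 0 := by
  have : CompleteSpace E := FiniteDimensional.complete ℝ E
  by_cases h : (i : ℕ) + j + 1 < n
  swap
  · exact ⟨0, fun X Y hX hY => by simp [h]⟩
  obtain ⟨e1, he1⟩ := 𝓕.exists_ext (i + 1) x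
  obtain ⟨e2, he2⟩ := 𝓕.exists_ext (j + 1) x
  let k : Fin n := ⟨i + j + 1, h⟩
  let f : 𝓕.H (i + 1) x →ₗ[ℝ] 𝓕.H (j + 1) x →ₗ[ℝ] 𝓕.Gr x := LinearMap.mk₂ ℝ
    (fun v w => 𝓕.cls x k ⟨VectorField.mlieBracket 𝓘(ℝ, E) (e1 v) (e2 w) x,
      (he1 v).1.bracket_mem' (he2 w).1⟩)
    (fun v v' w => by
      rw [← map_add]; congr 1; apply Subtype.ext
      simp only [map_add, Submodule.coe_add]
      exact VectorField.mlieBracket_add_left (he1 v).1.1.mdiffAt (he1 v').1.1.mdiffAt)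
    (fun c v w => by
      rw [← map_smul]; congr 1; apply Subtype.ext
      simp only [map_smul, Submodule.coe_smul]
      exact VectorField.mlieBracket_const_smul_left (he1 v).1.1.mdiffAt)
    (fun v w w' => by
      rw [← map_add]; congr 1; apply Subtype.ext
      simp only [map_add, Submodule.coe_add]
      exact VectorField.mlieBracket_add_right (he2 w).1.1.mdiffAt (he2 w').1.1.mdiffAt)
    (fun c v w => by
      rw [← map_smul]; congr 1; apply Subtype.ext
      simp only [map_smul, Submodule.coe_smul]
      exact VectorField.mlieBracket_const_smul_right (he2 w).1.1.mdiffAt)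
  have key : ∀ (X Y : Π y : M, TangentSpace 𝓘(ℝ, E) y) (hX : 𝓕.IsSection (i + 1) x X)
      (hY : 𝓕.IsSection (j + 1) x Y) (v : 𝓕.H (i + 1) x) (w : 𝓕.H (j + 1) x),
      (v : TangentSpace 𝓘(ℝ, E) x) - X x ∈ 𝓕.H i x → (w : TangentSpace 𝓘(ℝ, E) x) - Y x ∈ 𝓕.H j x →
      f v w = 𝓕.cls x k ⟨VectorField.mlieBracket 𝓘(ℝ, E) X Y x, hX.bracket_mem' hY⟩ := by
    intro X Y hX hY v w hv hw
    refine (𝓕.cls_eq_of_sub_mem (w := ⟨VectorField.mlieBracket 𝓘(ℝ, E) X (e2 w) x,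
      hX.bracket_mem' (he2 w).1⟩) ?_).trans (𝓕.cls_eq_of_sub_mem ?_)
    · exact bracket_sub_mem_left (he1 v).1 hX (he2 w).1 (by rw [(he1 v).2]; exact hv)
    · exact bracket_sub_mem_right hX (he2 w).1 hY (by rw [(he2 w).2]; exact hw)
  have h1 : ∀ (v : 𝓕.H (i + 1) x) (w : 𝓕.H (j + 1) x),
      (v : TangentSpace 𝓘(ℝ, E) x) ∈ 𝓕.H i x → f v w = 0 := by
    intro v w hv
    have h0 := (he1 0).2
    rw [key _ _ (he1 0).1 (he2 w).1 v w (by rw [h0]; simpa using hv) (by rw [(he2 w).2]; simp)]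
    rw [← map_zero (𝓕.cls x k)]
    congr 1; apply Subtype.ext
    have := congrFun (VectorField.mlieBracket_zero_left (I := 𝓘(ℝ, E)) (W := e2 w)) x
    simpa using this
  have h2 : ∀ (v : 𝓕.H (i + 1) x) (w : 𝓕.H (j + 1) x),
      (w : TangentSpace 𝓘(ℝ, E) x) ∈ 𝓕.H j x → f v w = 0 := by
    intro v w hw
    have h0 := (he2 0).2
    rw [key _ _ (he1 v).1 (he2 0).1 v w (by rw [(he1 v).2]; simp) (by rw [h0]; simpa using hw)]
    rw [← map_zero (𝓕.cls x k)]
    congr 1; apply Subtype.ext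
    have := congrFun (VectorField.mlieBracket_zero_right (I := 𝓘(ℝ, E)) (W := e1 v)) x
    simpa using this
  let g := (Submodule.liftQ ((𝓕.H j x).submoduleOf (𝓕.H (j + 1) x)) f.flip (fun w hw => by
    rw [LinearMap.mem_ker]; ext1 v; exact h2 v w hw)).flip
  refine ⟨Submodule.liftQ ((𝓕.H i x).submoduleOf (𝓕.H (i + 1) x)) g (fun v hv => ?_), ?_⟩
  · rw [LinearMap.mem_ker]
    refine LinearMap.ext fun w => ?_
    obtain ⟨w, rfl⟩ := Submodule.Quotient.mk_surjective _ w
    exact h1 v w hv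
  · intro X Y hX hY
    rw [dif_pos h]
    exact key X Y hX hY _ _ (by simp) (by simp)

lemma exists_isOsculatingBracket (x : M) : ∃ B, 𝓕.IsOsculatingBracket x B := by
  choose D hD using 𝓕.exists_part x
  let p : Π i : Fin n, 𝓕.Gr x →ₗ[ℝ] 𝓕.GrPart x i := fun i =>
    LinearMap.proj (R := ℝ) (φ := fun i : Fin n => 𝓕.GrPart x i) i
  have hp : ∀ i v, p i (𝓕.cls x i v) = Submodule.Quotient.mk v := fun i v => Pi.single_eq_same _ _
  have hp' : ∀ i i' v, i' ≠ i → p i' (𝓕.cls x i v) = 0 := fun i i' v h => Pi.single_eq_of_ne h _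
  refine ⟨∑ i, ∑ j, (D i j).compl₁₂ (p i) (p j), fun i j X Y hX hY => ?_⟩
  rw [← hD i j X Y hX hY]
  simp only [LinearMap.sum_apply, LinearMap.compl₁₂_apply]
  rw [Finset.sum_eq_single i, Finset.sum_eq_single j, hp, hp]
  · intro j' _ hj
    rw [hp' j j' _ hj, map_zero]
  · simp
  · intro i' _ hi
    simp [hp' i i' _ hi]
  · simp

/-- The Lie bracket of the osculating Lie algebra `gr(H)_x`. -/
def osculatingBracket (x : M) : 𝓕.Gr x →ₗ[ℝ] 𝓕.Gr x →ₗ[ℝ] 𝓕.Gr x :=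
  Classical.choose (𝓕.exists_isOsculatingBracket x)

lemma osculatingBracket_spec (x : M) : 𝓕.IsOsculatingBracket x (𝓕.osculatingBracket x) :=
  Classical.choose_spec (𝓕.exists_isOsculatingBracket x)
end Filtration

/-! ### Exterior forms, the orbital Dirac operator and the H-cosymbol -/

instance tangentSpace_finiteDimensional (x : M) : FiniteDimensional ℝ (TangentSpace 𝓘(ℝ, E) x) :=
  inferInstanceAs (FiniteDimensional ℝ E)

variable (E) in
/-- The complex exterior forms at `x`: the fibre of `Λ^*(M)`. -/
abbrev FormAt (x : M) : Type _ := ExteriorAlgebra ℂ (TangentSpace 𝓘(ℝ, E) x →ₗ[ℝ] ℂ)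

/-- Pullback of forms along a linear map. -/
def formPullback {V W : Type*} [AddCommGroup V] [Module ℝ V] [AddCommGroup W] [Module ℝ W]
    (L : V →ₗ[ℝ] W) : ExteriorAlgebra ℂ (W →ₗ[ℝ] ℂ) →ₐ[ℂ] ExteriorAlgebra ℂ (V →ₗ[ℝ] ℂ) :=
  ExteriorAlgebra.map (LinearMap.lcomp ℂ ℂ L)

/-- The basis of the exterior forms consisting of the increasing products of the dual basis of `b`;
it is orthonormal for the induced Hermitian structure when `b` is orthonormal. -/
def formBasis {V : Type*} [AddCommGroup V] [Module ℝ V] {d : ℕ} (b : Module.Basis (Fin d) ℝ V) :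
    Module.Basis (Finset (Fin d)) ℂ (ExteriorAlgebra ℂ (V →ₗ[ℝ] ℂ)) :=
  (Module.Basis.ofEquivFun (b.constr ℂ).symm).ExteriorAlgebra

/-- The covector dual to a vector. -/
def flat {V : Type*} [NormedAddCommGroup V] [InnerProductSpace ℝ V] (v : V) : V →ₗ[ℝ] ℂ :=
  Complex.ofRealLI.toLinearMap ∘ₗ innerₛₗ ℝ v

/-- Evaluation of covectors at a vector. -/
def evalAt {V : Type*} [AddCommGroup V] [Module ℝ V] (v : V) : (V →ₗ[ℝ] ℂ) →ₗ[ℂ] ℂ :=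
  LinearMap.applyₗ' ℂ v

/-- `ext(v) + int(v)`: exterior multiplication by the covector dual to `v`, plus contraction with `v`. -/
def cliff {V : Type*} [NormedAddCommGroup V] [InnerProductSpace ℝ V] (v : V) :
    Module.End ℂ (ExteriorAlgebra ℂ (V →ₗ[ℝ] ℂ)) :=
  LinearMap.mulLeft ℂ (ExteriorAlgebra.ι ℂ (flat v)) +
    CliffordAlgebra.contractLeft (Q := (0 : QuadraticForm ℂ (V →ₗ[ℝ] ℂ))) (evalAt v)

/-- A smooth section of `Λ^*(M)`: its coefficients in local trivialisations are smooth. -/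
def SmoothForm (s : Π y : M, FormAt E y) : Prop :=
  ∀ (y₀ : M) (l : ExteriorAlgebra ℂ (E →ₗ[ℝ] ℂ) →ₗ[ℂ] ℂ),
    ContMDiffAt 𝓘(ℝ, E) 𝓘(ℝ, ℂ) ∞ (fun y => l (formPullback
      ((trivializationAt E (TangentSpace 𝓘(ℝ, E) : M → Type _) y₀).symmL ℝ y : E →ₗ[ℝ] _) (s y))) y₀

/-- The derivative of a complex function in the direction of a tangent vector. -/
def dirDeriv {E' : Type*} [NormedAddCommGroup E'] [NormedSpace ℝ E'] {N : Type*}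
    [TopologicalSpace N] [ChartedSpace E' N] (f : N → ℂ) (y : N) (v : TangentSpace 𝓘(ℝ, E') y) : ℂ :=
  mfderiv 𝓘(ℝ, E') 𝓘(ℝ, ℂ) f y v

variable (E M) in
/-- A connection on `Λ^*(M)`: `nabla y v s` is the covariant derivative of `s` in the direction `v`. -/
structure FormConnection where
  nabla : Π y : M, TangentSpace 𝓘(ℝ, E) y →ₗ[ℝ] ((Π z : M, FormAt E z) → FormAt E y)
  add : ∀ y v s t, SmoothForm s → SmoothForm t → nabla y v (s + t) = nabla y v s + nabla y v t
  leibniz : ∀ y v (f : M → ℂ) s, ContMDiff 𝓘(ℝ, E) 𝓘(ℝ, ℂ) ∞ f → SmoothForm s →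
    nabla y v (fun z => f z • s z) =
      dirDeriv f y v • s y + f y • nabla y v s
  smooth : ∀ (X : Π y : M, TangentSpace 𝓘(ℝ, E) y) s,
    ContMDiff 𝓘(ℝ, E) 𝓘(ℝ, E).tangent ∞ (fun z => (⟨z, X z⟩ : TangentBundle 𝓘(ℝ, E) M)) →
    SmoothForm s → SmoothForm (fun y => nabla y (X y) s)

variable {F : Type*} [NormedAddCommGroup F] [NormedSpace ℝ F]  [FiniteDimensional ℝ F]
  {G : Type*} [TopologicalSpace G] [ChartedSpace F G] [Group G]

/-- The adjoint action of `g` on the Lie algebra. -/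
def Ad (g : G) : GroupLieAlgebra 𝓘(ℝ, F) G →ₗ[ℝ] GroupLieAlgebra 𝓘(ℝ, F) G :=
  (mfderiv 𝓘(ℝ, F) 𝓘(ℝ, F) (fun h : G => g * h * g⁻¹) 1 : F →L[ℝ] F).toLinearMap

variable [MulAction G M] 
variable (E M F G) in
/-- A `G`-invariant Riemannian metric on the trivial bundle `M × 𝔤`, where `g (x, v) = (g x, Ad_g v)`. -/
structure LieMetric where
  form : M → GroupLieAlgebra 𝓘(ℝ, F) G →ₗ[ℝ] GroupLieAlgebra 𝓘(ℝ, F) G →ₗ[ℝ] ℝ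
  symm : ∀ x v w, form x v w = form x w v
  pos : ∀ x v, v ≠ 0 → 0 < form x v v
  smooth : ∀ v w, ContMDiff 𝓘(ℝ, E) 𝓘(ℝ, ℝ) ∞ fun x => form x v w
  inv : ∀ (g : G) x v w, form (g • x) (Ad g v) (Ad g w) = form x v w

namespace LieMetric
variable (γ : LieMetric E M F G)

/-- The fibre at `x` of the bundle `M × 𝔤`, with the inner product given by the metric. -/
def Fiber (_ : LieMetric E M F G) (_ : M) : Type _ := GroupLieAlgebra 𝓘(ℝ, F) G

variable (x : M)
instance : AddCommGroup (γ.Fiber x) := inferInstanceAs (AddCommGroup (GroupLieAlgebra 𝓘(ℝ, F) G))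
instance : Module ℝ (γ.Fiber x) := inferInstanceAs (Module ℝ (GroupLieAlgebra 𝓘(ℝ, F) G))
instance : FiniteDimensional ℝ (γ.Fiber x) := inferInstanceAs (FiniteDimensional ℝ F)

/-- The inner product of the fibre at `x`. -/
@[reducible] def core : InnerProductSpace.Core ℝ (γ.Fiber x) where
  inner v w := γ.form x v w
  conj_inner_symm v w := γ.symm x w v
  re_inner_nonneg v := by
    by_cases h : v = 0
    · subst h; exact (congrArg (fun l => l 0) (map_zero (γ.form x))).ge
    · exact (γ.pos x v h).le
  add_left u v w := congrArg (fun l => l w) (map_add (γ.form x) u v)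
  smul_left u v r := congrArg (fun l => l v) (map_smul (γ.form x) r u)
  definite v h := by
    by_contra hv
    exact (γ.pos x v hv).ne' h

instance : NormedAddCommGroup (γ.Fiber x) := (γ.core x).toNormedAddCommGroup
instance : InnerProductSpace ℝ (γ.Fiber x) := InnerProductSpace.ofCore (γ.core x).toCore

/-- `f'_x : 𝔤 → T_x M`, the derivative at the unit of the orbit map `g ↦ g x`. -/
def orbitDiff : γ.Fiber x →ₗ[ℝ] TangentSpace 𝓘(ℝ, E) x :=
  (mfderiv 𝓘(ℝ, F) 𝓘(ℝ, E) (fun g : G => g • x) 1 : F →L[ℝ] E).toLinearMap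

/-- The function `g ↦ g⁻¹ (s (g x))` on `G` with values in `Λ^*_x(M)`, corresponding to the
restriction of the form `s` to the orbit of `x`. -/
def transport (s : Π y : M, FormAt E y) (x : M) (g : G) : FormAt E x :=
  formPullback (mfderiv 𝓘(ℝ, E) 𝓘(ℝ, E) (fun y : M => g • y) x).toLinearMap (s (g • x))

/-- `∂/∂v` at the unit of `G`: the derivative of `transport s x` along the one-parameter group of `v`
(computed on coefficients). -/
def orbitDeriv (s : Π y : M, FormAt E y) (v : γ.Fiber x) : FormAt E x :=
  ∑ S, dirDeriv (E' := F) (fun g : G =>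
    (formBasis (Module.finBasis ℝ (TangentSpace 𝓘(ℝ, E) x))).repr (transport s x g) S) 1 v •
      formBasis (Module.finBasis ℝ (TangentSpace 𝓘(ℝ, E) x)) S

variable [Bundle.RiemannianBundle (fun x : M => TangentSpace 𝓘(ℝ, E) x)]

/-- An orthonormal basis of `𝔤`, for the metric at `x`, of eigenvectors of `f'_x^* f'_x`. It is adapted
to the splitting of `𝔤` into the stabiliser algebra `𝔪_x` (the kernel) and `𝔪_x^⊥`. -/
def singularBasis : OrthonormalBasis (Fin (Module.finrank ℝ (γ.Fiber x))) ℝ (γ.Fiber x) :=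
  (γ.orbitDiff x).isSymmetric_adjoint_comp_self.eigenvectorBasis rfl

/-- The orbital Dirac operator `D_G = - i ∑ₖ (ext(eₖ) + int(eₖ)) ∂/∂vₖ` at `x`, where `vₖ` runs through
an orthonormal basis of `𝔪_x^⊥` and `eₖ` is the image of `vₖ` under the isometry
`(f'_x f'_x^*)^{-1/2} f'_x` from `𝔪_x^⊥` onto `T_x(G x) ⊆ T_x M`. For an eigenvector `vₖ` of `f'_x^* f'_x`
outside of the kernel, `eₖ = f'_x vₖ / ‖f'_x vₖ‖`; for the basis vectors in `𝔪_x` the term below is zero. -/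
def orbitalDirac (s : Π y : M, FormAt E y) (x : M) : FormAt E x :=
  (-Complex.I) • ∑ k, cliff (‖γ.orbitDiff x (γ.singularBasis x k)‖⁻¹ • γ.orbitDiff x (γ.singularBasis x k))
    (γ.orbitDeriv x s (γ.singularBasis x k))

end LieMetric

/-- The operator `P` on forms has H-order at most `k + 1` near `x` and its H-cosymbol of that order at
`x`, obtained by freezing the coefficients, is `σ` in `gr(H)_x ⊗ End(Λ^*_x(M))`: near `x`,
`P = ∑ⱼ Φⱼ ∇_{Xⱼ} + Ψ` with a connection `∇`, smooth sections `Xⱼ` of `H (k + 1)` and bundle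
endomorphisms `Φⱼ` and `Ψ`, and `σ = ∑ⱼ [Xⱼ(x)] ⊗ Φⱼ(x)`. -/
def Filtration.HasHCosymbol {n : ℕ} (𝓕 : Filtration E M n)
    (P : (Π y : M, FormAt E y) → Π y : M, FormAt E y) (x : M) (k : Fin n)
    (σ : 𝓕.Gr x ⊗[ℝ] Module.End ℂ (FormAt E x)) : Prop :=
  ∃ (C : FormConnection E M) (m : ℕ) (X : Fin m → Π y : M, TangentSpace 𝓘(ℝ, E) y)
    (hX : ∀ j, 𝓕.IsSection (k + 1) x (X j)) (Φ : Fin m → Π y : M, Module.End ℂ (FormAt E y))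
    (Ψ : Π y : M, Module.End ℂ (FormAt E y)),
    (∀ᶠ y in 𝓝 x, ∀ s : Π y : M, FormAt E y, SmoothForm s →
      P s y = ∑ j, Φ j y (C.nabla y (X j y) s) + Ψ y (s y)) ∧
    σ = ∑ j, 𝓕.cls x k ⟨X j x, (hX j).mem⟩ ⊗ₜ[ℝ] Φ j x

namespace Filtration
variable {n : ℕ} (𝓕 : Filtration E M n) (x : M)

/-- The group law of the osculating group `Gr(H)_x` in exponential coordinates. -/
def grMul : 𝓕.Gr x → 𝓕.Gr x → 𝓕.Gr x :=
  GradedLie.mul (𝓕.osculatingBracket x) (𝓕.degree x)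

variable [Bundle.RiemannianBundle (fun x : M => TangentSpace 𝓘(ℝ, E) x)]

/-- An element of `gr(H)_x ⊗ End(Λ^*_x(M))`, the second factor written in matrices with respect to
the orthonormal basis of `Λ^*_x(M)` given by an orthonormal basis `b` of `T_x M`. -/
def toMatrixSymbol {d : ℕ} (b : OrthonormalBasis (Fin d) ℝ (TangentSpace 𝓘(ℝ, E) x)) :
    𝓕.Gr x ⊗[ℝ] Module.End ℂ (FormAt E x) →ₗ[ℝ]
      𝓕.Gr x ⊗[ℝ] Matrix (Finset (Fin d)) (Finset (Fin d)) ℂ :=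
  TensorProduct.map LinearMap.id
    ((LinearMap.toMatrix (formBasis b.toBasis) (formBasis b.toBasis)).toLinearMap.restrictScalars ℝ)

/-- The Hilbert module `C*(Gr(H)_x) ⊗ Λ^*_x(M)`, the second factor identified with `ℂ^(2^d)` by the
orthonormal basis given by an orthonormal basis of `T_x M`, `d = dim M`. -/
abbrev HMod (d : ℕ) : Type _ := GradedLie.Mod (𝓕.grMul x) (Finset (Fin d))

/-- The graph of `σ` as an operator on `C*(Gr(H)_x) ⊗ Λ^*_x(M)` with domain `C_c^∞(Gr(H)_x) ⊗ Λ^*_x(M)`. -/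
def cosymbolGraph {d : ℕ} (b : OrthonormalBasis (Fin d) ℝ (TangentSpace 𝓘(ℝ, E) x))
    (σ : 𝓕.Gr x ⊗[ℝ] Module.End ℂ (FormAt E x)) : Set (𝓕.HMod x d × 𝓕.HMod x d) :=
  GradedLie.opGraph (𝓕.grMul x) (𝓕.toMatrixSymbol x b σ)

end Filtration

end Manifold

end

/-! Only two features of the cosymbol matter: it is a sum `∑ X_a ⊗ A_a` with left-invariant fields
`X_a` and skew-Hermitian matrices `A_a`, and Lebesgue measure is a two-sided Haar measure of the
osculating group. No ellipticity enters.

The coefficients. Let a smooth function `f` vanish at `x` with real differential `ξ`. Applied to `f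
s`, the presentation `∑ Φ_j ∇_{X_j} + Ψ` and the definition of the orbital Dirac operator lose their
terms of order zero, and comparison gives `∑ ξ(X_j) Φ_j = -i ∑ ξ(f'_x v_k) cliff(e_k)`
(`sum_smul_eq_of_orbitalDirac`). Clifford multiplication is Hermitian, so the right side is
skew-Hermitian. Letting `ξ` run through a dual orthonormal basis and regrouping the sum yields the
`A_a` (`exists_toMatrixSymbol_eq`). A left-invariant field is skew for the inner product of the
group C*-algebra, so `∑ X_a ⊗ A_a` is symmetric (`inner_graphSubmodule`).

Dense range. Let `ψ` be a smooth self-adjoint approximate unit. Applying `σ + il` to the tuples with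
single entry `ψ` gives the rows of a matrix `c` over the group C*-algebra, with `c - c* - 2ilψ = ∑
A_a (X_a ψ + (X_a ψ)*)`. For an even real mollifier the function `Xψ + (Xψ)*` is the derivative of
`ψ` along the left-invariant minus the right-invariant field of `X`. This field vanishes at the
unit, and the factor `η` so gained pays for the `η⁻¹` lost in differentiating: the `L¹` norm stays
bounded, a Friedrichs estimate (`exists_mollifier`). For large `|l|` the imaginary part of `c` is
therefore close to `lψ`, relative to `|l|`. A closed left ideal containing such `c` is everything
(`leftIdeal_eq_top`): with `r = (1 + t c*c)⁻¹` the element `y - y r` lies in the ideal, while `c r`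
is small, which forces `r ψ r` to have norm below one, hence `y r` to be shorter than `y` by a fixed
factor; the Riesz lemma excludes this for a proper ideal.

Regularity. A symmetric operator satisfies `‖(T + iμ)x‖ ≥ |μ| ‖x‖`, so dense ranges become full
ranges for the closure, and a contraction argument moves the parameter from `±l` to `±1`.
Surjectivity of `T ± i` gives self-adjointness as in Hilbert space, and `1 + T² = (T - i)(T + i)` is
then onto (`exists_regular_closure`).

The group. The law is defined by exponentials acting on the Lie algebra extended by its degree
derivation `D`. They form a group because the orbit map of `D` is a bijection and an automorphism
fixing `D` and unipotent for the filtration is trivial (`exists_unipExp_mul`). In orbit coordinates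
left translations are affine and unitriangular, hence preserve Lebesgue measure (`isExpGroup_mul`).
-/

noncomputable section

/-! ### A density criterion for left ideals of C*-algebras -/

namespace CStarDensity

/-- Compress `c - c* ≈ 2ilψ` by `r` on both sides: `r c r` and its adjoint have norm at most `‖c
r‖`, and the error does not grow. -/
lemma norm_conjugate_le {U : Type*} [CStarAlgebra U] {c ψ r : U} {l C : ℝ} (hr : star r = r) (hr1 : ‖r‖ ≤ 1)
    (hc : ‖c - star c - (2 * l * Complex.I) • ψ‖ ≤ 2 * C) :
    |l| * ‖r * ψ * r‖ ≤ ‖c * r‖ + C := by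
  have h1 : (2 * l * Complex.I) • (r * ψ * r) =
      r * (c * r) - star (c * r) * r - r * (c - star c - (2 * l * Complex.I) • ψ) * r := by
    rw [star_mul, hr]
    simp only [mul_sub, sub_mul, mul_smul_comm, smul_mul_assoc, mul_assoc]
    abel
  have h2 : ‖(2 * l * Complex.I) • (r * ψ * r)‖ = 2 * |l| * ‖r * ψ * r‖ := by
    rw [norm_smul]; simp
  have h3 : ‖r * (c * r)‖ ≤ ‖c * r‖ :=
    (norm_mul_le _ _).trans (mul_le_of_le_one_left (norm_nonneg _) hr1)
  have h4 : ‖star (c * r) * r‖ ≤ ‖c * r‖ := by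
    refine (norm_mul_le _ _).trans ?_
    rw [norm_star]
    exact mul_le_of_le_one_right (norm_nonneg _) hr1
  have h5 : ‖r * (c - star c - (2 * l * Complex.I) • ψ) * r‖ ≤ 2 * C := by
    refine le_trans ?_ hc
    refine (norm_mul_le _ _).trans ((mul_le_of_le_one_right (norm_nonneg _) hr1).trans ?_)
    exact (norm_mul_le _ _).trans (mul_le_of_le_one_left (norm_nonneg _) hr1)
  have h6 : 2 * |l| * ‖r * ψ * r‖ ≤ ‖c * r‖ + ‖c * r‖ + 2 * C := by
    rw [← h2, h1]
    exact (norm_sub_le _ _).trans (add_le_add ((norm_sub_le _ _).trans (add_le_add h3 h4)) h5)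
  linarith

section Unital
variable {U : Type*} [CStarAlgebra U] [PartialOrder U] [StarOrderedRing U]

/-- Here `r = (1 + t c*c)⁻¹`. The formula for `1 - r` puts `y (1 - r)` in every left ideal
containing `c`; the last bound comes from `t (c r)*(c r) = r - r²`, estimated crudely by `2`. -/
lemma exists_resolvent (c : U) {t : ℝ} (ht : 0 < t) :
    ∃ r : U, star r = r ∧ ‖r‖ ≤ 1 ∧ 1 - r = t • (r * star c * c) ∧ ‖c * r‖ ^ 2 ≤ 2 / t := by
  set p : U := 1 + t • (star c * c) with hp
  have hp1 : (1 : U) ≤ p := le_add_of_nonneg_right (smul_nonneg ht.le (star_mul_self_nonneg c))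
  have hsa : star p = p := by simp [hp]
  obtain ⟨u, hu⟩ : IsUnit p := CStarAlgebra.isUnit_of_le (1 : U) hp1
  have hrp : (↑u⁻¹ : U) * p = 1 := by rw [← hu]; simp
  have hpr : p * (↑u⁻¹ : U) = 1 := by rw [← hu]; simp
  set r : U := ↑u⁻¹ with hr
  have hrs : star r = r := by
    have h1 : star r * p = 1 := by rw [← hsa, ← star_mul, hpr, star_one]
    calc star r = star r * (p * r) := by rw [hpr, mul_one]
      _ = r := by rw [← mul_assoc, h1, one_mul]
  have h0 : 0 ≤ r := by
    have h1 : r = star r * p * r := by rw [hrs, hrp, one_mul]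
    rw [h1]
    exact star_left_conjugate_nonneg (zero_le_one.trans hp1) r
  have hr1 : ‖r‖ ≤ 1 := by
    rw [CStarAlgebra.norm_le_one_iff_of_nonneg r h0]
    exact CStarAlgebra.inv_le_one (Units.val_le_val.1 (by rw [hu]; exact hp1))
  have hone : 1 - r = t • (r * star c * c) := by
    have h2 : r * p = r + t • (r * star c * c) := by
      rw [hp, mul_add, mul_one, mul_smul_comm, mul_assoc]
    rw [hrp] at h2
    rw [h2]; abel
  refine ⟨r, hrs, hr1, hone, ?_⟩
  have h3 : t • (star (c * r) * (c * r)) = r - r * r := by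
    have h4 : r - r * r = (1 - r) * r := by rw [sub_mul, one_mul]
    rw [h4, hone, star_mul, hrs, smul_mul_assoc]
    simp only [mul_assoc]
  have h5 : t * (‖c * r‖ * ‖c * r‖) ≤ 2 := by
    rw [← CStarRing.norm_star_mul_self, ← Real.norm_of_nonneg ht.le, ← norm_smul, h3]
    calc ‖r - r * r‖ ≤ ‖r‖ + ‖r‖ * ‖r‖ := (norm_sub_le _ _).trans (by gcongr; exact norm_mul_le _ _)
      _ ≤ 1 + 1 * 1 := by gcongr
      _ = 2 := by norm_num
  rw [le_div_iff₀ ht]; nlinarith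

/-- `ψ` is only self-adjoint, so it is averaged with `1`: then `z = (1 + ψ)/2` satisfies `0 ≤ z ≤
1`, hence `z² ≤ z`, and `‖z r‖² = ‖r z² r‖ ≤ ‖r z r‖`. -/
lemma norm_mul_sq_le {ψ r : U} (hψ : star ψ = ψ) (hψ1 : ‖ψ‖ ≤ 1) (hr : star r = r) (hr1 : ‖r‖ ≤ 1) :
    ‖((2 : ℝ)⁻¹ • (1 + ψ)) * r‖ ^ 2 ≤ (1 + ‖r * ψ * r‖) / 2 := by
  set z : U := (2 : ℝ)⁻¹ • (1 + ψ) with hz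
  have hzs : star z = z := by simp [hz, hψ]
  have hle : algebraMap ℝ U ‖ψ‖ ≤ 1 := by
    rw [Algebra.algebraMap_eq_smul_one]
    nth_rewrite 2 [← one_smul ℝ (1 : U)]
    exact smul_le_smul_of_nonneg_right hψ1 zero_le_one
  have h1 : ψ ≤ 1 := (IsSelfAdjoint.le_algebraMap_norm_self hψ).trans hle
  have h2 : -1 ≤ ψ := (neg_le_neg hle).trans (IsSelfAdjoint.neg_algebraMap_norm_le_self hψ)
  have hz0 : 0 ≤ z := smul_nonneg (by norm_num) (by simpa using add_le_add_right h2 (1 : U))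
  have hz1 : z ≤ 1 := by
    have h3 : z ≤ (2 : ℝ)⁻¹ • (1 + 1) := by
      refine smul_le_smul_of_nonneg_left ?_ (by norm_num)
      exact add_le_add le_rfl h1
    refine h3.trans_eq ?_
    rw [smul_add, ← add_smul]; norm_num
  -- `z²` is `√z z √z`, and `z ≤ 1` is conjugated by `√z`.
  have hzz : star z * z ≤ z := by
    rw [hzs]
    have h4 : z * z = CFC.sqrt z * z * CFC.sqrt z := by
      nth_rewrite 1 [← CFC.sqrt_mul_sqrt_self z hz0]
      have : Commute (CFC.sqrt z) z := by
        rw [← CFC.sqrt_mul_sqrt_self z hz0, CFC.sqrt_mul_sqrt_self z hz0]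
        nth_rewrite 2 [← CFC.sqrt_mul_sqrt_self z hz0]
        exact (Commute.refl _).mul_right (Commute.refl _)
      rw [mul_assoc, mul_assoc, this.eq]
    have h5 := star_left_conjugate_le_conjugate hz1 (CFC.sqrt z)
    have h6 : star (CFC.sqrt z) = CFC.sqrt z := (IsSelfAdjoint.of_nonneg (CFC.sqrt_nonneg z)).star_eq
    rw [h6, mul_one, CFC.sqrt_mul_sqrt_self z hz0] at h5
    rw [h4]; exact h5
  have h7 := star_left_conjugate_le_conjugate hzz r
  have h8 : ‖star (z * r) * (z * r)‖ ≤ ‖star r * z * r‖ := by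
    refine CStarAlgebra.norm_le_norm_of_nonneg_of_le (star_mul_self_nonneg _) ?_
    rw [star_mul]; simpa only [mul_assoc] using h7
  have h9 : star r * z * r = (2 : ℝ)⁻¹ • (r * r + r * ψ * r) := by
    rw [hr, hz, mul_smul_comm, smul_mul_assoc, mul_add, mul_one, add_mul]
  rw [h9, norm_smul, CStarRing.norm_star_mul_self] at h8
  have h10 : ‖r * r + r * ψ * r‖ ≤ 1 + ‖r * ψ * r‖ := by
    refine (norm_add_le _ _).trans ?_
    gcongr
    refine (norm_mul_le _ _).trans ?_
    nlinarith [norm_nonneg r]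
  have h11 : ‖(2 : ℝ)⁻¹‖ = 2⁻¹ := by norm_num
  rw [h11] at h8
  nlinarith

end Unital

variable {B : Type*} [NonUnitalCStarAlgebra B]

/-- A closed left ideal containing elements `c` whose imaginary parts are close to `l ψ`,
relative to `|l|`, for `ψ` in an approximate unit, is everything. -/
theorem leftIdeal_eq_top (N : Submodule ℂ B) (hN : IsClosed (N : Set B))
    (hmul : ∀ a, ∀ x ∈ N, a * x ∈ N) {l C : ℝ} (hC : C < |l|)
    (h : ∀ (y : B) (δ : ℝ), 0 < δ → ∃ c ∈ N, ∃ ψ : B, star ψ = ψ ∧ ‖ψ‖ ≤ 1 ∧ ‖y * ψ - y‖ ≤ δ ∧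
      ‖c - star c - (2 * l * Complex.I) • ψ‖ ≤ 2 * C) : N = ⊤ := by
  -- The resolvent `(1 + t c*c)⁻¹` exists only in the unitization, so the estimates are made there.
  let _ : PartialOrder (Unitization ℂ B) := CStarAlgebra.spectralOrder _
  have : StarOrderedRing (Unitization ℂ B) := CStarAlgebra.spectralOrderedRing _
  by_contra hne
  have hex : ∃ x, x ∉ N := by
    by_contra! hh
    exact hne (eq_top_iff.2 fun x _ => hh x)
  have hC0 : 0 ≤ C := by
    obtain ⟨c, -, ψ, -, -, -, hh⟩ := h 0 1 one_pos
    linarith [norm_nonneg (c - star c - (2 * l * Complex.I) • ψ)]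
  have hl : 0 < |l| := lt_of_le_of_lt hC0 hC
  -- `q` is an upper bound, below one, for the relevant norms
  obtain ⟨η, hη, hq⟩ : ∃ η : ℝ, 0 < η ∧ (1 + (η + C) / |l|) / 2 < (1 - η) ^ 2 ∧ η < 1 := by
    have h1 : Filter.Tendsto (fun η : ℝ => (1 + (η + C) / |l|) / 2 - (1 - η) ^ 2) (𝓝 0)
        (𝓝 ((1 + (0 + C) / |l|) / 2 - (1 - 0) ^ 2)) := Continuous.tendsto (by fun_prop) 0
    have h2 : (1 + (0 + C) / |l|) / 2 - (1 - 0) ^ 2 < 0 := by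
      have : C / |l| < 1 := (div_lt_one hl).2 hC
      rw [zero_add]; linarith
    have h3 := (h1.eventually_lt_const h2).filter_mono (nhdsWithin_le_nhds (s := Set.Ioi 0))
    have h4 : ∀ᶠ η in 𝓝[>] (0 : ℝ), η ∈ Set.Ioo (0 : ℝ) 1 := Ioo_mem_nhdsGT one_pos
    obtain ⟨η, h5, h6⟩ := (h3.and h4).exists
    exact ⟨η, h6.1, by linarith, h6.2⟩
  -- `y₀` keeps distance at least `(1 - η/4)‖y₀‖` from `N`; below, `y₀ r` is a point of `y₀ + N` of
  -- norm at most `(1 - η/2)‖y₀‖`.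
  obtain ⟨y₀, hy₀, hy⟩ := riesz_lemma hN hex (r := 1 - η / 4) (by linarith)
  have hy₀0 : 0 < ‖y₀‖ := norm_pos_iff.2 fun h0 => hy₀ (h0 ▸ N.zero_mem)
  obtain ⟨c, hc, ψ, hψ, hψ1, hyψ, hk⟩ := h y₀ (‖y₀‖ * η) (by positivity)
  -- With `t = 2/η²` the resolvent bound becomes `‖c r‖ ≤ η`.
  obtain ⟨t, ht, htη⟩ : ∃ t : ℝ, 0 < t ∧ 2 / t ≤ η ^ 2 :=
    ⟨2 / η ^ 2, by positivity, by rw [div_div_eq_mul_div]; field_simp; exact le_rfl⟩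
  obtain ⟨r, hr, hr1, hr2, hcr⟩ := exists_resolvent (c : Unitization ℂ B) ht
  have hcr' : ‖(c : Unitization ℂ B) * r‖ ≤ η := abs_le_of_sq_le_sq (hcr.trans htη) hη.le |> fun h => by
    simpa using h
  have hk' : ‖(c : Unitization ℂ B) - star (c : Unitization ℂ B) -
      (2 * l * Complex.I) • (ψ : Unitization ℂ B)‖ ≤ 2 * C := by
    rw [← Unitization.inr_star, ← Unitization.inr_smul, ← Unitization.inr_sub, ← Unitization.inr_sub,
      Unitization.norm_inr]
    exact hk
  have hψ' : star (ψ : Unitization ℂ B) = ψ := by rw [← Unitization.inr_star, hψ]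
  have hψ1' : ‖(ψ : Unitization ℂ B)‖ ≤ 1 := by rwa [Unitization.norm_inr]
  have e1 := norm_conjugate_le hr hr1 hk'
  have e2 := norm_mul_sq_le hψ' hψ1' hr hr1
  have e3 : ‖((2 : ℝ)⁻¹ • (1 + (ψ : Unitization ℂ B))) * r‖ ≤ 1 - η := by
    refine le_of_lt (lt_of_pow_lt_pow_left₀ 2 (by linarith [hq.2]) ?_)
    refine lt_of_le_of_lt e2 (lt_of_le_of_lt ?_ hq.1)
    gcongr
    rw [le_div_iff₀ hl, mul_comm]
    exact e1.trans (by gcongr)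
  -- `y₀ r - y₀` is in the ideal
  obtain ⟨w, hw⟩ : ∃ w : B, (w : Unitization ℂ B) = y₀ * r * star (c : Unitization ℂ B) := by
    refine ⟨(y₀ * r * star (c : Unitization ℂ B)).snd, ?_⟩
    -- The scalar part vanishes because `y₀` comes from `B`.
    refine Unitization.ext ?_ rfl
    simp
  have hmem : t • (w * c) ∈ N := by
    have := N.smul_mem (t : ℂ) (hmul w c hc)
    simpa using this
  have e4 : ((y₀ - t • (w * c) : B) : Unitization ℂ B) = y₀ * r := by
    have e5 : r = 1 - t • (r * star (c : Unitization ℂ B) * c) := by rw [← hr2]; abel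
    rw [Unitization.inr_sub, Unitization.inr_smul, Unitization.inr_mul, hw]
    conv_rhs => rw [e5]
    rw [mul_sub, mul_one, mul_smul_comm]
    simp only [mul_assoc]
  have e6 := hy _ hmem
  rw [← Unitization.norm_inr (𝕜 := ℂ) (y₀ - t • (w * c)), e4] at e6
  have e7 : (y₀ : Unitization ℂ B) * r = y₀ * (((2 : ℝ)⁻¹ • (1 + (ψ : Unitization ℂ B))) * r) -
      (2 : ℝ)⁻¹ • (((y₀ * ψ - y₀ : B) : Unitization ℂ B) * r) := by
    rw [Unitization.inr_sub, Unitization.inr_mul, smul_mul_assoc, mul_smul_comm, ← smul_sub, sub_mul,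
      add_mul, one_mul, mul_add, ← mul_assoc]
    module
  have e8 : ‖(y₀ : Unitization ℂ B) * r‖ ≤ ‖y₀‖ * (1 - η) + 2⁻¹ * (‖y₀‖ * η * 1) := by
    rw [e7]
    refine (norm_sub_le _ _).trans (add_le_add ?_ ?_)
    · refine (norm_mul_le _ _).trans ?_
      rw [Unitization.norm_inr]; gcongr
    · rw [norm_smul]
      have : ‖(2 : ℝ)⁻¹‖ = 2⁻¹ := by norm_num
      rw [this]
      gcongr
      refine (norm_mul_le _ _).trans ?_
      rw [Unitization.norm_inr]; gcongr
  nlinarith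

end CStarDensity
end

/-! ### ### From left ideals of matrices to submodules of the standard Hilbert module -/

noncomputable section

namespace CStarDensity
variable {A : Type*} [NonUnitalCStarAlgebra A] [PartialOrder A] [StarOrderedRing A] {J : Type*} [Fintype J]

/-- The C*-norm of a matrix is an operator norm; this crude bound is what carries entrywise
estimates into the matrix algebra. -/
lemma norm_cstarMatrix_le (M : CStarMatrix J J A) : ‖M‖ ≤ ∑ i, ∑ j, ‖M i j‖ := by
  have h0 : 0 ≤ ∑ i, ∑ j, ‖M i j‖ := by positivity
  refine CStarMatrix.norm_le_of_forall_inner_le (C := ⟨_, h0⟩) fun v w => ?_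
  rw [WithCStarModule.pi_inner]
  refine (norm_sum_le _ _).trans ?_
  have h1 : ∀ j, ‖inner A (w j) ((CStarMatrix.toCLM M v) j)‖ ≤ ∑ i, ‖M i j‖ * ‖v‖ * ‖w‖ := by
    intro j
    rw [CStarMatrix.toCLM_apply_eq_sum, WithCStarModule.inner_def]
    simp only [WithCStarModule.equiv_symm_pi_apply, Finset.sum_mul]
    refine (norm_sum_le _ _).trans (Finset.sum_le_sum fun i _ => ?_)
    calc ‖v i * M i j * star (w j)‖ ≤ ‖v i‖ * ‖M i j‖ * ‖w j‖ := by
          refine (norm_mul_le _ _).trans ?_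
          rw [norm_star]
          gcongr; exact norm_mul_le _ _
      _ ≤ ‖v‖ * ‖M i j‖ * ‖w‖ := by
          gcongr <;> exact WithCStarModule.norm_apply_le_norm _ _
      _ = ‖M i j‖ * ‖v‖ * ‖w‖ := by ring
  refine (Finset.sum_le_sum fun j _ => h1 j).trans ?_
  rw [Finset.sum_comm]
  simp only [← Finset.sum_mul]
  exact le_rfl

lemma sum_mod_apply {B K ι : Type*} [NonUnitalCStarAlgebra B] (s : Finset ι) (f : ι → WithCStarModule B (K → B))
    (k : K) : (∑ j ∈ s, f j) k = ∑ j ∈ s, f j k :=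
  map_sum (LinearMap.proj (R := ℂ) (φ := fun _ : K => B) k ∘ₗ
    (WithCStarModule.linearEquiv ℂ B (K → B)).toLinearMap) f s

/-- A row of a matrix, in the standard Hilbert module. -/
def row (i : J) : CStarMatrix J J A →ₗ[ℂ] (WithCStarModule A (J → A)) where
  toFun M := (WithCStarModule.equiv A (J → A)).symm (M i)
  map_add' _ _ := rfl
  map_smul' _ _ := rfl

lemma continuous_row (i : J) : Continuous (row i : CStarMatrix J J A → WithCStarModule A (J → A)) := by
  refine AddMonoidHomClass.continuous_of_bound (row i : CStarMatrix J J A →ₗ[ℂ] (WithCStarModule A (J → A)))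
    (Fintype.card J) fun M => ?_
  have h1 : ‖row i M‖ ≤ ∑ j, ‖(row i M) j‖ := WithCStarModule.pi_norm_le_sum_norm _
  refine h1.trans ((Finset.sum_le_card_nsmul _ _ ‖M‖ fun j _ => ?_).trans ?_)
  · exact CStarMatrix.norm_entry_le_norm (M := M) (i := i) (j := j)
  · simp

variable [DecidableEq J]

/-- Scalar matrices, as a homomorphism. -/
def scalarMatrix (J A : Type*) [Fintype J] [DecidableEq J] [NonUnitalCStarAlgebra A] [PartialOrder A]
    [StarOrderedRing A] : A →⋆ₙₐ[ℂ] CStarMatrix J J A where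
  toFun a := CStarMatrix.ofMatrix (Matrix.diagonal fun _ => a)
  map_smul' c a := by ext i j; by_cases h : i = j <;> simp [h]
  map_zero' := by ext i j; simp
  map_add' a b := by ext i j; by_cases h : i = j <;> simp [h]
  map_mul' a b := by
    ext i j
    rw [CStarMatrix.mul_apply]
    simp [Matrix.diagonal_apply]
  map_star' a := by
    ext i j
    rw [CStarMatrix.star_apply]
    by_cases h : i = j
    · simp [h]
    · simp [h, Ne.symm h]

lemma scalarMatrix_apply (a : A) (i j : J) : scalarMatrix J A a i j = if i = j then a else 0 := rfl

lemma norm_scalarMatrix_le (a : A) : ‖scalarMatrix J A a‖ ≤ ‖a‖ :=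
  NonUnitalStarAlgHom.norm_apply_le _ a

/-- A density criterion for submodules of the standard Hilbert module. -/
theorem submodule_eq_top (L : Submodule ℂ (WithCStarModule A (J → A))) (hL : IsClosed (L : Set (WithCStarModule A (J → A))))
    (hmul : ∀ (a : A), ∀ x ∈ L, a • x ∈ L) {l C : ℝ} (hC : C < |l|)
    (h : ∀ (s : Finset A) (δ : ℝ), 0 < δ → ∃ ψ : A, star ψ = ψ ∧ ‖ψ‖ ≤ 1 ∧
      (∀ y ∈ s, ‖y * ψ - y‖ ≤ δ) ∧ ∃ c : J → J → A,
      (∀ i, (WithCStarModule.equiv A (J → A)).symm (c i) ∈ L) ∧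
      ∑ i, ∑ j, ‖c i j - star (c j i) - (2 * l * Complex.I) • (if i = j then ψ else 0)‖ ≤ 2 * C) :
    L = ⊤ := by
  -- Matrices with all rows in `L`: a left ideal, since row `i` of `a * x` is the combination of the
  -- rows of `x` with coefficients `a i j`.
  let N : Submodule ℂ (CStarMatrix J J A) := ⨅ i, L.comap (row i)
  have hNmem : ∀ M, M ∈ N ↔ ∀ i, row i M ∈ L := fun M => by simp [N]
  have hN : N = ⊤ := by
    refine leftIdeal_eq_top N ?_ ?_ hC ?_
    · have : (N : Set (CStarMatrix J J A)) = ⋂ i, row i ⁻¹' (L : Set (WithCStarModule A (J → A))) := by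
        ext M; simp [hNmem]
      rw [this]
      exact isClosed_iInter fun i => hL.preimage (continuous_row i)
    · intro a x hx
      rw [hNmem] at hx ⊢
      intro i
      have : row i (a * x) = ∑ j, a i j • row j x := by
        refine WithCStarModule.ext fun k => ?_
        rw [sum_mod_apply]
        exact CStarMatrix.mul_apply
      rw [this]
      exact L.sum_mem fun j _ => hmul _ _ (hx j)
    · intro y δ hδ
      classical
      -- The approximate unit is required to work for all entries of `y` at once; the tolerance
      -- leaves room for the sum over `|J|²` entries, the `+ 1` covering an empty `J`.
      obtain ⟨ψ, h1, h2, h3, c, h4, h5⟩ := h (Finset.univ.image fun p : J × J => y p.1 p.2)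
        (δ / (Fintype.card J * Fintype.card J + 1)) (by positivity)
      refine ⟨CStarMatrix.ofMatrix c, (hNmem _).2 h4, scalarMatrix J A ψ, ?_, ?_, ?_, ?_⟩
      · rw [← map_star, h1]
      · exact (norm_scalarMatrix_le ψ).trans h2
      · refine (norm_cstarMatrix_le _).trans ?_
        have h6 : ∀ i j, ‖(y * scalarMatrix J A ψ - y) i j‖ ≤
            δ / (Fintype.card J * Fintype.card J + 1) := by
          intro i j
          have : (y * scalarMatrix J A ψ - y) i j = y i j * ψ - y i j := by
            rw [CStarMatrix.sub_apply, CStarMatrix.mul_apply]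
            simp [scalarMatrix_apply]
          rw [this]
          exact h3 _ (Finset.mem_image.2 ⟨(i, j), Finset.mem_univ _, rfl⟩)
        refine (Finset.sum_le_sum fun i _ => Finset.sum_le_sum fun j _ => h6 i j).trans ?_
        simp only [Finset.sum_const, Finset.card_univ, nsmul_eq_mul]
        rw [← mul_assoc, mul_div_assoc', div_le_iff₀ (by positivity)]
        nlinarith
      · refine (norm_cstarMatrix_le _).trans (le_of_eq_of_le ?_ h5)
        rfl
  rw [eq_top_iff]
  rintro x -
  rcases isEmpty_or_nonempty J with hJ | ⟨⟨i⟩⟩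
  · have : x = 0 := WithCStarModule.ext fun k => (hJ.false k).elim
    rw [this]; exact L.zero_mem
  · have h1 : (CStarMatrix.ofMatrix fun _ => WithCStarModule.equiv A (J → A) x) ∈ N := by
      rw [hN]; trivial
    exact (hNmem _).1 h1 i

end CStarDensity
end

noncomputable section

/-! ### Selfadjoint regular closures of symmetric operators -/

namespace HilbertModule
variable {A : Type*} {E : Type*} [NonUnitalCStarAlgebra A] [PartialOrder A] [StarOrderedRing A]
  [NormedAddCommGroup E] [NormedSpace ℂ E] [SMul A E] [CStarModule A E]

lemma eq_zero_of_inner_dense {s : Set E} (hs : Dense s) {y : E} (h : ∀ x ∈ s, inner A y x = 0) : y = 0 := by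
  have h1 : (fun x => inner A y x) = fun _ => (0 : A) :=
    Continuous.ext_on hs (CStarModule.continuous_inner.comp (by fun_prop : Continuous fun x : E => (y, x)))
      continuous_const h
  exact (CStarModule.inner_self (A := A)).1 (congrFun h1 y)

lemma inner_graph_closure {S : Submodule ℂ (E × E)}
    (hsym : ∀ p ∈ S, ∀ q ∈ S, inner A p.2 q.1 = inner A p.1 q.2) :
    ∀ p ∈ S.topologicalClosure, ∀ q ∈ S.topologicalClosure, inner A p.2 q.1 = inner A p.1 q.2 := by
  have hc : IsClosed {r : (E × E) × (E × E) | inner A r.1.2 r.2.1 = inner A r.1.1 r.2.2} := by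
    refine isClosed_eq ?_ ?_
    · exact CStarModule.continuous_inner.comp
        (by fun_prop : Continuous fun r : (E × E) × (E × E) => (r.1.2, r.2.1))
    · exact CStarModule.continuous_inner.comp
        (by fun_prop : Continuous fun r : (E × E) × (E × E) => (r.1.1, r.2.2))
  intro p hp q hq
  have h1 : (p, q) ∈ closure ((S : Set (E × E)) ×ˢ (S : Set (E × E))) := by
    rw [closure_prod_eq]; exact ⟨hp, hq⟩
  exact closure_minimal (fun r hr => hsym _ hr.1 _ hr.2) hc h1

/-- Symmetry cancels the cross terms, so `⟪Tx + iμx, Tx + iμx⟫ = ⟪Tx, Tx⟫ + μ²⟪x, x⟫` as positive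
elements of `A`. -/
lemma abs_mul_norm_le {p : E × E} (hp : inner A p.2 p.1 = inner A p.1 p.2) (μ : ℝ) :
    |μ| * ‖p.1‖ ≤ ‖p.2 + (Complex.I * μ) • p.1‖ := by
  have h1 : inner A (p.2 + (Complex.I * μ) • p.1) (p.2 + (Complex.I * μ) • p.1) =
      inner A p.2 p.2 + (μ * μ : ℝ) • inner A p.1 p.1 := by
    simp only [CStarModule.inner_add_left, CStarModule.inner_add_right, CStarModule.inner_smul_left_complex,
      CStarModule.inner_smul_right_complex, smul_add, hp, smul_smul]
    have h2 : star (Complex.I * μ) = -(Complex.I * μ) := by simp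
    have h3 : Complex.I * μ * -(Complex.I * μ) = ((μ * μ : ℝ) : ℂ) := by
      push_cast; linear_combination (-(μ : ℂ) * μ) * Complex.I_mul_I
    rw [h2, ← Complex.coe_smul (μ * μ)]
    rw [h3]
    module
  have h5 : ‖(μ * μ : ℝ) • inner A p.1 p.1‖ ≤ ‖p.2 + (Complex.I * μ) • p.1‖ ^ 2 := by
    rw [CStarModule.norm_sq_eq A, h1]
    refine CStarAlgebra.norm_le_norm_of_nonneg_of_le
      (smul_nonneg (mul_self_nonneg μ) CStarModule.inner_self_nonneg) ?_
    exact le_add_of_nonneg_left CStarModule.inner_self_nonneg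
  rw [norm_smul, ← CStarModule.norm_sq_eq A, Real.norm_of_nonneg (mul_self_nonneg μ)] at h5
  refine abs_le_of_sq_le_sq' ?_ (norm_nonneg _) |>.2
  rw [mul_pow, sq_abs]; nlinarith

variable [CompleteSpace E]

/-- `T + iμ` is bounded below on the closed, hence complete, graph, so its range is closed. -/
lemma range_of_dense {G : Submodule ℂ (E × E)} (hG : IsClosed (G : Set (E × E)))
    (hsym : ∀ p ∈ G, ∀ q ∈ G, inner A p.2 q.1 = inner A p.1 q.2) {μ : ℝ} (hμ : 1 ≤ |μ|)
    (hd : Dense {w | ∃ p ∈ G, w = p.2 + (Complex.I * μ) • p.1}) (w : E) :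
    ∃ p ∈ G, w = p.2 + (Complex.I * μ) • p.1 := by
  have : CompleteSpace G := hG.completeSpace_coe
  let φ : G →L[ℂ] E := (ContinuousLinearMap.snd ℂ E E + (Complex.I * μ) • ContinuousLinearMap.fst ℂ E E) ∘L
    G.subtypeL
  have hφ : ∀ p : G, φ p = p.1.2 + (Complex.I * μ) • p.1.1 := fun p => rfl
  -- The constant `2` comes from `‖Tx‖ ≤ ‖(T + iμ)x‖ + |μ|‖x‖ ≤ 2‖(T + iμ)x‖`.
  have hanti : AntilipschitzWith 2 φ := by
    refine φ.antilipschitz_of_bound fun p => ?_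
    have h1 := abs_mul_norm_le (hsym p p.2 p p.2) μ
    rw [hφ]
    set a := ‖p.1.2 + (Complex.I * μ) • p.1.1‖
    have h2 : ‖(Complex.I * μ) • p.1.1‖ = |μ| * ‖p.1.1‖ := by simp [norm_smul]
    have h3 : ‖p.1.2‖ ≤ a + |μ| * ‖p.1.1‖ := by
      rw [← h2]
      calc ‖p.1.2‖ = ‖(p.1.2 + (Complex.I * μ) • p.1.1) - (Complex.I * μ) • p.1.1‖ := by simp
        _ ≤ _ := norm_sub_le _ _
    have h4 : ‖p.1.1‖ ≤ |μ| * ‖p.1.1‖ := le_mul_of_one_le_left (norm_nonneg _) hμ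
    have h5 : ‖p‖ = max ‖p.1.1‖ ‖p.1.2‖ := rfl
    have h6 : 0 ≤ a := norm_nonneg _
    rw [h5, max_le_iff]
    constructor <;> push_cast <;> linarith
  have hcl := hanti.isClosed_range φ.uniformContinuous
  have hr : Set.range φ = {w | ∃ p ∈ G, w = p.2 + (Complex.I * μ) • p.1} := by
    ext w
    constructor
    · rintro ⟨p, rfl⟩; exact ⟨p, p.2, rfl⟩
    · rintro ⟨p, hp, rfl⟩; exact ⟨⟨p, hp⟩, rfl⟩
  have h7 : Set.range φ = Set.univ := by
    rw [← hcl.closure_eq, hr]; exact hd.closure_eq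
  have h8 : w ∈ Set.range φ := h7 ▸ Set.mem_univ w
  rw [hr] at h8; exact h8

/-- The inverse `R` of `T + iμ` is `1/|μ|`-Lipschitz, so `u ↦ w + i(μ - ν) R u` is a contraction,
and its fixed point `u` gives the solution `R u` of `(T + iν) x = w`. This brings the large
parameter down to `±1`. -/
lemma range_of_range {G : Submodule ℂ (E × E)}
    (hsym : ∀ p ∈ G, ∀ q ∈ G, inner A p.2 q.1 = inner A p.1 q.2) {μ ν : ℝ} (hμ : |μ - ν| < |μ|)
    (hd : ∀ w, ∃ p ∈ G, w = p.2 + (Complex.I * μ) • p.1) (w : E) :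
    ∃ p ∈ G, w = p.2 + (Complex.I * ν) • p.1 := by
  choose R hR hR' using hd
  have hμ0 : 0 < |μ| := (abs_nonneg _).trans_lt hμ
  let f : E → E := fun w' => w + (Complex.I * (μ - ν : ℝ)) • (R w').1
  have hf : ContractingWith (Real.toNNReal (|μ - ν| / |μ|)) f := by
    constructor
    · rw [← NNReal.coe_lt_coe, Real.coe_toNNReal _ (by positivity)]
      simpa using (div_lt_one hμ0).2 hμ
    · refine LipschitzWith.of_dist_le_mul fun u v => ?_
      rw [Real.coe_toNNReal _ (by positivity), dist_eq_norm, dist_eq_norm]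
      have h1 := abs_mul_norm_le (hsym _ (G.sub_mem (hR u) (hR v)) _ (G.sub_mem (hR u) (hR v))) μ
      have h2 : (R u - R v).2 + (Complex.I * μ) • (R u - R v).1 = u - v := by
        conv_rhs => rw [hR' u, hR' v]
        simp only [Prod.fst_sub, Prod.snd_sub, smul_sub]
        abel
      rw [h2] at h1
      have h3 : f u - f v = (Complex.I * (μ - ν : ℝ)) • (R u - R v).1 := by
        simp only [f, Prod.fst_sub, smul_sub]; abel
      rw [h3, norm_smul, norm_mul, Complex.norm_I, one_mul, Complex.norm_real, Real.norm_eq_abs,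
        div_mul_eq_mul_div, mul_div_assoc]
      refine mul_le_mul_of_nonneg_left ?_ (abs_nonneg _)
      rw [le_div_iff₀ hμ0, mul_comm]; exact h1
  set u := hf.fixedPoint f
  have hu : f u = u := hf.fixedPoint_isFixedPt
  refine ⟨R u, hR u, ?_⟩
  have h4 : w = u - (Complex.I * (μ - ν : ℝ)) • (R u).1 := by
    rw [eq_sub_iff_add_eq]; exact hu
  rw [h4]
  nth_rewrite 1 [hR' u]
  push_cast
  module

/-- A symmetric densely defined operator `S` (given by its graph), such that `S ± i l` have dense range
for some `l ≥ 1`, is closable with selfadjoint regular closure. -/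
theorem exists_regular_closure (S : Submodule ℂ (E × E))
    (hsym : ∀ p ∈ S, ∀ q ∈ S, inner A p.2 q.1 = inner A p.1 q.2)
    (hdom : Dense {x : E | ∃ y, (x, y) ∈ S})
    (hcont : ∀ a : A, Continuous fun x : E => a • x)
    (hsmul : ∀ (a : A), ∀ p ∈ S, (a • p.1, a • p.2) ∈ S.topologicalClosure)
    {l : ℝ} (hl : 1 ≤ l) (hp : Dense {w | ∃ p ∈ S, w = p.2 + (Complex.I * l) • p.1})
    (hm : Dense {w | ∃ p ∈ S, w = p.2 - (Complex.I * l) • p.1}) :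
    ∃ T : E →ₗ.[ℂ] E, (T.graph : Set (E × E)) = closure (S : Set (E × E)) ∧
      IsSelfAdjointOp A T ∧ IsRegularOp A T := by
  set G := S.topologicalClosure with hGdef
  have hSG : S ≤ G := S.le_topologicalClosure
  have hG : IsClosed (G : Set (E × E)) := S.isClosed_topologicalClosure
  have hGs := inner_graph_closure hsym
  -- Closability: if `(0, y)` is in the closure, symmetry makes `y` orthogonal to the dense domain.
  have hsv : ∀ x ∈ G, x.1 = 0 → x.2 = 0 := by
    intro x hx hx0
    refine eq_zero_of_inner_dense (A := A) hdom ?_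
    rintro u ⟨v, huv⟩
    have := hGs x hx (u, v) (hSG huv)
    rw [hx0] at this
    simpa using this
  have hl' : |l| = l := abs_of_nonneg (by linarith)
  have r1 : ∀ w, ∃ p ∈ G, w = p.2 + (Complex.I * (l : ℝ)) • p.1 :=
    range_of_dense hG hGs (by rw [hl']; exact hl)
      (hp.mono (by rintro w ⟨p, h, h'⟩; exact ⟨p, hSG h, h'⟩))
  have r2 : ∀ w, ∃ p ∈ G, w = p.2 + (Complex.I * (-l : ℝ)) • p.1 :=
    range_of_dense hG hGs (by rw [abs_neg, hl']; exact hl)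
      (hm.mono (by rintro w ⟨p, h, h'⟩; exact ⟨p, hSG h, by rw [h']; push_cast; module⟩))
  have s1 : ∀ w, ∃ p ∈ G, w = p.2 + (Complex.I * (1 : ℝ)) • p.1 :=
    range_of_range hGs (by rw [abs_of_nonneg (by linarith), hl']; linarith) r1
  have s2 : ∀ w, ∃ p ∈ G, w = p.2 + (Complex.I * (-1 : ℝ)) • p.1 :=
    range_of_range hGs (by rw [abs_neg, hl', abs_of_nonpos (by linarith)]; linarith) r2
  set T := G.toLinearPMap with hT
  have hTG : T.graph = G := Submodule.toLinearPMap_graph_eq G hsv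
  have hmemG : ∀ x : T.domain, ((x : E), T x) ∈ G := fun x => hTG ▸ T.mem_graph x
  have hGT : ∀ p ∈ G, ∃ x : T.domain, (x : E) = p.1 ∧ T x = p.2 := by
    intro p hp
    rw [← hTG] at hp
    obtain ⟨x, h1, h2⟩ := (T.mem_graph_iff).1 hp
    exact ⟨x, h1, h2⟩
  have hsa : IsSelfAdjointOp A T := by
    intro y z
    constructor
    · intro h
      -- Solve `(T + i) p.1 = z + i y`. The difference `y - p.1` is then orthogonal to the range of
      -- `T - i`, which is the whole module.
      obtain ⟨p, hpG, hpw⟩ := s1 (z + (Complex.I * (1 : ℝ)) • y)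
      have key : y - p.1 = 0 := by
        refine eq_zero_of_inner_dense (A := A) dense_univ fun u _ => ?_
        obtain ⟨q, hq, rfl⟩ := s2 u
        obtain ⟨x, hx1, hx2⟩ := hGT q hq
        have h1 := h x
        rw [hx1, hx2] at h1
        have h2 := hGs q hq p hpG
        have h3 : inner A q.2 (y - p.1) = inner A q.1 (z - p.2) := by
          rw [CStarModule.inner_sub_right, CStarModule.inner_sub_right, h1, h2]
        have h4 : z - p.2 = -(Complex.I * (1 : ℝ)) • (y - p.1) := by
          have : z = p.2 + (Complex.I * (1 : ℝ)) • p.1 - (Complex.I * (1 : ℝ)) • y := by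
            rw [← hpw]; abel
          rw [this]; module
        have h5 : inner A (q.2 + (Complex.I * (-1 : ℝ)) • q.1) (y - p.1) = 0 := by
          rw [CStarModule.inner_add_left, h3, h4, CStarModule.inner_smul_left_complex,
            CStarModule.inner_smul_right_complex]
          simp
        rw [← CStarModule.star_inner, h5, star_zero]
      have hy : y = p.1 := sub_eq_zero.1 key
      have hz : z = p.2 := by
        rw [hy] at hpw
        exact add_right_cancel hpw
      rw [hTG, hy, hz]; exact hpG
    · intro h x
      rw [hTG] at h
      exact hGs _ (hmemG x) _ h
  have hdT : Dense (T.domain : Set E) := by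
    refine hdom.mono ?_
    rintro u ⟨v, huv⟩
    obtain ⟨x, hx, -⟩ := hGT _ (hSG huv)
    have h0 : (x : E) = u := hx
    exact h0 ▸ x.2
  refine ⟨T, ?_, hsa, ?_, ?_, hdT, ?_, ?_⟩
  · rw [hTG]; rfl
  · intro a x
    have h1 : ∀ p ∈ G, (a • p.1, a • p.2) ∈ G := by
      intro p hp
      have hc : Continuous fun p : E × E => (a • p.1, a • p.2) :=
        ((hcont a).comp continuous_fst).prodMk ((hcont a).comp continuous_snd)
      have := map_mem_closure hc hp (t := (G : Set (E × E))) fun q hq => hsmul a q hq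
      rwa [hG.closure_eq] at this
    obtain ⟨y, hy1, hy2⟩ := hGT _ (h1 _ (hmemG x))
    simp only at hy1 hy2
    refine ⟨hy1 ▸ y.2, ?_⟩
    rw [← hy2]
    congr 1
    exact Subtype.ext hy1.symm
  · change IsClosed (T.graph : Set (E × E))
    rw [hTG]; exact hG
  · refine hdT.mono fun u hu => ⟨T ⟨u, hu⟩, (hsa _ _).2 ?_⟩
    exact T.mem_graph ⟨u, hu⟩
  · have : {w : E | ∃ (x : T.domain) (z : E), IsAdjointPair A T (T x) z ∧ w = x + z} = Set.univ := by
      refine Set.eq_univ_of_forall fun w => ?_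
      -- Factor `1 + T² = (T - i)(T + i)`: first solve `w = (T - i) p.1`, then `p.1 = (T + i) q.1`.
      obtain ⟨p, hpG, hpw⟩ := s2 w
      obtain ⟨q, hqG, hqw⟩ := s1 p.1
      obtain ⟨x, hx1, hx2⟩ := hGT q hqG
      refine ⟨x, p.2 - Complex.I • q.2, (hsa _ _).2 ?_, ?_⟩
      · have h1 := G.sub_mem hpG (G.smul_mem Complex.I hqG)
        have h2 : T x = (p - Complex.I • q).1 := by
          rw [hx2, Prod.fst_sub, Prod.smul_fst, hqw]
          push_cast; module
        rw [hTG, h2]; exact h1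
      · rw [hpw, hx1, hqw, smul_add, smul_smul]
        have : Complex.I * ((-1 : ℝ) : ℂ) * (Complex.I * ((1 : ℝ) : ℂ)) = 1 := by
          push_cast; linear_combination (-1 : ℂ) * Complex.I_mul_I
        rw [this]
        push_cast; module
    rw [this]; exact dense_univ

end HilbertModule
end

noncomputable section

/-! ### Unitriangular maps of a filtered vector space -/

namespace GradedLie
variable {V : Type*} [NormedAddCommGroup V] [NormedSpace ℝ V]

/-- `f` is the identity up to terms of higher filtration. -/
def UniTri (F : ℕ → Submodule ℝ V) (f : V → V) : Prop :=
  ∀ i X Z, Z ∈ F i → f (X + Z) - f X - Z ∈ F (i + 1)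

section UniTri
variable {F : ℕ → Submodule ℝ V} {f g : V → V}

lemma UniTri.sub_mem (hF : Antitone F) (hf : UniTri F f) {i : ℕ} {X Z : V} (hZ : Z ∈ F i) :
    f (X + Z) - f X ∈ F i := by
  have h := (F i).add_mem (hF (Nat.le_succ i) (hf i X Z hZ)) hZ
  rwa [sub_add_cancel] at h

lemma UniTri.comp (hF : Antitone F) (hf : UniTri F f) (hg : UniTri F g) : UniTri F (f ∘ g) := by
  intro i X Z hZ
  have h1 := hg i X Z hZ
  have h2 := hf i (g X) _ (hg.sub_mem hF (X := X) hZ)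
  rw [add_sub_cancel] at h2
  have h3 := (F (i + 1)).add_mem h1 h2
  have h4 : g (X + Z) - g X - Z + (f (g (X + Z)) - f (g X) - (g (X + Z) - g X)) =
      f (g (X + Z)) - f (g X) - Z := by abel
  rwa [h4] at h3

/-- Climbs the filtration: if `Y - X ∈ F j`, then `f Y - f X` and `Y - X` agree modulo `F (j + 1)`.
-/
lemma UniTri.mem_of_sub_mem (hone : F 0 = ⊤) (hf : UniTri F f) {X Y : V} {i : ℕ}
    (h : f Y - f X ∈ F i) (hF : Antitone F) : Y - X ∈ F i := by
  have key : ∀ j ≤ i, Y - X ∈ F j := by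
    intro j
    induction j with
    | zero => intro _; rw [hone]; trivial
    | succ j ih =>
      intro hj
      have h1 := hf j X (Y - X) (ih (by omega))
      rw [add_sub_cancel] at h1
      have h2 := (F (j + 1)).sub_mem (hF hj h) h1
      rwa [sub_sub_cancel] at h2
  exact key i le_rfl

/-- The iteration converging to the inverse of `f`. -/
def invIter (f : V → V) : ℕ → V → V
  | 0 => fun _ => 0
  | k + 1 => fun W => invIter f k W + (W - f (invIter f k W))

/-- Adding the current error to the argument moves the value of `f` by that error up to one
filtration step more, so each iteration gains a step. -/
lemma sub_invIter_mem (hone : F 0 = ⊤) (hf : UniTri F f) (W : V) (k : ℕ) :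
    W - f (invIter f k W) ∈ F k := by
  induction k with
  | zero => rw [hone]; trivial
  | succ k ih =>
    have h1 := hf k (invIter f k W) _ ih
    rw [invIter]
    have h2 := (F (k + 1)).neg_mem h1
    convert h2 using 1
    abel

lemma contDiff_invIter (hf : ContDiff ℝ ∞ f) (k : ℕ) : ContDiff ℝ ∞ (invIter f k) := by
  induction k with
  | zero => exact contDiff_const
  | succ k ih => exact ih.add (contDiff_id.sub (hf.comp ih))

/-- Unitriangular maps are bijective, with unitriangular inverse. -/
lemma UniTri.exists_inverse {N : ℕ} (hF : Antitone F) (hone : F 0 = ⊤) (hN : F N = ⊥)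
    (hf : UniTri F f) (hs : ContDiff ℝ ∞ f) :
    ∃ g : V → V, ContDiff ℝ ∞ g ∧ UniTri F g ∧ (∀ X, f (g X) = X) ∧ ∀ X, g (f X) = X := by
  have h1 : ∀ W, f (invIter f N W) = W := by
    intro W
    have h := sub_invIter_mem hone hf W N
    rw [hN, Submodule.mem_bot] at h
    exact (sub_eq_zero.1 h).symm
  have hinj : Function.Injective f := by
    intro X Y h
    have h2 := hf.mem_of_sub_mem hone (X := X) (Y := Y) (i := N) (by rw [h, sub_self]; exact zero_mem _) hF
    rw [hN, Submodule.mem_bot] at h2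
    exact (sub_eq_zero.1 h2).symm
  refine ⟨invIter f N, contDiff_invIter hs N, ?_, h1, fun X => hinj (h1 _)⟩
  intro i X Z hZ
  set g := invIter f N
  have h2 : g (X + Z) - g X ∈ F i := by
    refine hf.mem_of_sub_mem hone ?_ hF
    rw [h1, h1, add_sub_cancel_left]; exact hZ
  have h3 := hf i (g X) _ h2
  rw [add_sub_cancel, h1, h1, add_sub_cancel_left] at h3
  have h4 := (F (i + 1)).neg_mem h3
  rwa [neg_sub] at h4

variable [FiniteDimensional ℝ V]

/-- The difference quotients lie in `F (i + 1)`, a closed subspace since the dimension is finite. -/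
lemma UniTri.fderiv_sub_mem (hf : UniTri F f) (hs : Differentiable ℝ f) (X : V) {i : ℕ} {Z : V}
    (hZ : Z ∈ F i) : fderiv ℝ f X Z - Z ∈ F (i + 1) := by
  have h1 : HasDerivAt (fun t : ℝ => f (X + t • Z) - t • Z) (fderiv ℝ f X Z - Z) 0 := by
    have h2 : HasDerivAt (fun t : ℝ => X + t • Z) Z 0 := by
      simpa using ((hasDerivAt_id (0 : ℝ)).smul_const Z).const_add X
    have h3 : HasDerivAt (fun t : ℝ => t • Z) Z 0 := by
      simpa using (hasDerivAt_id (0 : ℝ)).smul_const Z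
    have h4 : HasFDerivAt f (fderiv ℝ f X) (X + (0 : ℝ) • Z) := by
      simpa using (hs X).hasFDerivAt
    exact (h4.comp_hasDerivAt (0 : ℝ) h2).sub h3
  have hcl : IsClosed (F (i + 1) : Set V) := (F (i + 1)).closed_of_finiteDimensional
  have h5 := h1.tendsto_slope
  refine hcl.mem_of_tendsto h5 (Filter.Eventually.of_forall fun t => ?_)
  rw [slope_def_module]
  refine (F (i + 1)).smul_mem _ ?_
  have h6 := hf i X (t • Z) ((F i).smul_mem t hZ)
  simpa [sub_right_comm] using h6

/-- `1 - L` is nilpotent, so its characteristic polynomial is a power of `X`; its value at `1` is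
`det L`. -/
lemma det_eq_one_of_sub_mem {N : ℕ} (hone : F 0 = ⊤) (hN : F N = ⊥) (L : V →ₗ[ℝ] V)
    (hL : ∀ i, ∀ Z ∈ F i, L Z - Z ∈ F (i + 1)) : LinearMap.det L = 1 := by
  have h1 : ∀ k Z, ((L - 1) ^ k) Z ∈ F k := by
    intro k
    induction k with
    | zero => intro Z; rw [hone]; trivial
    | succ k ih =>
      intro Z
      rw [pow_succ', Module.End.mul_apply]
      exact hL k _ (ih Z)
  have hnil : IsNilpotent (1 - L) := by
    have : IsNilpotent (L - 1) := ⟨N, LinearMap.ext fun Z => by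
      have := h1 N Z
      rw [hN, Submodule.mem_bot] at this
      exact this⟩
    rw [← neg_sub]; exact this.neg
  have h2 := hnil.charpoly_eq_X_pow_finrank
  have h3 : LinearMap.det L = (LinearMap.charpoly (1 - L)).eval 1 := by
    rw [LinearMap.eval_charpoly]
    simp
  rw [h3, h2]; simp

/-- Unitriangular smooth maps preserve the Lebesgue measure. -/
lemma UniTri.measurePreserving {N : ℕ} [MeasurableSpace V] [BorelSpace V]
    (hF : Antitone F) (hone : F 0 = ⊤) (hN : F N = ⊥)
    (hf : UniTri F f) (hs : ContDiff ℝ ∞ f) :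
    MeasureTheory.MeasurePreserving f (MeasureTheory.Measure.addHaar (G := V))
      MeasureTheory.Measure.addHaar := by
  obtain ⟨g, hgs, hg, hfg, hgf⟩ := hf.exists_inverse hF hone hN hs
  have hd := hs.differentiable (by simp)
  refine ⟨hs.continuous.measurable, ?_⟩
  ext s hsm
  rw [MeasureTheory.Measure.map_apply hs.continuous.measurable hsm]
  have hpre : MeasurableSet (f ⁻¹' s) := hs.continuous.measurable hsm
  have h1 := MeasureTheory.lintegral_abs_det_fderiv_eq_addHaar_image (MeasureTheory.Measure.addHaar (G := V))
    hpre (f := f) (f' := fun X => fderiv ℝ f X) (fun X _ => (hd X).hasFDerivAt.hasFDerivWithinAt)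
    (Function.LeftInverse.injective hgf).injOn
  have h2 : ∀ X, (fderiv ℝ f X).det = 1 := fun X =>
    det_eq_one_of_sub_mem hone hN _ fun i Z hZ => hf.fderiv_sub_mem hd X hZ
  have h3 : f '' (f ⁻¹' s) = s :=
    Set.image_preimage_eq s (Function.RightInverse.surjective hfg)
  simp only [h2, abs_one, ENNReal.ofReal_one, MeasureTheory.lintegral_one,
    MeasureTheory.Measure.restrict_apply_univ] at h1
  rw [h3] at h1
  exact h1
end UniTri

end GradedLie
end

noncomputable section

/-! ### The group law of a graded Lie algebra -/

namespace GradedLie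
variable {V : Type*} [NormedAddCommGroup V] [NormedSpace ℝ V]

/-- A Lie bracket `B` and a derivation `δ`, acting as `i` on the `i`-th graded piece of a finite
multiplicative filtration `F`. -/
structure IsFiltered (B : V →ₗ[ℝ] V →ₗ[ℝ] V) (δ : V →ₗ[ℝ] V) (F : ℕ → Submodule ℝ V) (N : ℕ) : Prop where
  anti : Antitone F
  one : F 1 = ⊤
  bot : F N = ⊥
  bracket_mem : ∀ {i j : ℕ} {X Y : V}, X ∈ F i → Y ∈ F j → B X Y ∈ F (i + j)
  degree_mem : ∀ {i : ℕ} {X : V}, X ∈ F i → δ X - (i : ℝ) • X ∈ F (i + 1)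
  skew : ∀ X Y, B X Y = -B Y X
  jacobi : ∀ X Y Z, B X (B Y Z) = B (B X Y) Z + B Y (B X Z)
  der : ∀ X Y, δ (B X Y) = B (δ X) Y + B X (δ Y)

namespace IsFiltered
variable {B : V →ₗ[ℝ] V →ₗ[ℝ] V} {δ : V →ₗ[ℝ] V} {F : ℕ → Submodule ℝ V} {N : ℕ}

lemma zero (h : IsFiltered B δ F N) : F 0 = ⊤ := top_le_iff.1 (h.one ▸ h.anti (Nat.zero_le 1))

lemma mem_one (h : IsFiltered B δ F N) (X : V) : X ∈ F 1 := h.one ▸ Submodule.mem_top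

lemma bracket_mem_succ (h : IsFiltered B δ F N) {i : ℕ} {X Y : V} (hY : Y ∈ F i) : B X Y ∈ F (i + 1) :=
  Nat.add_comm 1 i ▸ h.bracket_mem (h.mem_one X) hY

lemma bracket_mem_succ' (h : IsFiltered B δ F N) {i : ℕ} {X Y : V} (hX : X ∈ F i) : B X Y ∈ F (i + 1) :=
  h.bracket_mem hX (h.mem_one Y)

lemma degree_mem' (h : IsFiltered B δ F N) {i : ℕ} {X : V} (hX : X ∈ F i) : δ X ∈ F i := by
  have h1 := (F i).add_mem (h.anti (Nat.le_succ i) (h.degree_mem hX)) ((F i).smul_mem (i : ℝ) hX)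
  rwa [sub_add_cancel] at h1

lemma pow_bracket_mem (h : IsFiltered B δ F N) (X : V) {i : ℕ} {Y : V} (hY : Y ∈ F i) (k : ℕ) :
    (B X ^ k) Y ∈ F (i + k) := by
  induction k with
  | zero => exact hY
  | succ k ih => rw [pow_succ', Module.End.mul_apply]; exact h.bracket_mem_succ ih

/-- If `P` raises degrees by `k`, comparing `P δ` with `δ P` on `F i` gives `i P X ≡ (i + k) P X`
one step further up. As `k ≠ 0`, `P` raises degrees by `k + 1`, and so on until the filtration ends.
-/
lemma eq_zero_of_commute (h : IsFiltered B δ F N) (P : V →ₗ[ℝ] V)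
    (hc : ∀ X, P (δ X) = δ (P X)) (hP : ∀ i, ∀ X ∈ F i, P X ∈ F (i + 1)) : P = 0 := by
  have key : ∀ k, 1 ≤ k → ∀ i, ∀ X ∈ F i, P X ∈ F (i + k) := by
    intro k hk
    induction k, hk using Nat.le_induction with
    | base => exact hP
    | succ k hk ih =>
      intro i X hX
      have h1 := ih (i + 1) _ (h.degree_mem hX)
      have h2 := h.degree_mem (ih i X hX)
      rw [map_sub, map_smul, hc] at h1
      rw [show i + 1 + k = i + k + 1 by omega] at h1
      have h3 := (F (i + k + 1)).sub_mem h1 h2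
      have h4 : δ (P X) - (i : ℝ) • P X - (δ (P X) - ((i + k : ℕ) : ℝ) • P X) = (k : ℝ) • P X := by
        push_cast; module
      rw [h4] at h3
      have hk0 : (k : ℝ) ≠ 0 := by positivity
      exact ((F (i + k + 1)).smul_mem_iff hk0).1 h3
  ext X
  have h1 := key (N + 1) (by omega) 0 X (by rw [h.zero]; trivial)
  have h2 := h.anti (show N ≤ 0 + (N + 1) by omega) h1
  rw [h.bot, Submodule.mem_bot] at h2
  exact h2

lemma degree_injective (h : IsFiltered B δ F N) : Function.Injective δ := by
  rw [← LinearMap.ker_eq_bot, LinearMap.ker_eq_bot']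
  intro X hX
  have key : ∀ i, X ∈ F (i + 1) := by
    intro i
    induction i with
    | zero => exact h.mem_one X
    | succ i ih =>
      have h1 := h.degree_mem ih
      rw [hX, zero_sub, neg_mem_iff] at h1
      exact ((F (i + 1 + 1)).smul_mem_iff (by positivity)).1 h1
  have h2 := h.anti (Nat.le_succ N) (key N)
  rw [h.bot, Submodule.mem_bot] at h2
  exact h2

/-! #### The extension by the degree derivation -/

/-- The bracket of the semidirect product `V ⋊ ℝ δ`. -/
def extBracket (B : V →ₗ[ℝ] V →ₗ[ℝ] V) (δ : V →ₗ[ℝ] V) (u v : V × ℝ) : V × ℝ :=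
  (B u.1 v.1 + u.2 • δ v.1 - v.2 • δ u.1, 0)

lemma extAd_apply (X : V) (u : V × ℝ) : extAd B δ X u = (B X u.1 - u.2 • δ X, 0) := by
  simp [extAd]

/-- `extAd B δ X` is the bracket with `(X, 0)` in the extension, so this is the Jacobi identity
there: it combines the Jacobi identity of `B`, the Leibniz rule for `δ` and skewness. -/
lemma extAd_der (h : IsFiltered B δ F N) (X : V) (u v : V × ℝ) :
    extAd B δ X (extBracket B δ u v) =
      extBracket B δ u (extAd B δ X v) + extBracket B δ (extAd B δ X u) v := by
  simp only [extAd_apply, extBracket, map_add, map_sub, map_smul, LinearMap.sub_apply, LinearMap.smul_apply,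
    h.der, h.jacobi X u.1 v.1, Prod.mk_add_mk, zero_smul, sub_zero, add_zero]
  refine Prod.ext ?_ rfl
  simp only [h.skew u.1 (δ X)]
  module

lemma extAd_pow_succ (X : V) (u : V × ℝ) (k : ℕ) :
    (extAd B δ X ^ (k + 1)) u = ((B X ^ k) (B X u.1 - u.2 • δ X), 0) := by
  induction k with
  | zero => simp [extAd_apply]
  | succ k ih => rw [pow_succ', Module.End.mul_apply, ih, extAd_apply, pow_succ', Module.End.mul_apply]; simp

lemma isNilpotent_extAd (h : IsFiltered B δ F N) (X : V) : IsNilpotent (extAd B δ X) := by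
  refine ⟨N + 1, LinearMap.ext fun u => ?_⟩
  rw [extAd_pow_succ]
  have h1 := h.pow_bracket_mem X (i := 0) (Y := B X u.1 - u.2 • δ X) (by rw [h.zero]; trivial) N
  rw [zero_add, h.bot, Submodule.mem_bot] at h1
  rw [h1]; rfl

variable [FiniteDimensional ℝ V]

/-- The truncation at `dim V` loses nothing: by Cayley-Hamilton a nilpotent endomorphism of a space
of dimension `dim V + 1` has vanishing power `dim V + 1`. -/
lemma unipExp_eq_exp [Module ℚ V] (h : IsFiltered B δ F N) (X : V) :
    unipExp B δ X = IsNilpotent.exp (extAd B δ X) := by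
  have h1 : extAd B δ X ^ (Module.finrank ℝ V + 1) = 0 := by
    have h2 := (h.isNilpotent_extAd X).charpoly_eq_X_pow_finrank
    have h3 := (extAd B δ X).aeval_self_charpoly
    rw [h2, Module.finrank_prod, Module.finrank_self] at h3
    simpa using h3
  rw [IsNilpotent.exp_eq_sum h1, unipExp]
  refine Finset.sum_congr rfl fun m _ => ?_
  rw [← Rat.cast_smul_eq_qsmul ℝ]
  simp

/-- The exponential of a nilpotent derivation is an automorphism. -/
lemma unipExp_bracket (h : IsFiltered B δ F N) (X : V) (u v : V × ℝ) :
    unipExp B δ X (extBracket B δ u v) =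
      extBracket B δ (unipExp B δ X u) (unipExp B δ X v) := by
  let _ : Module ℚ V := Module.compHom V (algebraMap ℚ ℝ)
  rw [h.unipExp_eq_exp]
  -- The bracket becomes the multiplication of a non-associative ring, the setting of
  -- `Module.End.exp_mul_of_derivation`.
  let R : NonUnitalNonAssocRing (V × ℝ) :=
    { (inferInstance : AddCommGroup (V × ℝ)) with
      mul := extBracket B δ
      left_distrib := fun a b c => by
        refine Prod.ext ?_ (by change (0 : ℝ) = 0 + 0; simp)
        change B a.1 (b + c).1 + a.2 • δ (b + c).1 - (b + c).2 • δ a.1 =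
          (B a.1 b.1 + a.2 • δ b.1 - b.2 • δ a.1) + (B a.1 c.1 + a.2 • δ c.1 - c.2 • δ a.1)
        simp only [Prod.fst_add, Prod.snd_add, map_add]; module
      right_distrib := fun a b c => by
        refine Prod.ext ?_ (by change (0 : ℝ) = 0 + 0; simp)
        change B (a + b).1 c.1 + (a + b).2 • δ c.1 - c.2 • δ (a + b).1 =
          (B a.1 c.1 + a.2 • δ c.1 - c.2 • δ a.1) + (B b.1 c.1 + b.2 • δ c.1 - c.2 • δ b.1)
        simp only [Prod.fst_add, Prod.snd_add, map_add, LinearMap.add_apply]; module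
      zero_mul := fun a => by
        refine Prod.ext ?_ rfl
        change B (0 : V × ℝ).1 a.1 + (0 : V × ℝ).2 • δ a.1 - a.2 • δ (0 : V × ℝ).1 = 0
        simp
      mul_zero := fun a => by
        refine Prod.ext ?_ rfl
        change B a.1 (0 : V × ℝ).1 + a.2 • δ (0 : V × ℝ).1 - (0 : V × ℝ).2 • δ a.1 = 0
        simp }
  have i1 : SMulCommClass ℝ (V × ℝ) (V × ℝ) := ⟨fun c a b => by
    change c • extBracket B δ a b = extBracket B δ a (c • b)
    refine Prod.ext ?_ (by simp [extBracket])
    simp only [extBracket, Prod.smul_fst, Prod.smul_snd, map_smul]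
    module⟩
  have i2 : IsScalarTower ℝ (V × ℝ) (V × ℝ) := ⟨fun c a b => by
    change extBracket B δ (c • a) b = c • extBracket B δ a b
    refine Prod.ext ?_ (by simp [extBracket])
    simp only [extBracket, Prod.smul_fst, Prod.smul_snd, map_smul, LinearMap.smul_apply]
    module⟩
  exact Module.End.exp_mul_of_derivation ℝ (V × ℝ) (extAd B δ X) (h.extAd_der X)
    (h.isNilpotent_extAd X) u v

end IsFiltered
end GradedLie
end

/-! ### ### The exponentials form a group with invariant Lebesgue measure -/

noncomputable section

namespace GradedLie

/-- A Lie group law on a vector space whose one-parameter groups are the lines and for which the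
Lebesgue measure is a two-sided Haar measure. -/
structure IsExpGroup {V : Type*} [NormedAddCommGroup V] [NormedSpace ℝ V] [FiniteDimensional ℝ V]
    (m : V → V → V) : Prop where
  contDiff : ContDiff ℝ ∞ (fun p : V × V => m p.1 p.2)
  assoc : ∀ x y z, m (m x y) z = m x (m y z)
  smul_smul : ∀ (s t : ℝ) x, m (s • x) (t • x) = (s + t) • x
  zero_left : ∀ x, m 0 x = x
  measurePreserving_left : ∀ x, @MeasureTheory.MeasurePreserving V V (borel V) (borel V) (m x) (haar V) (haar V)

namespace IsFiltered
variable {V : Type*} [NormedAddCommGroup V] [NormedSpace ℝ V]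
  {B : V →ₗ[ℝ] V →ₗ[ℝ] V} {δ : V →ₗ[ℝ] V} {F : ℕ → Submodule ℝ V} {N : ℕ}

lemma extAd_smul (s : ℝ) (X : V) : extAd B δ (s • X) = s • extAd B δ X := by
  refine LinearMap.ext fun u => ?_
  rw [LinearMap.smul_apply, extAd_apply, extAd_apply]
  refine Prod.ext ?_ (by simp)
  simp only [map_smul, LinearMap.smul_apply, Prod.smul_fst]
  module

/-- The exponential of `ad X` on `V`. -/
def expAd (B : V →ₗ[ℝ] V →ₗ[ℝ] V) (X : V) : V →ₗ[ℝ] V :=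
  ∑ m ∈ Finset.range (Module.finrank ℝ V + 1), ((m.factorial : ℝ)⁻¹) • (B X) ^ m

/-- The image of the degree derivation under the exponential, minus the derivation. -/
def orbitMap (B : V →ₗ[ℝ] V →ₗ[ℝ] V) (δ : V →ₗ[ℝ] V) (X : V) : V :=
  -∑ m ∈ Finset.range (Module.finrank ℝ V), (((m + 1).factorial : ℝ)⁻¹) • ((B X) ^ m) (δ X)

/-- Block form of the exponential. `orbitMap` describes the orbit of the derivation `(0, 1)`, and
its index shift comes from the first power of `extAd` sending `(0, 1)` to `-δ X`. -/
lemma unipExp_apply (X W : V) (s : ℝ) :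
    unipExp B δ X (W, s) = (expAd B X W + s • orbitMap B δ X, s) := by
  have h1 : ∀ m, (extAd B δ X ^ m) (W, 0) = ((B X ^ m) W, 0) := by
    rintro (_ | m)
    · rfl
    · rw [extAd_pow_succ]; simp [pow_succ]
  have h2 : unipExp B δ X (W, 0) = (expAd B X W, 0) := by
    rw [unipExp, expAd]
    simp only [LinearMap.sum_apply, LinearMap.smul_apply, h1]
    refine Prod.ext ?_ ?_
    · simp [Prod.fst_sum]
    · simp [Prod.snd_sum]
  have h3 : unipExp B δ X (0, 1) = (orbitMap B δ X, 1) := by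
    rw [unipExp, Finset.sum_range_succ']
    simp only [LinearMap.add_apply, LinearMap.sum_apply, LinearMap.smul_apply, extAd_pow_succ]
    refine Prod.ext ?_ ?_
    · simp [Prod.fst_sum, orbitMap]
    · simp [Prod.snd_sum]
  have h4 : ((W, s) : V × ℝ) = (W, 0) + s • (0, 1) := by simp
  rw [h4, map_add, map_smul, h2, h3]
  simp

lemma expAd_sub_mem (h : IsFiltered B δ F N) (X : V) {i : ℕ} {W : V} (hW : W ∈ F i) :
    expAd B X W - W ∈ F (i + 1) := by
  rw [expAd, Finset.sum_range_succ']
  simp only [LinearMap.add_apply, LinearMap.sum_apply, LinearMap.smul_apply, pow_zero, Nat.factorial_zero,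
    Nat.cast_one, inv_one, one_smul, Module.End.one_apply, add_sub_cancel_right]
  exact Submodule.sum_mem _ fun k _ => (F (i + 1)).smul_mem _ <|
    h.anti (by omega) (h.pow_bracket_mem X hW (k + 1))

/-- Every bracket gains one degree, so a change of `X` in `F i` affects the bracket terms of the
orbit map only in `F (i + 1)`. -/
lemma sub_mem_of_pow_bracket (h : IsFiltered B δ F N) (k : ℕ) {i : ℕ} {X Z : V} (hZ : Z ∈ F i) :
    (B (X + Z) ^ (k + 1)) (δ (X + Z)) - (B X ^ (k + 1)) (δ X) ∈ F (i + 1) := by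
  have step : ∀ u v : V, u - v ∈ F i → B (X + Z) u - B X v ∈ F (i + 1) := by
    intro u v huv
    have h1 : B (X + Z) u - B X v = B Z u + B X (u - v) := by
      rw [map_add, LinearMap.add_apply, map_sub]; abel
    rw [h1]
    exact (F (i + 1)).add_mem (h.bracket_mem_succ' hZ) (h.bracket_mem_succ huv)
  induction k with
  | zero =>
    simp only [zero_add, pow_one]
    refine step _ _ ?_
    rw [map_add, add_sub_cancel_left]; exact h.degree_mem' hZ
  | succ k ih =>
    rw [pow_succ', Module.End.mul_apply, pow_succ' _ (k + 1), Module.End.mul_apply]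
    exact step _ _ (h.anti (Nat.le_succ i) ih)

variable [FiniteDimensional ℝ V]

lemma unipExp_smul_mul (h : IsFiltered B δ F N) (s t : ℝ) (X : V) :
    unipExp B δ (s • X) * unipExp B δ (t • X) = unipExp B δ ((s + t) • X) := by
  let _ : Module ℚ V := Module.compHom V (algebraMap ℚ ℝ)
  rw [h.unipExp_eq_exp, h.unipExp_eq_exp, h.unipExp_eq_exp,
    ← IsNilpotent.exp_add_of_commute _ (h.isNilpotent_extAd _) (h.isNilpotent_extAd _)]
  · rw [extAd_smul, extAd_smul, extAd_smul, add_smul]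
  · rw [extAd_smul, extAd_smul]
    exact ((Commute.refl _).smul_left s).smul_right t

lemma unipExp_zero (h : IsFiltered B δ F N) : unipExp B δ (0 : V) = 1 := by
  let _ : Module ℚ V := Module.compHom V (algebraMap ℚ ℝ)
  rw [h.unipExp_eq_exp]
  have : extAd B δ (0 : V) = 0 := by
    have := extAd_smul (B := B) (δ := δ) 0 (0 : V)
    simpa using this
  rw [this, IsNilpotent.exp_zero]

lemma unipExp_neg_mul (h : IsFiltered B δ F N) (X : V) : unipExp B δ (-X) * unipExp B δ X = 1 := by
  have := h.unipExp_smul_mul (-1) 1 X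
  simpa [h.unipExp_zero] using this

lemma contDiff_pow_bracket {P : Type*} [NormedAddCommGroup P] [NormedSpace ℝ P] {x w : P → V}
    (B : V →ₗ[ℝ] V →ₗ[ℝ] V) (hx : ContDiff ℝ ∞ x) (hw : ContDiff ℝ ∞ w) (k : ℕ) :
    ContDiff ℝ ∞ fun p => (B (x p) ^ k) (w p) := by
  induction k with
  | zero => exact hw
  | succ k ih =>
    have h1 := (B.toContinuousBilinearMap.isBoundedBilinearMap.contDiff (n := ∞)).comp (hx.prodMk ih)
    have h2 : (fun p => (B (x p) ^ (k + 1)) (w p)) = fun p => B (x p) ((B (x p) ^ k) (w p)) := by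
      ext p; rw [pow_succ', Module.End.mul_apply]
    rw [h2]; exact h1

lemma contDiff_expAd {P : Type*} [NormedAddCommGroup P] [NormedSpace ℝ P] {x w : P → V}
    (B : V →ₗ[ℝ] V →ₗ[ℝ] V) (hx : ContDiff ℝ ∞ x) (hw : ContDiff ℝ ∞ w) :
    ContDiff ℝ ∞ fun p => expAd B (x p) (w p) := by
  have h1 : (fun p => expAd B (x p) (w p)) = fun p =>
      ∑ m ∈ Finset.range (Module.finrank ℝ V + 1), ((m.factorial : ℝ)⁻¹) • (B (x p) ^ m) (w p) := by
    ext p; simp [expAd]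
  rw [h1]
  exact ContDiff.sum fun m _ => (contDiff_pow_bracket B hx hw m).const_smul _

lemma contDiff_orbitMap (B : V →ₗ[ℝ] V →ₗ[ℝ] V) (δ : V →ₗ[ℝ] V) : ContDiff ℝ ∞ (orbitMap B δ) := by
  refine ContDiff.neg (ContDiff.sum fun m _ => ContDiff.const_smul _ ?_)
  exact contDiff_pow_bracket B contDiff_id (LinearMap.toContinuousLinearMap δ).contDiff m

/-- The degree derivation as an automorphism. -/
def degreeEquiv (h : IsFiltered B δ F N) : V ≃ₗ[ℝ] V := LinearEquiv.ofInjectiveEndo δ h.degree_injective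

lemma degreeEquiv_apply (h : IsFiltered B δ F N) (X : V) : h.degreeEquiv X = δ X := rfl

lemma degreeEquiv_symm_mem (h : IsFiltered B δ F N) {i : ℕ} {W : V} (hW : W ∈ F i) :
    h.degreeEquiv.symm W ∈ F i := by
  set X := h.degreeEquiv.symm W with hX
  have hδ : δ X = W := by rw [← h.degreeEquiv_apply, hX, LinearEquiv.apply_symm_apply]
  rcases Nat.eq_zero_or_pos i with rfl | hi
  -- Degree zero is separated because the climb starts at `F 1 = ⊤` and divides by the positive
  -- degree `j`.
  · rw [h.zero]; trivial
  have key : ∀ j, 1 ≤ j → j ≤ i → X ∈ F j := by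
    intro j hj
    induction j, hj using Nat.le_induction with
    | base => intro _; exact h.mem_one X
    | succ j hj ih =>
      intro hji
      have h1 := h.degree_mem (ih (by omega))
      have h2 := (F (j + 1)).sub_mem (h.anti hji (hδ ▸ hW)) h1
      rw [sub_sub_cancel] at h2
      exact ((F (j + 1)).smul_mem_iff (by positivity)).1 h2
  exact key i hi le_rfl

/-- The orbit map, normalised to be unitriangular. -/
def normMap (h : IsFiltered B δ F N) (X : V) : V := -h.degreeEquiv.symm (orbitMap B δ X)

lemma contDiff_normMap (h : IsFiltered B δ F N) : ContDiff ℝ ∞ h.normMap :=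
  ((LinearMap.toContinuousLinearMap h.degreeEquiv.symm.toLinearMap).contDiff.comp
    (contDiff_orbitMap B δ)).neg

lemma orbitMap_eq (h : IsFiltered B δ F N) (X : V) : orbitMap B δ X = -δ (h.normMap X) := by
  rw [normMap, map_neg, neg_neg, ← h.degreeEquiv_apply, LinearEquiv.apply_symm_apply]

/-- The term `m = 0` of the orbit map is `-δ X`, so `normMap X` is `X` plus `δ⁻¹` of terms
containing at least one bracket. -/
lemma uniTri_normMap (h : IsFiltered B δ F N) : UniTri F h.normMap := by
  intro i X Z hZ
  -- In dimension zero the sum defining `orbitMap` is empty and has no term `m = 0` to split off.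
  rcases Nat.eq_zero_or_pos (Module.finrank ℝ V) with h0 | hpos
  · have : Subsingleton V := Module.finrank_zero_iff.1 h0
    rw [Subsingleton.elim (h.normMap (X + Z) - h.normMap X - Z) 0]
    exact zero_mem _
  obtain ⟨d, hd⟩ := Nat.exists_eq_succ_of_ne_zero hpos.ne'
  have h1 : h.normMap (X + Z) - h.normMap X - Z = h.degreeEquiv.symm
      (∑ m ∈ Finset.range d, (((m + 1 + 1).factorial : ℝ)⁻¹) •
        ((B (X + Z) ^ (m + 1)) (δ (X + Z)) - (B X ^ (m + 1)) (δ X))) := by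
    have h2 : ∀ X, h.normMap X = h.degreeEquiv.symm (∑ m ∈ Finset.range d, (((m + 1 + 1).factorial : ℝ)⁻¹) •
        (B X ^ (m + 1)) (δ X)) + X := by
      intro X
      rw [normMap, orbitMap, hd, map_neg, neg_neg, Nat.succ_eq_add_one, Finset.sum_range_succ', map_add]
      congr 1
      rw [LinearEquiv.symm_apply_eq, degreeEquiv_apply]
      simp
    rw [h2, h2]
    simp only [smul_sub, Finset.sum_sub_distrib, map_sub]
    abel
  rw [h1]
  exact h.degreeEquiv_symm_mem (Submodule.sum_mem _ fun m _ => (F (i + 1)).smul_mem _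
    (h.sub_mem_of_pow_bracket m hZ))

lemma orbitMap_bijective (h : IsFiltered B δ F N) :
    ∃ g : V → V, ContDiff ℝ ∞ g ∧ (∀ X, orbitMap B δ (g X) = X) ∧ ∀ X, g (orbitMap B δ X) = X := by
  obtain ⟨g, hg, -, h1, h2⟩ := h.uniTri_normMap.exists_inverse h.anti h.zero h.bot h.contDiff_normMap
  refine ⟨fun X => g (-h.degreeEquiv.symm X),
    hg.comp (LinearMap.toContinuousLinearMap h.degreeEquiv.symm.toLinearMap).contDiff.neg, fun X => ?_,
    fun X => h2 X⟩
  rw [h.orbitMap_eq, h1, map_neg, neg_neg, ← h.degreeEquiv_apply, LinearEquiv.apply_symm_apply]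

lemma unipExp_injective (h : IsFiltered B δ F N) : Function.Injective (unipExp B δ) := by
  intro X Y hXY
  obtain ⟨g, -, -, h2⟩ := h.orbitMap_bijective
  have h3 := congrArg Prod.fst (LinearMap.congr_fun hXY (0, 1))
  simp only [unipExp_apply, map_zero, one_smul, zero_add] at h3
  rw [← h2 X, h3, h2]

/-- The exponentials form a group: the Baker-Campbell-Hausdorff theorem for graded Lie algebras. -/
lemma exists_unipExp_mul (h : IsFiltered B δ F N) (X Y : V) :
    ∃ Z, unipExp B δ X * unipExp B δ Y = unipExp B δ Z := by
  obtain ⟨g, -, h1, h2⟩ := h.orbitMap_bijective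
  -- The candidate `Z` moves the derivation `(0, 1)` to the same point as the product does; it
  -- remains to see that `P`, which now fixes `(0, 1)`, is the identity.
  set Z := g ((unipExp B δ X * unipExp B δ Y) (0, 1)).1 with hZ
  refine ⟨Z, ?_⟩
  set P := unipExp B δ (-Z) * (unipExp B δ X * unipExp B δ Y) with hP
  have hPD : P (0, 1) = (0, 1) := by
    have h3 : (unipExp B δ X * unipExp B δ Y) (0, 1) = unipExp B δ Z (0, 1) := by
      refine Prod.ext ?_ ?_
      · rw [unipExp_apply Z, hZ, h1]; simp
      · simp [Module.End.mul_apply, unipExp_apply]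
    rw [hP, Module.End.mul_apply, h3, ← Module.End.mul_apply, h.unipExp_neg_mul, Module.End.one_apply]
  set p : V →ₗ[ℝ] V := expAd B (-Z) ∘ₗ expAd B X ∘ₗ expAd B Y with hp
  have hPW : ∀ W, P (W, 0) = (p W, 0) := by
    intro W
    simp [hP, Module.End.mul_apply, unipExp_apply, hp]
  have hbr : ∀ u v, P (extBracket B δ u v) = extBracket B δ (P u) (P v) := by
    intro u v
    simp only [hP, Module.End.mul_apply, h.unipExp_bracket]
  -- An automorphism fixing `(0, 1)` commutes with the bracket by it, that is with `δ`; being also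
  -- unipotent for the filtration, it is trivial on `V` by `eq_zero_of_commute`.
  have hp1 : p - 1 = 0 := by
    refine h.eq_zero_of_commute _ (fun W => ?_) fun i W hW => ?_
    · have h3 := hbr (0, 1) (W, 0)
      have h4 : ∀ W, extBracket B δ (0, 1) (W, 0) = (δ W, 0) := fun W => by simp [extBracket]
      rw [hPD, hPW, h4, h4, hPW] at h3
      have h5 := congrArg Prod.fst h3
      simp only at h5
      simp [h5]
    · have a1 := h.expAd_sub_mem Y hW
      have m1 : expAd B Y W ∈ F i := by
        simpa using (F i).add_mem (h.anti (Nat.le_succ i) a1) hW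
      have a2 := h.expAd_sub_mem X m1
      have m2 : expAd B X (expAd B Y W) ∈ F i := by
        simpa using (F i).add_mem (h.anti (Nat.le_succ i) a2) m1
      have a3 := h.expAd_sub_mem (-Z) m2
      have a4 := (F (i + 1)).add_mem (add_mem a3 a2) a1
      have a5 : (p - 1) W = expAd B (-Z) (expAd B X (expAd B Y W)) - expAd B X (expAd B Y W) +
          (expAd B X (expAd B Y W) - expAd B Y W) + (expAd B Y W - W) := by
        simp [hp]
      rw [a5]; exact a4
  have hP1 : P = 1 := by
    refine LinearMap.ext fun u => ?_
    have h4 : u = (u.1, 0) + u.2 • ((0, 1) : V × ℝ) := by ext <;> simp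
    rw [h4, map_add, map_smul, hPD, hPW, sub_eq_zero.1 hp1]
    rfl
  have h5 : unipExp B δ Z * P = unipExp B δ X * unipExp B δ Y := by
    have := h.unipExp_neg_mul (-Z)
    rw [neg_neg] at this
    rw [hP, ← mul_assoc, this, one_mul]
  rw [← h5, hP1, mul_one]

lemma unipExp_mul (h : IsFiltered B δ F N) (X Y : V) :
    unipExp B δ (mul B δ X Y) = unipExp B δ X * unipExp B δ Y := by
  obtain ⟨Z, hZ⟩ := h.exists_unipExp_mul X Y
  rw [mul, hZ, Function.leftInverse_invFun h.unipExp_injective]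

lemma orbitMap_mul (h : IsFiltered B δ F N) (X Y : V) :
    orbitMap B δ (mul B δ X Y) = orbitMap B δ X + expAd B X (orbitMap B δ Y) := by
  have h1 := congrArg Prod.fst (LinearMap.congr_fun (h.unipExp_mul X Y) (0, 1))
  simpa [Module.End.mul_apply, unipExp_apply, add_comm] using h1

/-- The algebraic laws are inherited from composition of endomorphisms. Smoothness and invariance of
the measure are read off in the orbit coordinates, where `orbitMap_mul` makes left translation
affine. -/
theorem isExpGroup_mul (h : IsFiltered B δ F N) : IsExpGroup (mul B δ) where
  contDiff := by
    obtain ⟨g, hg, -, h2⟩ := h.orbitMap_bijective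
    have h3 : (fun p : V × V => mul B δ p.1 p.2) =
        fun p => g (orbitMap B δ p.1 + expAd B p.1 (orbitMap B δ p.2)) := by
      ext p; rw [← h.orbitMap_mul, h2]
    rw [h3]
    exact hg.comp (((contDiff_orbitMap B δ).comp contDiff_fst).add
      (contDiff_expAd B contDiff_fst ((contDiff_orbitMap B δ).comp contDiff_snd)))
  assoc X Y Z := h.unipExp_injective (by simp only [h.unipExp_mul, mul_assoc])
  smul_smul s t X := h.unipExp_injective (by rw [h.unipExp_mul, h.unipExp_smul_mul])
  zero_left X := h.unipExp_injective (by rw [h.unipExp_mul, h.unipExp_zero, one_mul])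
  measurePreserving_left X := by
    let _ : MeasurableSpace V := borel V
    have : BorelSpace V := ⟨rfl⟩
    obtain ⟨g, hgs, hg, h1, h2⟩ :=
      h.uniTri_normMap.exists_inverse h.anti h.zero h.bot h.contDiff_normMap
    -- Left translation by `X` in the coordinate `normMap`: its linear part is `exp (ad X)`
    -- conjugated by the degree derivation, hence unitriangular.
    set a : V → V := fun W => h.normMap X + h.degreeEquiv.symm (expAd B X (h.degreeEquiv W)) with ha
    have ha' : UniTri F a := by
      intro i Y Z hZ
      have h3 : a (Y + Z) - a Y - Z = h.degreeEquiv.symm (expAd B X (h.degreeEquiv Z) - h.degreeEquiv Z) := by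
        simp [ha]
      rw [h3]
      exact h.degreeEquiv_symm_mem (h.expAd_sub_mem X (h.degree_mem' hZ))
    have has : ContDiff ℝ ∞ a := contDiff_const.add
      (LinearMap.toContinuousLinearMap
        (h.degreeEquiv.symm.toLinearMap ∘ₗ expAd B X ∘ₗ h.degreeEquiv.toLinearMap)).contDiff
    have h4 : mul B δ X = g ∘ a ∘ h.normMap := by
      ext Y
      have h5 : h.normMap (mul B δ X Y) = a (h.normMap Y) := by
        have h6 := h.orbitMap_mul X Y
        rw [h.orbitMap_eq, h.orbitMap_eq, h.orbitMap_eq] at h6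
        apply h.degreeEquiv.injective
        rw [ha]
        simp only [map_add, LinearEquiv.apply_symm_apply]
        simp only [h.degreeEquiv_apply]
        rw [← neg_inj, h6, map_neg]; abel
      rw [Function.comp_apply, Function.comp_apply, ← h5, h2]
    rw [h4]
    exact UniTri.measurePreserving h.anti h.zero h.bot (hg.comp h.anti (ha'.comp h.anti h.uniTri_normMap))
      (hgs.comp (has.comp h.contDiff_normMap))

end IsFiltered
end GradedLie
end

noncomputable section

/-! ### Smooth parameter integrals -/

namespace GradedLie
open MeasureTheory

lemma contDiff_fderiv_param {V W : Type*} [NormedAddCommGroup V] [NormedSpace ℝ V]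
    [NormedAddCommGroup W] [NormedSpace ℝ W] {Φ : W → V → ℂ} (hΦ : ContDiff ℝ ∞ (Function.uncurry Φ)) :
    ContDiff ℝ ∞ fun p : W × V => fderiv ℝ (fun w => Φ w p.2) p.1 := by
  have h1 : ContDiff ℝ ∞ (Function.uncurry fun (p : W × V) (w : W) => Φ w p.2) :=
    hΦ.comp (contDiff_snd.prodMk (contDiff_snd.comp contDiff_fst))
  exact h1.fderiv contDiff_fst (by simp)

section Param
variable {V W : Type*} [NormedAddCommGroup V] [NormedSpace ℝ V]
  [NormedAddCommGroup W] [NormedSpace ℝ W] [FiniteDimensional ℝ W] [MeasurableSpace V] [BorelSpace V]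

/-- Differentiation under the integral; the dominating function uses a bound of the derivative on a
compact ball times the support of `f`. Only continuity of `f` is needed. -/
lemma hasFDerivAt_param (μ : Measure V) [IsFiniteMeasureOnCompacts μ] {f : V → ℂ} (hf : Continuous f)
    (hfc : HasCompactSupport f) {Φ : W → V → ℂ} (hΦ : ContDiff ℝ ∞ (Function.uncurry Φ)) (w₀ : W) :
    HasFDerivAt (fun w => ∫ y, f y * Φ w y ∂μ) (∫ y, f y • fderiv ℝ (fun w => Φ w y) w₀ ∂μ) w₀ := by
  have hc := (contDiff_fderiv_param hΦ).continuous
  have hcΦ := hΦ.continuous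
  obtain ⟨C, hC⟩ : ∃ C, ∀ p ∈ Metric.closedBall w₀ 1 ×ˢ tsupport f,
      ‖fderiv ℝ (fun w => Φ w p.2) p.1‖ ≤ C :=
    ((isCompact_closedBall w₀ 1).prod hfc).exists_bound_of_continuousOn hc.continuousOn
  have hfi : Integrable f μ := hf.integrable_of_hasCompactSupport hfc
  refine hasFDerivAt_integral_of_dominated_of_fderiv_le (bound := fun y => ‖f y‖ * C)
    (F' := fun w y => f y • fderiv ℝ (fun w => Φ w y) w)
    (Metric.ball_mem_nhds w₀ one_pos) ?_ ?_ ?_ ?_ ?_ ?_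
  · refine Filter.Eventually.of_forall fun w => Continuous.aestronglyMeasurable ?_
    exact hf.mul (hcΦ.comp (by fun_prop : Continuous fun y : V => (w, y)))
  · refine Continuous.integrable_of_hasCompactSupport ?_ hfc.mul_right
    exact hf.mul (hcΦ.comp (by fun_prop : Continuous fun y : V => (w₀, y)))
  · refine Continuous.aestronglyMeasurable ?_
    exact hf.smul (hc.comp (by fun_prop : Continuous fun y : V => (w₀, y)))
  · refine Filter.Eventually.of_forall fun y w hw => ?_
    rw [norm_smul]
    by_cases hy : y ∈ tsupport f
    · exact mul_le_mul_of_nonneg_left (hC (w, y) ⟨Metric.ball_subset_closedBall hw, hy⟩) (norm_nonneg _)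
    · rw [image_eq_zero_of_notMem_tsupport hy]; simp
  · exact hfi.norm.mul_const C
  · refine Filter.Eventually.of_forall fun y w _ => ?_
    have h1 : DifferentiableAt ℝ (fun w => Φ w y) w :=
      ((hΦ.comp (contDiff_id.prodMk contDiff_const)).differentiable (by simp)) w
    exact h1.hasFDerivAt.const_mul (f y)

lemma fderiv_param_apply (μ : Measure V) [IsFiniteMeasureOnCompacts μ] {f : V → ℂ} (hf : Continuous f)
    (hfc : HasCompactSupport f) {Φ : W → V → ℂ} (hΦ : ContDiff ℝ ∞ (Function.uncurry Φ)) (w₀ v : W) :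
    fderiv ℝ (fun w => ∫ y, f y * Φ w y ∂μ) w₀ v = ∫ y, f y * fderiv ℝ (fun w => Φ w y) w₀ v ∂μ := by
  rw [(hasFDerivAt_param μ hf hfc hΦ w₀).fderiv, ContinuousLinearMap.integral_apply]
  · rfl
  · refine Continuous.integrable_of_hasCompactSupport ?_ hfc.smul_right
    exact hf.smul ((contDiff_fderiv_param hΦ).continuous.comp (by fun_prop : Continuous fun y : V => (w₀, y)))

lemma contDiff_param (μ : Measure V) [IsFiniteMeasureOnCompacts μ] {f : V → ℂ} (hf : Continuous f)
    (hfc : HasCompactSupport f) {Φ : W → V → ℂ} (hΦ : ContDiff ℝ ∞ (Function.uncurry Φ)) :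
    ContDiff ℝ ∞ fun w => ∫ y, f y * Φ w y ∂μ := by
  rw [contDiff_infty]
  intro n
  -- Generalised over `Φ`, because a directional derivative of the integral is an integral of the
  -- same kind with another kernel.
  induction n generalizing Φ with
  | zero =>
    exact contDiff_zero.2 (continuous_iff_continuousAt.2 fun w =>
      (hasFDerivAt_param μ hf hfc hΦ w).continuousAt)
  | succ n ih =>
    push_cast
    rw [contDiff_succ_iff_fderiv_apply]
    refine ⟨fun w => (hasFDerivAt_param μ hf hfc hΦ w).differentiableAt, by simp, fun v => ?_⟩
    simp_rw [fderiv_param_apply μ hf hfc hΦ]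
    exact ih ((contDiff_fderiv_param hΦ).clm_apply contDiff_const)
end Param

/-! ### Elementary properties of group laws -/

variable {V : Type*} [NormedAddCommGroup V] [NormedSpace ℝ V] [FiniteDimensional ℝ V] {m : V → V → V}

namespace IsExpGroup

lemma neg_left (h : IsExpGroup m) (x : V) : m (-x) x = 0 := by
  have := h.smul_smul (-1) 1 x; simpa using this

lemma neg_right (h : IsExpGroup m) (x : V) : m x (-x) = 0 := by
  have := h.neg_left (-x); rwa [neg_neg] at this

lemma zero_right (h : IsExpGroup m) (x : V) : m x 0 = x := by
  rw [← h.neg_left x, ← h.assoc, h.neg_right, h.zero_left]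

lemma neg_mul_cancel (h : IsExpGroup m) (x y : V) : m (-x) (m x y) = y := by
  rw [← h.assoc, h.neg_left, h.zero_left]

lemma mul_neg_cancel (h : IsExpGroup m) (x y : V) : m x (m (-x) y) = y := by
  rw [← h.assoc, h.neg_right, h.zero_left]

lemma neg_mul (h : IsExpGroup m) (x y : V) : -(m x y) = m (-y) (-x) := by
  have h1 : m (m (-y) (-x)) (m x y) = 0 := by
    rw [h.assoc, h.neg_mul_cancel, h.neg_left]
  rw [← h.zero_right (m (-y) (-x)), ← h.neg_right (m x y), ← h.assoc, h1, h.zero_left]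

lemma contDiff_mul (h : IsExpGroup m) {P : Type*} [NormedAddCommGroup P] [NormedSpace ℝ P] {f g : P → V}
    (hf : ContDiff ℝ ∞ f) (hg : ContDiff ℝ ∞ g) : ContDiff ℝ ∞ fun p => m (f p) (g p) :=
  h.contDiff.comp (hf.prodMk hg)

lemma continuous_mul (h : IsExpGroup m) {P : Type*} [TopologicalSpace P] {f g : P → V}
    (hf : Continuous f) (hg : Continuous g) : Continuous fun p => m (f p) (g p) :=
  h.contDiff.continuous.comp (hf.prodMk hg)

/-- Left translation as a homeomorphism. -/
def leftHomeo (h : IsExpGroup m) (x : V) : V ≃ₜ V where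
  toFun := m x
  invFun := m (-x)
  left_inv y := h.neg_mul_cancel x y
  right_inv y := h.mul_neg_cancel x y
  continuous_toFun := h.continuous_mul continuous_const continuous_id
  continuous_invFun := h.continuous_mul continuous_const continuous_id

section Integral
variable [MeasurableSpace V] [BorelSpace V]

lemma _root_.GradedLie.conv_eq (m : V → V → V) (f g : V → ℂ) (x : V) :
    conv m f g x = ∫ y, f y * g (m (-y) x) ∂(Measure.addHaar : Measure V) := by
  have := BorelSpace.measurable_eq (α := V)
  subst this
  rfl

lemma _root_.GradedLie.norm1_eq (f : V → ℂ) : norm1 f = ∫ y, ‖f y‖ ∂(Measure.addHaar : Measure V) := by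
  have := BorelSpace.measurable_eq (α := V)
  subst this
  rfl

lemma measurePreserving (h : IsExpGroup m) (x : V) :
    MeasurePreserving (m x) (Measure.addHaar : Measure V) Measure.addHaar := by
  have := BorelSpace.measurable_eq (α := V)
  subst this
  exact h.measurePreserving_left x

lemma integral_left {F : Type*} [NormedAddCommGroup F] [NormedSpace ℝ F] (h : IsExpGroup m) (x : V)
    (f : V → F) : ∫ y, f (m x y) ∂(Measure.addHaar : Measure V) = ∫ y, f y ∂(Measure.addHaar : Measure V) :=
  (h.measurePreserving x).integral_comp (h.leftHomeo x).measurableEmbedding f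

/-- Inversion is `x ↦ -x`, which preserves Lebesgue measure and exchanges right and left
translations: the group is unimodular. -/
lemma integral_right {F : Type*} [NormedAddCommGroup F] [NormedSpace ℝ F] (h : IsExpGroup m) (x : V)
    (f : V → F) : ∫ y, f (m y x) ∂(Measure.addHaar : Measure V) = ∫ y, f y ∂(Measure.addHaar : Measure V) := by
  have h1 : ∀ y, f (m y x) = (fun z => f (-(m (-x) z))) (-y) := by
    intro y; simp [h.neg_mul]
  simp_rw [h1]
  rw [integral_neg_eq_self (fun z => f (-(m (-x) z))), h.integral_left (-x) (fun z => f (-z)),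
    integral_neg_eq_self f]

end Integral
end IsExpGroup
end GradedLie
end

noncomputable section

/-! ### The convolution algebra in the group C*-algebra -/

namespace GradedLie
open MeasureTheory
variable {V : Type*} [NormedAddCommGroup V] [NormedSpace ℝ V] [FiniteDimensional ℝ V] {m : V → V → V}

lemma CStar.ext {a b : CStar m} (h : ∀ r : Rep m, a.1.1 r = b.1.1 r) : a = b :=
  Subtype.ext (lp.ext (funext h))

lemma incl_add (f g : C_c(V, ℂ)) : incl m (f + g) = incl m f + incl m g :=
  CStar.ext fun r => r.toFun.map_add f g

lemma incl_smul (c : ℂ) (f : C_c(V, ℂ)) : incl m (c • f) = c • incl m f :=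
  CStar.ext fun r => r.toFun.map_smul c f

/-- `incl` as a linear map. -/
def inclₗ (m : V → V → V) : C_c(V, ℂ) →ₗ[ℂ] CStar m where
  toFun := incl m
  map_add' := incl_add
  map_smul' := incl_smul

lemma norm_incl_le (f : C_c(V, ℂ)) : ‖incl m f‖ ≤ norm1 f := by
  have h0 : 0 ≤ norm1 f := by
    borelize V
    rw [norm1_eq]
    exact integral_nonneg fun _ => norm_nonneg _
  exact lp.norm_le_of_forall_le h0 fun r => r.norm_le f

lemma incl_conv {f g k : C_c(V, ℂ)} (h : ∀ x, k x = conv m f g x) : incl m k = incl m f * incl m g :=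
  CStar.ext fun r => r.map_conv f g k h

lemma incl_star {f g : C_c(V, ℂ)} (h : ∀ x, g x = star (f (-x))) : incl m g = star (incl m f) :=
  CStar.ext fun r => r.map_star f g h

/-- The involution of the convolution algebra. -/
lemma exists_star {V : Type*} [NormedAddCommGroup V] (f : C_c(V, ℂ)) : ∃ g : C_c(V, ℂ), ∀ x, g x = star (f (-x)) := by
  refine ⟨⟨⟨fun x => star (f (-x)), by fun_prop⟩, ?_⟩, fun x => rfl⟩
  have h1 : HasCompactSupport (f ∘ Homeomorph.neg V) := f.hasCompactSupport.comp_homeomorph _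
  exact h1.comp_left (g := star) (star_zero ℂ)

variable (h : IsExpGroup m)
include h

/-- The convolution of functions with compact support. -/
lemma exists_conv (f g : C_c(V, ℂ)) : ∃ k : C_c(V, ℂ), ∀ x, k x = conv m f g x := by
  borelize V
  have hc : Continuous fun x => conv m f g x := by
    simp_rw [conv_eq]
    -- Restricting to the compact support of `f` makes continuity in the parameter automatic.
    have h1 : ∀ x, ∫ y, f y * g (m (-y) x) ∂(Measure.addHaar : Measure V) =
        ∫ y in tsupport f, f y * g (m (-y) x) ∂(Measure.addHaar : Measure V) := fun x => by
      rw [setIntegral_eq_integral_of_forall_compl_eq_zero]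
      intro y hy
      rw [image_eq_zero_of_notMem_tsupport hy, zero_mul]
    simp_rw [h1]
    refine continuous_parametric_integral_of_continuous ?_ f.hasCompactSupport
    exact (f.continuous.comp continuous_snd).mul
      (g.continuous.comp (h.continuous_mul continuous_snd.neg continuous_fst))
  refine ⟨⟨⟨_, hc⟩, ?_⟩, fun x => rfl⟩
  have hK : IsCompact ((fun p : V × V => m p.1 p.2) '' (tsupport f ×ˢ tsupport g)) :=
    (f.hasCompactSupport.isCompact.prod g.hasCompactSupport.isCompact).image h.contDiff.continuous
  refine HasCompactSupport.intro hK fun x hx => ?_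
  change conv m f g x = 0
  rw [conv_eq]
  refine integral_eq_zero_of_ae (Filter.Eventually.of_forall fun y => ?_)
  by_cases hy : y ∈ tsupport f
  · by_cases hg : m (-y) x ∈ tsupport g
    · exact (hx ⟨(y, m (-y) x), ⟨hy, hg⟩, h.mul_neg_cancel y x⟩).elim
    · simp [image_eq_zero_of_notMem_tsupport hg]
  · simp [image_eq_zero_of_notMem_tsupport hy]

lemma contDiff_conv (f : C_c(V, ℂ)) {g : V → ℂ} (hg : ContDiff ℝ ∞ g) : ContDiff ℝ ∞ (conv m f g) := by
  borelize V
  have h1 : conv m f g = fun x => ∫ y, f y * g (m (-y) x) ∂(Measure.addHaar : Measure V) := by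
    ext x; rw [conv_eq]
  rw [h1]
  exact contDiff_param (Φ := fun x y => g (m (-y) x)) Measure.addHaar f.continuous f.hasCompactSupport
    (hg.comp (h.contDiff_mul contDiff_snd.neg contDiff_fst))

/-- A convolution from the left is a superposition of left translates, and these commute with
left-invariant fields. -/
lemma leftDeriv_conv (f : C_c(V, ℂ)) {g : V → ℂ} (hg : ContDiff ℝ ∞ g) (X x : V) :
    leftDeriv m X (conv m f g) x = conv m f (leftDeriv m X g) x := by
  borelize V
  rw [conv_eq]
  have h1 : (fun Z => conv m f g (m x Z)) =
      fun Z => ∫ y, f y * g (m (m (-y) x) Z) ∂(Measure.addHaar : Measure V) := by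
    ext Z; rw [conv_eq]; simp_rw [h.assoc]
  rw [leftDeriv, h1]
  refine fderiv_param_apply (f := fun y => f y) (Φ := fun Z y => g (m (m (-y) x) Z)) Measure.addHaar
    f.continuous f.hasCompactSupport ?_ 0 X
  · exact hg.comp (h.contDiff_mul (h.contDiff_mul contDiff_snd.neg contDiff_const) contDiff_fst)

lemma contDiff_leftDeriv {f : V → ℂ} (hf : ContDiff ℝ ∞ f) (X : V) : ContDiff ℝ ∞ (leftDeriv m X f) := by
  have h1 : ContDiff ℝ ∞ (Function.uncurry fun y Z => f (m y Z)) := hf.comp h.contDiff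
  exact (ContDiff.fderiv h1 contDiff_const (by simp)).clm_apply contDiff_const

lemma leftDeriv_eq_zero {f : V → ℂ} {y : V} (hy : y ∉ tsupport f) (X : V) : leftDeriv m X f y = 0 := by
  have h1 : ∀ᶠ Z in 𝓝 (0 : V), f (m y Z) = 0 := by
    have h2 : Filter.Tendsto (fun Z => m y Z) (𝓝 0) (𝓝 y) := by
      have := (h.continuous_mul continuous_const continuous_id : Continuous fun Z => m y Z).tendsto 0
      rwa [h.zero_right] at this
    filter_upwards [h2.eventually ((isClosed_tsupport f).isOpen_compl.mem_nhds hy)] with Z hZ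
    exact image_eq_zero_of_notMem_tsupport hZ
  have h3 : (fun Z => f (m y Z)) =ᶠ[𝓝 0] fun _ => 0 := h1
  rw [leftDeriv, h3.fderiv_eq]
  simp

/-- Left-invariant derivatives of smooth functions with compact support. -/
lemma exists_leftDeriv {f : C_c(V, ℂ)} (hf : ContDiff ℝ ∞ f) (X : V) :
    ∃ g : C_c(V, ℂ), ∀ y, g y = leftDeriv m X f y :=
  ⟨⟨⟨_, (contDiff_leftDeriv h hf X).continuous⟩,
    HasCompactSupport.intro f.hasCompactSupport fun _ hy => leftDeriv_eq_zero h hy X⟩, fun _ => rfl⟩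

/-- Right translates of `f` all have the same integral; differentiate this at the unit. -/
lemma integral_leftDeriv_eq_zero [MeasurableSpace V] [BorelSpace V] {f : C_c(V, ℂ)} (hf : ContDiff ℝ ∞ f)
    (X : V) : ∫ y, leftDeriv m X f y ∂(Measure.addHaar : Measure V) = 0 := by
  -- `K` contains the supports of all translates `y ↦ f (y Z)` with `‖Z‖ ≤ 1`. The cutoff `χ`, equal
  -- to one on `K`, plays the compactly supported weight required by `fderiv_param_apply`.
  set K : Set V := (fun p : V × V => m p.1 (-p.2)) '' (tsupport f ×ˢ Metric.closedBall 0 1) with hKdef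
  have hK : IsCompact K :=
    (f.hasCompactSupport.isCompact.prod (isCompact_closedBall 0 1)).image
      (h.continuous_mul continuous_fst continuous_snd.neg)
  obtain ⟨χ, hχ1, -, hχc, -⟩ :=
    exists_continuous_one_zero_of_isCompact hK isClosed_empty (Set.disjoint_empty K)
  have hsub : ∀ y Z, Z ∈ Metric.closedBall (0 : V) 1 → f (m y Z) ≠ 0 → y ∈ K := by
    intro y Z hZ hne
    refine ⟨(m y Z, Z), ⟨subset_tsupport _ hne, hZ⟩, ?_⟩
    simp only [h.assoc, h.neg_right, h.zero_right]
  have h1 : ∀ y Z, Z ∈ Metric.closedBall (0 : V) 1 → (χ y : ℂ) * f (m y Z) = f (m y Z) := by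
    intro y Z hZ
    by_cases h0 : f (m y Z) = 0
    · rw [h0, mul_zero]
    · rw [hχ1 (hsub y Z hZ h0)]; simp
  have hχcont : Continuous fun y => (χ y : ℂ) := by fun_prop
  have hχcs : HasCompactSupport fun y => (χ y : ℂ) := hχc.comp_left (g := fun t : ℝ => (t : ℂ)) (by simp)
  have h2 := fderiv_param_apply (Φ := fun Z y => f (m y Z)) Measure.addHaar hχcont hχcs
    (hf.comp (h.contDiff_mul contDiff_snd contDiff_fst)) (0 : V) X
  have h3 : (fun Z => ∫ y, (χ y : ℂ) * f (m y Z) ∂(Measure.addHaar : Measure V)) =ᶠ[𝓝 0]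
      fun _ => ∫ y, f y ∂(Measure.addHaar : Measure V) := by
    filter_upwards [Metric.closedBall_mem_nhds (0 : V) one_pos] with Z hZ
    rw [← h.integral_right Z f]
    exact integral_congr_ae (Filter.Eventually.of_forall fun y => h1 y Z hZ)
  rw [h3.fderiv_eq] at h2
  simp only [fderiv_fun_const, Pi.zero_apply, zero_apply] at h2
  rw [h2]
  refine integral_congr_ae (Filter.Eventually.of_forall fun y => ?_)
  simp only
  change leftDeriv m X f y = (χ y : ℂ) * leftDeriv m X f y
  by_cases h0 : y ∈ tsupport f
  · have : y ∈ K := ⟨(y, 0), ⟨h0, Metric.mem_closedBall_self zero_le_one⟩, by simp [h.zero_right]⟩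
    rw [hχ1 this]; simp
  · rw [leftDeriv_eq_zero h h0, mul_zero]

end GradedLie
end

/-! ### ### Density of functions, skewness of vector fields, approximate units -/

noncomputable section

namespace GradedLie
open MeasureTheory
variable {V : Type*} [NormedAddCommGroup V] [NormedSpace ℝ V] [FiniteDimensional ℝ V] {m : V → V → V}

/-- The functions are closed under convolution and involution, so the star algebra which they
generate is already their image. -/
lemma denseRange_incl (h : IsExpGroup m) : DenseRange (incl m) := by
  let S : NonUnitalStarSubalgebra ℂ (lp (fun r : Rep m => r.H →L[ℂ] r.H) ⊤) :=
    { carrier := Set.range (universalRep m)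
      add_mem' := by
        rintro _ _ ⟨f, rfl⟩ ⟨g, rfl⟩
        exact ⟨f + g, congrArg (fun a : CStar m => a.1) (incl_add f g)⟩
      zero_mem' := ⟨0, congrArg (fun a : CStar m => a.1) (map_zero (inclₗ m))⟩
      smul_mem' := by
        rintro c _ ⟨f, rfl⟩
        exact ⟨c • f, congrArg (fun a : CStar m => a.1) (incl_smul c f)⟩
      mul_mem' := by
        rintro _ _ ⟨f, rfl⟩ ⟨g, rfl⟩
        obtain ⟨k, hk⟩ := exists_conv h f g
        exact ⟨k, congrArg (fun a : CStar m => a.1) (incl_conv hk)⟩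
      star_mem' := by
        rintro _ ⟨f, rfl⟩
        obtain ⟨g, hg⟩ := exists_star f
        exact ⟨g, congrArg (fun a : CStar m => a.1) (incl_star hg)⟩ }
  have hS : NonUnitalStarAlgebra.adjoin ℂ (Set.range (universalRep m)) ≤ S :=
    NonUnitalStarAlgebra.adjoin_le (fun _ hx => hx)
  intro a
  have ha : a.1 ∈ closure (Set.range (universalRep m)) :=
    closure_mono hS a.2
  rw [Metric.mem_closure_iff] at ha ⊢
  intro ε hε
  obtain ⟨_, ⟨f, rfl⟩, hf⟩ := ha ε hε
  exact ⟨incl m f, ⟨f, rfl⟩, hf⟩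

/-- Left-invariant vector fields are skew-symmetric. -/
lemma incl_leftDeriv_mul_star (h : IsExpGroup m) {f g f' g' : C_c(V, ℂ)} (hf : ContDiff ℝ ∞ f)
    (hg : ContDiff ℝ ∞ g) {X : V} (hf' : ∀ y, f' y = leftDeriv m X f y)
    (hg' : ∀ y, g' y = leftDeriv m X g y) :
    incl m g' * star (incl m f) = -(incl m g * star (incl m f')) := by
  borelize V
  obtain ⟨fs, hfs⟩ := exists_star f
  obtain ⟨fs', hfs'⟩ := exists_star f'
  obtain ⟨k, hk⟩ := exists_conv h g' fs
  obtain ⟨k', hk'⟩ := exists_conv h g fs'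
  rw [← incl_star hfs, ← incl_star hfs', ← incl_conv hk, ← incl_conv hk']
  have hkk : k = -k' := by
    ext z
    rw [CompactlySupportedContinuousMap.neg_apply, hk, hk', conv_eq, conv_eq, ← add_eq_zero_iff_eq_neg]
    -- At the point `z` the asserted identity is `∫ X u = 0` for this `u`, expanded by the product
    -- rule; left invariance lets `X` pass the translation by `z⁻¹`.
    let u : C_c(V, ℂ) := ⟨⟨fun y => g y * star (f (m (-z) y)),
      g.continuous.mul (f.continuous.comp (h.continuous_mul continuous_const continuous_id)).star⟩,
      g.hasCompactSupport.mul_right⟩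
    have hfz : ContDiff ℝ ∞ fun y => f (m (-z) y) := hf.comp (h.contDiff_mul contDiff_const contDiff_id)
    have hstar : ContDiff ℝ ∞ (fun w : ℂ => star w) := Complex.conjCLE.contDiff
    have hu : ContDiff ℝ ∞ u := hg.mul (hstar.comp hfz)
    have h1 := integral_leftDeriv_eq_zero h hu X
    have h2 : ∀ y, leftDeriv m X u y = g' y * star (f (m (-z) y)) + g y * star (f' (m (-z) y)) := by
      intro y
      rw [hg', hf']
      have d1 : HasFDerivAt (fun Z => g (m y Z)) (fderiv ℝ (fun Z => g (m y Z)) 0) 0 :=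
        ((hg.comp (h.contDiff_mul contDiff_const contDiff_id)).differentiable (by simp) 0).hasFDerivAt
      have d2 : HasFDerivAt (fun Z => f (m (m (-z) y) Z)) (fderiv ℝ (fun Z => f (m (m (-z) y) Z)) 0) 0 :=
        ((hf.comp (h.contDiff_mul contDiff_const contDiff_id)).differentiable (by simp) 0).hasFDerivAt
      have d3 := d1.mul ((Complex.conjCLE.hasFDerivAt).comp (0 : V) d2)
      have d4 : (fun Z => u (m y Z)) =
          (fun Z => g (m y Z)) * (Complex.conjCLE ∘ fun Z => f (m (m (-z) y) Z)) := by
        ext Z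
        change g (m y Z) * star (f (m (-z) (m y Z))) = _
        rw [← h.assoc]; rfl
      rw [leftDeriv, d4, d3.fderiv]
      simp only [leftDeriv, h.zero_right, Function.comp_apply]
      change g y * star (fderiv ℝ (fun Z => f (m (m (-z) y) Z)) 0 X) +
        star (f (m (-z) y)) * fderiv ℝ (fun Z => g (m y Z)) 0 X = _
      ring
    simp_rw [h2] at h1
    have e : ∀ y, -(m (-y) z) = m (-z) y := fun y => by rw [h.neg_mul, neg_neg]
    simp_rw [hfs, hfs', e]
    rw [← integral_add]
    · exact h1
    · refine Continuous.integrable_of_hasCompactSupport ?_ g'.hasCompactSupport.mul_right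
      exact g'.continuous.mul (f.continuous.comp (h.continuous_mul continuous_const continuous_id)).star
    · refine Continuous.integrable_of_hasCompactSupport ?_ g.hasCompactSupport.mul_right
      exact g.continuous.mul (f'.continuous.comp (h.continuous_mul continuous_const continuous_id)).star
  rw [hkk]
  exact map_neg (inclₗ m) k'

lemma norm1_le_of_forall_le {f : V → ℂ} {K : Set V} (hK : IsCompact K) {C : ℝ} (hC : ∀ x, ‖f x‖ ≤ C)
    (h0 : ∀ x ∉ K, f x = 0) : norm1 f ≤ C * (haar V).real K := by
  borelize V
  rw [norm1_eq, ← setIntegral_eq_integral_of_forall_compl_eq_zero (s := K) (fun x hx => by rw [h0 x hx, norm_zero])]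
  have h1 := norm_setIntegral_le_of_norm_le_const (μ := (Measure.addHaar : Measure V)) (s := K)
    (f := fun x => ‖f x‖) (C := C) hK.measure_lt_top (fun x _ => by simpa using hC x)
  exact (le_abs_self _).trans h1

/-- Functions of small support, of integral one, are almost right units. -/
lemma exists_conv_sub_le (h : IsExpGroup m) (f : C_c(V, ℂ)) {ε : ℝ} (hε : 0 < ε) :
    ∃ η > 0, ∀ ψ : C_c(V, ℂ), (∀ x, ψ (-x) = ψ x) → norm1 ψ ≤ 1 →
      (∀ [MeasurableSpace V] [BorelSpace V], ∫ x, ψ x ∂(Measure.addHaar : Measure V) = 1) →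
      (∀ x, η ≤ ‖x‖ → ψ x = 0) → ‖incl m f * incl m ψ - incl m f‖ ≤ ε := by
  borelize V
  set K : Set V := (fun p : V × V => m p.1 (-p.2)) '' (tsupport f ×ˢ Metric.closedBall 0 1) with hKdef
  have hK : IsCompact K :=
    (f.hasCompactSupport.isCompact.prod (isCompact_closedBall 0 1)).image
      (h.continuous_mul continuous_fst continuous_snd.neg)
  have hKmem : ∀ x w, ‖w‖ ≤ 1 → m x w ∈ tsupport f → x ∈ K := fun x w hw hx =>
    ⟨(m x w, w), ⟨hx, by simpa using hw⟩, by simp only [h.assoc, h.neg_right, h.zero_right]⟩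
  set v := (haar V).real K with hv
  have hv0 : 0 ≤ v := ENNReal.toReal_nonneg
  set ε' := ε / (v + 1) with hε'
  have hε'0 : 0 < ε' := by positivity
  have hcont : Continuous fun p : V × V => ‖f (m p.1 p.2) - f p.1‖ :=
    ((f.continuous.comp h.contDiff.continuous).sub (f.continuous.comp continuous_fst)).norm
  -- The tube lemma gives uniform continuity on `K`: right translation by elements near the unit
  -- changes `f` by less than `ε'` there.
  obtain ⟨u, w, -, hw, hKu, h0w, huw⟩ := generalized_tube_lemma hK (isCompact_singleton (x := (0 : V)))
    (isOpen_lt hcont (continuous_const (y := ε')))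
    (by rintro ⟨x, y⟩ ⟨-, hy⟩
        obtain rfl : y = 0 := hy
        change ‖f (m x 0) - f x‖ < ε'
        simpa [h.zero_right] using hε'0)
  obtain ⟨η₀, hη₀, hball⟩ := Metric.isOpen_iff.1 hw 0 (h0w rfl)
  refine ⟨min η₀ 1, lt_min hη₀ one_pos, fun ψ hsym hψ1 hψ2 hsupp => ?_⟩
  obtain ⟨k, hk⟩ := exists_conv h f ψ
  rw [← incl_conv hk]
  have e1 : incl m k - incl m f = incl m (k - f) := (map_sub (inclₗ m) k f).symm
  rw [e1]
  refine (norm_incl_le _).trans ?_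
  have hint : Integrable (fun w => ψ w) (Measure.addHaar : Measure V) :=
    ψ.continuous.integrable_of_hasCompactSupport ψ.hasCompactSupport
  have hkf : ∀ x, (k - f) x = ∫ w, (f (m x w) - f x) * ψ w ∂(Measure.addHaar : Measure V) := by
    intro x
    -- Substitute `y = x w`; evenness of `ψ` removes the inverse.
    have e2 : conv m f ψ x = ∫ w, f (m x w) * ψ w ∂(Measure.addHaar : Measure V) := by
      rw [conv_eq, ← h.integral_left x]
      refine integral_congr_ae (Filter.Eventually.of_forall fun w => ?_)
      simp only
      rw [h.neg_mul, h.assoc, h.neg_left, h.zero_right, hsym]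
    simp_rw [sub_mul]
    rw [integral_sub]
    · rw [integral_const_mul, hψ2, mul_one, ← e2, ← hk]; rfl
    · exact ((f.continuous.comp (h.continuous_mul continuous_const continuous_id)).mul
        ψ.continuous).integrable_of_hasCompactSupport ψ.hasCompactSupport.mul_left
    · exact hint.const_mul _
  have hzero : ∀ x ∉ K, (k - f) x = 0 := by
    intro x hx
    rw [hkf]
    refine integral_eq_zero_of_ae (Filter.Eventually.of_forall fun w => ?_)
    by_cases hw1 : min η₀ 1 ≤ ‖w‖
    · simp [hsupp w hw1]
    · have hw2 : ‖w‖ ≤ 1 := (not_le.1 hw1).le.trans (min_le_right _ _)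
      have a1 : f (m x w) = 0 := by
        by_contra hne
        exact hx (hKmem x w hw2 (subset_tsupport _ hne))
      have a2 : f x = 0 := by
        by_contra hne
        exact hx (hKmem x 0 (by simp) (by rw [h.zero_right]; exact subset_tsupport _ hne))
      simp [a1, a2]
  have hle : ∀ x, ‖(k - f) x‖ ≤ ε' := by
    intro x
    by_cases hx : x ∈ K
    swap
    · rw [hzero x hx, norm_zero]; exact hε'0.le
    rw [hkf]
    have b1 : ∀ w, ‖(f (m x w) - f x) * ψ w‖ ≤ ε' * ‖ψ w‖ := by
      intro z
      rw [norm_mul]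
      by_cases hz : min η₀ 1 ≤ ‖z‖
      · simp [hsupp z hz]
      · have hz' : z ∈ w := hball (by
          rw [mem_ball_zero_iff]; exact (not_le.1 hz).trans_le (min_le_left _ _))
        have := huw (Set.mk_mem_prod (hKu hx) hz')
        exact mul_le_mul_of_nonneg_right (le_of_lt this) (norm_nonneg _)
    refine (norm_integral_le_of_norm_le (hint.norm.const_mul ε') (Filter.Eventually.of_forall b1)).trans ?_
    rw [integral_const_mul, ← norm1_eq]
    exact mul_le_of_le_one_right hε'0.le hψ1
  refine (norm1_le_of_forall_le hK hle hzero).trans ?_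
  rw [← hv, hε', div_mul_eq_mul_div, div_le_iff₀ (by positivity)]
  nlinarith

end GradedLie
end

noncomputable section

/-! ### Mollifiers -/

namespace GradedLie
open MeasureTheory
variable {V : Type*} [NormedAddCommGroup V] [NormedSpace ℝ V] [FiniteDimensional ℝ V] {m : V → V → V}

/-- The symmetrized left-invariant derivative of an even real function `ψ` is a derivative along a vector field
vanishing at the unit. -/
lemma leftDeriv_add_star (h : IsExpGroup m) {ψ : V → ℂ} (hψ : ContDiff ℝ ∞ ψ) (hsym : ∀ x, ψ (-x) = ψ x)
    (hreal : ∀ x, star (ψ x) = ψ x) (X x : V) :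
    leftDeriv m X ψ x + star (leftDeriv m X ψ (-x)) =
      fderiv ℝ ψ x (fderiv ℝ (fun Z => m x Z) 0 X + fderiv ℝ (fun Z => m (-Z) x) 0 X) := by
  have hd : ∀ y, HasFDerivAt ψ (fderiv ℝ ψ y) y := fun y =>
    (hψ.differentiable (by simp) y).hasFDerivAt
  -- The derivative of a real-valued function is real.
  have hstar : ∀ y v, star (fderiv ℝ ψ y v) = fderiv ℝ ψ y v := by
    intro y v
    have h1 := (Complex.conjCLE.hasFDerivAt).comp y (hd y)
    have h2 : (⇑Complex.conjCLE ∘ ψ) = ψ := funext hreal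
    rw [h2] at h1
    conv_rhs => rw [h1.fderiv]
    rfl
  have h1 : HasFDerivAt (fun Z => m x Z) (fderiv ℝ (fun Z => m x Z) 0) 0 :=
    ((h.contDiff_mul contDiff_const contDiff_id).differentiable (by simp) 0).hasFDerivAt
  have h2 : HasFDerivAt (fun Z => m (-Z) x) (fderiv ℝ (fun Z => m (-Z) x) 0) 0 :=
    ((h.contDiff_mul contDiff_id.neg contDiff_const).differentiable (by simp) 0).hasFDerivAt
  have e1 : leftDeriv m X ψ x = fderiv ℝ ψ x (fderiv ℝ (fun Z => m x Z) 0 X) := by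
    have h3 : HasFDerivAt ψ (fderiv ℝ ψ x) (m x 0) := by rw [h.zero_right]; exact hd x
    have h4 := h3.comp (0 : V) h1
    exact congrArg (fun L => L X) h4.fderiv
  have e2 : leftDeriv m X ψ (-x) = fderiv ℝ ψ x (fderiv ℝ (fun Z => m (-Z) x) 0 X) := by
    have h3 : HasFDerivAt ψ (fderiv ℝ ψ x) (m (-0) x) := by rw [neg_zero, h.zero_left]; exact hd x
    have h4 := h3.comp (0 : V) h2
    have h5 : (fun Z => ψ (m (-x) Z)) = ψ ∘ fun Z => m (-Z) x := by
      ext Z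
      rw [← hsym, h.neg_mul, neg_neg]; rfl
    rw [leftDeriv, h5]
    exact congrArg (fun L => L X) h4.fderiv
  rw [e1, e2, hstar, map_add]

/-- The vector is the value at `x` of the left-invariant minus the right-invariant field of `X`. It
depends smoothly on `x` and vanishes at the unit, so the mean value inequality applies. -/
lemma exists_norm_fderiv_add_le (h : IsExpGroup m) (X : V) : ∃ C, 0 ≤ C ∧ ∀ x : V, ‖x‖ ≤ 1 →
    ‖fderiv ℝ (fun Z => m x Z) 0 X + fderiv ℝ (fun Z => m (-Z) x) 0 X‖ ≤ C * ‖x‖ := by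
  set a : V → V := fun x => fderiv ℝ (fun Z => m x Z) 0 X + fderiv ℝ (fun Z => m (-Z) x) 0 X with ha
  have h1 : ContDiff ℝ ∞ (Function.uncurry fun x Z => m x Z) := h.contDiff
  have h2 : ContDiff ℝ ∞ (Function.uncurry fun x Z => m (-Z) x) :=
    h.contDiff_mul contDiff_snd.neg contDiff_fst
  have hac : ContDiff ℝ ∞ a :=
    ((ContDiff.fderiv h1 contDiff_const (by simp)).clm_apply contDiff_const).add
      ((ContDiff.fderiv h2 contDiff_const (by simp)).clm_apply contDiff_const)
  have ha0 : a 0 = 0 := by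
    have e1 : (fun Z => m 0 Z) = id := funext h.zero_left
    have e2 : (fun Z => m (-Z) 0) = fun Z => -Z := funext fun Z => h.zero_right _
    simp only [ha, e1, e2]
    rw [fderiv_id, fderiv_fun_neg, fderiv_fun_id]
    simp
  obtain ⟨C, hC⟩ := (isCompact_closedBall (0 : V) 1).exists_bound_of_continuousOn
    (hac.continuous_fderiv (by simp)).continuousOn
  refine ⟨C, (norm_nonneg _).trans (hC 0 (by simp)), fun x hx => ?_⟩
  have := (convex_closedBall (0 : V) 1).norm_image_sub_le_of_norm_fderiv_le (𝕜 := ℝ) (f := a)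
    (fun y _ => hac.differentiable (by simp) y) hC (by simp : (0 : V) ∈ Metric.closedBall 0 1)
    (by simpa using hx : x ∈ Metric.closedBall 0 1)
  simpa [ha0] using this

/-- A symmetric smooth approximate unit satisfying the estimate of Friedrichs. -/
lemma exists_mollifier (h : IsExpGroup m) : ∃ Ψ : ℝ → C_c(V, ℂ), (∀ η, 0 < η →
      ContDiff ℝ ∞ (Ψ η) ∧ (∀ x, Ψ η (-x) = Ψ η x) ∧ (∀ x, star (Ψ η x) = Ψ η x) ∧ norm1 (Ψ η) ≤ 1 ∧
      (∀ [MeasurableSpace V] [BorelSpace V], ∫ x, Ψ η x ∂(Measure.addHaar : Measure V) = 1) ∧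
      (∀ x, η ≤ ‖x‖ → Ψ η x = 0)) ∧
    ∀ X, ∃ C, 0 ≤ C ∧ ∀ η, 0 < η → η ≤ 1 → ∀ k : C_c(V, ℂ),
      (∀ x, k x = leftDeriv m X (Ψ η) x + star (leftDeriv m X (Ψ η) (-x))) → norm1 k ≤ C := by
  borelize V
  let b : ContDiffBump (0 : V) := ⟨1 / 2, 1, by norm_num, by norm_num⟩
  set μ : Measure V := Measure.addHaar
  set d := Module.finrank ℝ V
  let β : V → ℝ := b.normed μ
  have hβs : ContDiff ℝ ∞ β := b.contDiff_normed
  have hβ0 : ∀ x, 1 ≤ ‖x‖ → β x = 0 := by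
    intro x hx
    have : x ∉ Function.support (b.normed μ) := by
      rw [b.support_normed_eq]
      simpa [b] using hx
    simpa using this
  have hβn : ∀ x, β (-x) = β x := fun x => b.normed_neg x
  have hβ1 : ∫ x, β x ∂μ = 1 := b.integral_normed
  have hβp : ∀ x, 0 ≤ β x := fun x => b.nonneg_normed x
  have hscale : ∀ η : ℝ, 0 < η → ∀ f : V → ℝ, ∫ x, (η⁻¹) ^ d * f (η⁻¹ • x) ∂μ = ∫ x, f x ∂μ := by
    intro η hη f
    rw [integral_const_mul, Measure.integral_comp_smul]
    rw [abs_of_nonneg (by positivity), smul_eq_mul, ← mul_assoc, mul_inv_cancel₀ (by positivity), one_mul]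
  let ρ : ℝ → V → ℝ := fun η x => (η⁻¹) ^ d * β (η⁻¹ • x)
  have hρs : ∀ η, ContDiff ℝ ∞ (ρ η) := fun η => contDiff_const.mul (hβs.comp (contDiff_const_smul _))
  have hρ0 : ∀ η, 0 < η → ∀ x, η ≤ ‖x‖ → ρ η x = 0 := by
    intro η hη x hx
    simp only [ρ]
    rw [hβ0, mul_zero]
    rw [norm_smul, norm_inv, Real.norm_of_nonneg hη.le, ← div_eq_inv_mul, le_div_iff₀ hη, one_mul]
    exact hx
  have hρc : ∀ η, 0 < η → HasCompactSupport (ρ η) := fun η hη =>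
    HasCompactSupport.intro (isCompact_closedBall (0 : V) η) fun x hx =>
      hρ0 η hη x (by simpa using (not_le.1 (by simpa using hx : ¬ ‖x‖ ≤ η)).le)
  let Ψ : ℝ → C_c(V, ℂ) := fun η => if hη : 0 < η then
    ⟨⟨fun x => (ρ η x : ℂ), Complex.continuous_ofReal.comp (hρs η).continuous⟩,
      (hρc η hη).comp_left (g := fun t : ℝ => (t : ℂ)) (by simp)⟩ else 0
  have hΨ : ∀ η, 0 < η → ∀ x, Ψ η x = ρ η x := by
    intro η hη x
    simp only [Ψ, dif_pos hη]; rfl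
  have hΨ' : ∀ η, 0 < η → (Ψ η : V → ℂ) = fun x => (ρ η x : ℂ) := fun η hη => funext (hΨ η hη)
  have hΨs : ∀ η, 0 < η → ContDiff ℝ ∞ (Ψ η) := fun η hη => by
    rw [hΨ' η hη]; exact Complex.ofRealCLM.contDiff.comp (hρs η)
  have hΨn : ∀ η, 0 < η → ∀ x, Ψ η (-x) = Ψ η x := fun η hη x => by
    rw [hΨ η hη, hΨ η hη]; simp only [ρ, smul_neg, hβn]
  have hΨr : ∀ η, 0 < η → ∀ x, star (Ψ η x) = Ψ η x := fun η hη x => by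
    rw [hΨ η hη]; exact Complex.conj_ofReal _
  refine ⟨Ψ, fun η hη => ⟨hΨs η hη, hΨn η hη, hΨr η hη, ?_, ?_, fun x hx => ?_⟩, fun X => ?_⟩
  · rw [norm1_eq]
    have : ∀ x, ‖Ψ η x‖ = ρ η x := fun x => by
      rw [hΨ η hη, Complex.norm_real, Real.norm_of_nonneg]
      exact mul_nonneg (by positivity) (hβp _)
    simp_rw [this]
    exact ((hscale η hη β).trans hβ1).le
  · intro i1 i2
    have := BorelSpace.measurable_eq (α := V)
    have e : i1 = borel V := i2.measurable_eq
    subst e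
    have e3 : ∀ x, Ψ η x = ((ρ η x : ℝ) : ℂ) := hΨ η hη
    simp_rw [e3]
    rw [integral_complex_ofReal]
    norm_cast
    exact (hscale η hη β).trans hβ1
  · rw [hΨ η hη, hρ0 η hη x hx]; simp
  · obtain ⟨C, hC0, hC⟩ := exists_norm_fderiv_add_le h X
    -- The bound is scale invariant: the derivative of the rescaled bump costs `η⁻¹`, and the factor
    -- `‖x‖` from the vanishing vector field returns it.
    refine ⟨C * ∫ x, ‖fderiv ℝ β x‖ * ‖x‖ ∂μ, mul_nonneg hC0 (integral_nonneg fun x => by positivity),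
      fun η hη hη1 k hk => ?_⟩
    have hfd : ∀ x, ‖fderiv ℝ (Ψ η) x‖ * ‖x‖ = (η⁻¹) ^ d * (‖fderiv ℝ β (η⁻¹ • x)‖ * ‖η⁻¹ • x‖) := by
      intro x
      have d1 : HasFDerivAt β (fderiv ℝ β (η⁻¹ • x)) (η⁻¹ • x) :=
        (hβs.differentiable (by simp) _).hasFDerivAt
      have d2 : HasFDerivAt (fun y : V => η⁻¹ • y) (η⁻¹ • ContinuousLinearMap.id ℝ V) x :=
        (hasFDerivAt_id x).const_smul η⁻¹
      have d3 : HasFDerivAt (ρ η) _ x := (d1.comp x d2).const_mul ((η⁻¹) ^ d)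
      have d4 := (Complex.ofRealCLM.hasFDerivAt).comp x d3
      have d5 : (Ψ η : V → ℂ) = Complex.ofRealCLM ∘ ρ η := hΨ' η hη
      have d6 : fderiv ℝ (Ψ η) x = Complex.ofRealLI.toContinuousLinearMap.comp
          (((η⁻¹) ^ d) • (fderiv ℝ β (η⁻¹ • x)).comp (η⁻¹ • ContinuousLinearMap.id ℝ V)) := by
        rw [d5, d4.fderiv]; rfl
      rw [d6, LinearIsometry.norm_toContinuousLinearMap_comp, norm_smul, ContinuousLinearMap.comp_smul,
        ContinuousLinearMap.comp_id, norm_smul, norm_smul,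
        Real.norm_of_nonneg (by positivity : 0 ≤ (η⁻¹) ^ d)]
      ring
    have hcs : HasCompactSupport fun x => ‖fderiv ℝ (Ψ η) x‖ * ‖x‖ :=
      ((Ψ η).hasCompactSupport.fderiv ℝ).norm.mul_right
    have hint : Integrable (fun x => C * (‖fderiv ℝ (Ψ η) x‖ * ‖x‖)) μ :=
      ((((hΨs η hη).continuous_fderiv (by simp)).norm.mul continuous_norm).integrable_of_hasCompactSupport
        hcs).const_mul C
    rw [norm1_eq]
    have hle : ∀ x, ‖k x‖ ≤ C * (‖fderiv ℝ (Ψ η) x‖ * ‖x‖) := by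
      intro x
      rw [hk, leftDeriv_add_star h (hΨs η hη) (hΨn η hη) (hΨr η hη)]
      by_cases hx : ‖x‖ ≤ 1
      · refine (ContinuousLinearMap.le_opNorm _ _).trans ?_
        calc _ ≤ ‖fderiv ℝ (Ψ η) x‖ * (C * ‖x‖) := mul_le_mul_of_nonneg_left (hC x hx) (norm_nonneg _)
          _ = _ := by ring
      -- Outside the unit ball the bound on the field is not available, but as `η ≤ 1` the bump
      -- vanishes there.
      · have : (Ψ η : V → ℂ) =ᶠ[𝓝 x] fun _ => 0 := by
          filter_upwards [(isOpen_lt continuous_const continuous_norm).mem_nhds (not_le.1 hx)] with y hy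
          rw [hΨ η hη, hρ0 η hη y (hη1.trans (le_of_lt hy))]; simp
        rw [this.fderiv_eq]; simp
    refine (integral_mono_of_nonneg (Filter.Eventually.of_forall fun x => norm_nonneg _) hint
      (Filter.Eventually.of_forall hle)).trans ?_
    rw [integral_const_mul]
    simp_rw [hfd]
    rw [hscale η hη (fun x => ‖fderiv ℝ β x‖ * ‖x‖)]

end GradedLie
end

noncomputable section

/-! ### Left-invariant first order operators with skew-Hermitian coefficients -/

namespace GradedLie
open MeasureTheory
variable {V : Type*} [NormedAddCommGroup V] [NormedSpace ℝ V] [FiniteDimensional ℝ V] {m : V → V → V}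

section Derivative

/-- The left-invariant derivative of a smooth function with compact support. -/
def lderiv (h : IsExpGroup m) (X : V) (f : C_c(V, ℂ)) : C_c(V, ℂ) :=
  open Classical in if hf : ContDiff ℝ ∞ f then Classical.choose (exists_leftDeriv h hf X) else 0

lemma lderiv_apply (h : IsExpGroup m) (X : V) {f : C_c(V, ℂ)} (hf : ContDiff ℝ ∞ f) (y : V) :
    lderiv h X f y = leftDeriv m X f y := by
  rw [lderiv, dif_pos hf]
  exact Classical.choose_spec (exists_leftDeriv h hf X) y

lemma lderiv_add (h : IsExpGroup m) (X : V) {f g : C_c(V, ℂ)} (hf : ContDiff ℝ ∞ f) (hg : ContDiff ℝ ∞ g) :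
    lderiv h X (f + g) = lderiv h X f + lderiv h X g := by
  ext y
  have hfg : ContDiff ℝ ∞ (f + g : C_c(V, ℂ)) := hf.add hg
  rw [CompactlySupportedContinuousMap.add_apply, lderiv_apply h X hfg, lderiv_apply h X hf, lderiv_apply h X hg]
  have h1 : ∀ {u : V → ℂ}, ContDiff ℝ ∞ u → DifferentiableAt ℝ (fun Z => u (m y Z)) 0 := fun hu =>
    (hu.comp (h.contDiff_mul contDiff_const contDiff_id)).differentiable (by simp) 0
  exact congrArg (fun L => L X) (fderiv_add (h1 hf) (h1 hg))

lemma lderiv_smul (h : IsExpGroup m) (X : V) (c : ℂ) {f : C_c(V, ℂ)} (hf : ContDiff ℝ ∞ f) :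
    lderiv h X (c • f) = c • lderiv h X f := by
  ext y
  have hfc : ContDiff ℝ ∞ (c • f : C_c(V, ℂ)) := contDiff_const.smul hf
  rw [CompactlySupportedContinuousMap.smul_apply, lderiv_apply h X hfc, lderiv_apply h X hf]
  have h1 : DifferentiableAt ℝ (fun Z => f (m y Z)) 0 :=
    (hf.comp (h.contDiff_mul contDiff_const contDiff_id)).differentiable (by simp) 0
  exact congrArg (fun L => L X) (fderiv_const_smul h1 c)

/-- Convolution from the left preserves smooth functions and commutes with left-invariant derivatives. -/
lemma exists_smooth_conv (h : IsExpGroup m) (g f : C_c(V, ℂ)) (hf : ContDiff ℝ ∞ f) :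
    ∃ k : C_c(V, ℂ), ContDiff ℝ ∞ k ∧ incl m k = incl m g * incl m f ∧
      ∀ X, incl m (lderiv h X k) = incl m g * incl m (lderiv h X f) := by
  obtain ⟨k, hk⟩ := exists_conv h g f
  have hk' : (k : V → ℂ) = conv m g f := funext hk
  have hks : ContDiff ℝ ∞ k := by rw [hk']; exact contDiff_conv h g hf
  refine ⟨k, hks, incl_conv hk, fun X => incl_conv fun x => ?_⟩
  rw [lderiv_apply h X hks, hk', leftDeriv_conv h g hf]
  congr 1
  exact (funext (lderiv_apply h X hf)).symm

end Derivative

section Operator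
variable {ι : Type} [Fintype ι]

lemma incl_sum {κ : Type*} (s : Finset κ) (f : κ → C_c(V, ℂ)) : incl m (∑ i ∈ s, f i) = ∑ i ∈ s, incl m (f i) :=
  map_sum (inclₗ m) f s

lemma sum_smul_apply {V : Type*} [TopologicalSpace V] {κ : Type*} [Fintype κ] (c : κ → ℂ) (f : κ → C_c(V, ℂ)) (y : V) :
    (∑ i, c i • f i) y = ∑ i, c i * f i y := by
  induction (Finset.univ : Finset κ) using Finset.cons_induction with
  | empty => simp
  | cons a s ha ih =>
    rw [Finset.sum_cons, Finset.sum_cons, CompactlySupportedContinuousMap.add_apply, ih]; rfl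

lemma toMod_apply {J : Type} (f : J → C_c(V, ℂ)) (S : J) : toMod m f S = incl m (f S) := rfl

variable {J : Type} [Fintype J]

/-- The operator of `∑ X a ⊗ A a` on tuples of smooth functions. -/
def tupleOp (h : IsExpGroup m) (X : ι → V) (A : ι → Matrix J J ℂ) (f : J → C_c(V, ℂ)) (S : J) : C_c(V, ℂ) :=
  ∑ p : ι × J, A p.1 S p.2 • lderiv h (X p.1) (f p.2)

lemma leftOp_sum (h : IsExpGroup m) (X : ι → V) (A : ι → Matrix J J ℂ) {f : J → C_c(V, ℂ)}
    (hf : ∀ S, ContDiff ℝ ∞ (f S)) (S : J) (y : V) :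
    leftOp m (fun S' => f S') S y (∑ a, X a ⊗ₜ[ℝ] A a) = tupleOp h X A f S y := by
  rw [tupleOp, sum_smul_apply, map_sum, Fintype.sum_prod_type]
  refine Finset.sum_congr rfl fun a _ => ?_
  simp_rw [lderiv_apply h _ (hf _)]
  rfl

lemma mem_opGraph_iff (h : IsExpGroup m) (X : ι → V) (A : ι → Matrix J J ℂ) (p : Mod m J × Mod m J) :
    p ∈ opGraph m (∑ a, X a ⊗ₜ[ℝ] A a) ↔
      ∃ f : J → C_c(V, ℂ), (∀ S, ContDiff ℝ ∞ (f S)) ∧ p = (toMod m f, toMod m (tupleOp h X A f)) := by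
  constructor
  · rintro ⟨f, g, hf, hg, rfl⟩
    refine ⟨f, hf, ?_⟩
    have : g = tupleOp h X A f := by
      ext S y; rw [hg, leftOp_sum h X A hf]
    rw [this]
  · rintro ⟨f, hf, rfl⟩
    exact ⟨f, _, hf, fun S y => (leftOp_sum h X A hf S y).symm, rfl⟩

lemma incl_tupleOp (h : IsExpGroup m) (X : ι → V) (A : ι → Matrix J J ℂ) (f : J → C_c(V, ℂ)) (S : J) :
    incl m (tupleOp h X A f S) = ∑ p : ι × J, A p.1 S p.2 • incl m (lderiv h (X p.1) (f p.2)) := by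
  rw [tupleOp, incl_sum]; simp_rw [incl_smul]

/-- The graph of the operator of `∑ X a ⊗ A a`, as a subspace. -/
def graphSubmodule (h : IsExpGroup m) (X : ι → V) (A : ι → Matrix J J ℂ) : Submodule ℂ (Mod m J × Mod m J) where
  carrier := opGraph m (∑ a, X a ⊗ₜ[ℝ] A a)
  add_mem' := by
    intro p q hp hq
    rw [mem_opGraph_iff h] at hp hq ⊢
    obtain ⟨f, hf, rfl⟩ := hp
    obtain ⟨g, hg, rfl⟩ := hq
    refine ⟨f + g, fun S => (hf S).add (hg S), Prod.ext ?_ ?_⟩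
    · exact WithCStarModule.ext fun S => (incl_add (f S) (g S)).symm
    · refine WithCStarModule.ext fun S => ?_
      change incl m _ + incl m _ = incl m _
      rw [incl_tupleOp, incl_tupleOp, incl_tupleOp, ← Finset.sum_add_distrib]
      refine Finset.sum_congr rfl fun p _ => ?_
      rw [Pi.add_apply, lderiv_add h _ (hf _) (hg _), incl_add, smul_add]
  zero_mem' := by
    rw [mem_opGraph_iff h]
    have h0 : ∀ X : V, lderiv h X (0 : C_c(V, ℂ)) = 0 := fun X => by
      have := lderiv_smul h X 0 (f := (0 : C_c(V, ℂ))) contDiff_const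
      simpa using this
    refine ⟨0, fun S => contDiff_const, Prod.ext ?_ ?_⟩
    · exact WithCStarModule.ext fun S => (map_zero (inclₗ m)).symm
    · refine WithCStarModule.ext fun S => ?_
      change 0 = incl m _
      rw [incl_tupleOp]
      simp only [Pi.zero_apply, h0]
      exact (Finset.sum_eq_zero fun p _ => by
        rw [show incl m (0 : C_c(V, ℂ)) = 0 from map_zero (inclₗ m), smul_zero]).symm
  smul_mem' := by
    intro c p hp
    rw [mem_opGraph_iff h] at hp ⊢
    obtain ⟨f, hf, rfl⟩ := hp
    refine ⟨c • f, fun S => contDiff_const.smul (hf S), Prod.ext ?_ ?_⟩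
    · exact WithCStarModule.ext fun S => (incl_smul c (f S)).symm
    · refine WithCStarModule.ext fun S => ?_
      change c • incl m _ = incl m _
      rw [incl_tupleOp, incl_tupleOp, Finset.smul_sum]
      refine Finset.sum_congr rfl fun p _ => ?_
      rw [Pi.smul_apply, lderiv_smul h _ _ (hf _), incl_smul, smul_comm]

lemma mem_graphSubmodule (h : IsExpGroup m) (X : ι → V) (A : ι → Matrix J J ℂ) (p : Mod m J × Mod m J) :
    p ∈ graphSubmodule h X A ↔
      ∃ f : J → C_c(V, ℂ), (∀ S, ContDiff ℝ ∞ (f S)) ∧ p = (toMod m f, toMod m (tupleOp h X A f)) :=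
  mem_opGraph_iff h X A p

/-- Fields and matrices are both skew, and the two signs cancel. -/
lemma inner_graphSubmodule (h : IsExpGroup m) (X : ι → V) {A : ι → Matrix J J ℂ} (hA : ∀ a, (A a).conjTranspose = -A a)
    {p q : Mod m J × Mod m J} (hp : p ∈ graphSubmodule h X A) (hq : q ∈ graphSubmodule h X A) :
    inner (CStar m) p.2 q.1 = inner (CStar m) p.1 q.2 := by
  rw [mem_graphSubmodule] at hp hq
  obtain ⟨f, hf, rfl⟩ := hp
  obtain ⟨g, hg, rfl⟩ := hq
  have hA' : ∀ a S S', star (A a S S') = -A a S' S := fun a S S' => by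
    have := congrFun (congrFun (hA a) S') S
    simpa using this
  rw [WithCStarModule.pi_inner, WithCStarModule.pi_inner]
  simp only [WithCStarModule.inner_def, toMod_apply, incl_tupleOp, star_sum, star_smul, Finset.mul_sum,
    Finset.sum_mul, mul_smul_comm, smul_mul_assoc, hA']
  have key : ∀ a S S', incl m (g S) * star (incl m (lderiv h (X a) (f S'))) =
      -(incl m (lderiv h (X a) (g S)) * star (incl m (f S'))) := fun a S S' => by
    rw [incl_leftDeriv_mul_star h (hf S') (hg S) (lderiv_apply h _ (hf S')) (lderiv_apply h _ (hg S)), neg_neg]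
  simp only [key, smul_neg, neg_smul, neg_neg, Fintype.sum_prod_type]
  rw [Finset.sum_comm]
  conv_rhs => rw [Finset.sum_comm]
  refine Finset.sum_congr rfl fun a _ => ?_
  rw [Finset.sum_comm]

end Operator

section Topology
variable {J : Type}

lemma continuous_mod_iff [Fintype J] {T : Type*} [TopologicalSpace T] {f : T → Mod m J} :
    Continuous f ↔ ∀ S, Continuous fun t => f t S := by
  have h1 : Continuous f ↔ Continuous fun t => WithCStarModule.equiv (CStar m) (J → CStar m) (f t) :=
    continuous_induced_rng
  rw [h1, continuous_pi_iff]
  rfl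

lemma continuous_mod_apply [Fintype J] (S : J) : Continuous fun x : Mod m J => x S :=
  continuous_mod_iff.1 continuous_id S

lemma mod_smul_apply (a : CStar m) (x : Mod m J) (S : J) : (a • x) S = a * x S := rfl

lemma continuous_mod_smul [Fintype J] : Continuous fun p : CStar m × Mod m J => p.1 • p.2 := by
  rw [continuous_mod_iff]
  intro S
  simp_rw [mod_smul_apply]
  exact continuous_fst.mul ((continuous_mod_apply S).comp continuous_snd)

end Topology

end GradedLie
end

/-! ### ### Dense range and regularity for left-invariant operators -/

noncomputable section

namespace GradedLie
open MeasureTheory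
variable {V : Type*} [NormedAddCommGroup V] [NormedSpace ℝ V] [FiniteDimensional ℝ V] {m : V → V → V}
  {J : Type} [Fintype J] {ι : Type} [Fintype ι]

/-- A selfadjoint smooth approximate unit `Ψ` of the group C*-algebra such that `X Ψ + (X Ψ)^*` stays bounded. -/
lemma exists_approxUnit (h : IsExpGroup m) : ∃ Ψ : ℝ → C_c(V, ℂ),
    (∀ η, 0 < η → ContDiff ℝ ∞ (Ψ η) ∧ star (incl m (Ψ η)) = incl m (Ψ η) ∧ ‖incl m (Ψ η)‖ ≤ 1) ∧
    (∀ (y : CStar m) (ε : ℝ), 0 < ε → ∀ᶠ η in 𝓝[>] 0, ‖y * incl m (Ψ η) - y‖ ≤ ε) ∧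
    ∀ X, ∃ C, 0 ≤ C ∧ ∀ η, 0 < η → η ≤ 1 →
      ‖incl m (lderiv h X (Ψ η)) + star (incl m (lderiv h X (Ψ η)))‖ ≤ C := by
  obtain ⟨Ψ, hΨ, hF⟩ := exists_mollifier h
  have hn : ∀ η, 0 < η → ‖incl m (Ψ η)‖ ≤ 1 := fun η hη => (norm_incl_le _).trans (hΨ η hη).2.2.2.1
  refine ⟨Ψ, fun η hη => ⟨(hΨ η hη).1, ?_, hn η hη⟩, fun y ε hε => ?_, fun X => ?_⟩
  · refine (incl_star fun x => ?_).symm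
    rw [(hΨ η hη).2.1, (hΨ η hη).2.2.1]
  · obtain ⟨f, hf⟩ := Metric.denseRange_iff.1 (denseRange_incl h) y (ε / 3) (by positivity)
    obtain ⟨η₀, hη₀, h1⟩ := exists_conv_sub_le h f (ε := ε / 3) (by positivity)
    filter_upwards [Ioc_mem_nhdsGT hη₀] with η hη
    have h2 := h1 (Ψ η) (hΨ η hη.1).2.1 (hΨ η hη.1).2.2.2.1 (hΨ η hη.1).2.2.2.2.1
      fun x hx => (hΨ η hη.1).2.2.2.2.2 x (hη.2.trans hx)
    have h3 : y * incl m (Ψ η) - y = (y - incl m f) * incl m (Ψ η) +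
        (incl m f * incl m (Ψ η) - incl m f) - (y - incl m f) := by rw [sub_mul]; abel
    rw [h3]
    rw [dist_eq_norm] at hf
    have h4 : ‖(y - incl m f) * incl m (Ψ η)‖ ≤ ε / 3 :=
      (norm_mul_le _ _).trans ((mul_le_of_le_one_right (norm_nonneg _) (hn η hη.1)).trans hf.le)
    calc _ ≤ ‖(y - incl m f) * incl m (Ψ η)‖ + ‖incl m f * incl m (Ψ η) - incl m f‖ + ‖y - incl m f‖ :=
          (norm_sub_le _ _).trans (add_le_add_left (norm_add_le _ _) _)
      _ ≤ ε / 3 + ε / 3 + ε / 3 := add_le_add (add_le_add h4 h2) hf.le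
      _ = ε := by ring
  · obtain ⟨C, hC0, hC⟩ := hF X
    refine ⟨C, hC0, fun η hη hη1 => ?_⟩
    obtain ⟨g, hg⟩ := exists_star (lderiv h X (Ψ η))
    rw [← incl_star hg, ← incl_add]
    refine (norm_incl_le _).trans (hC η hη hη1 _ fun x => ?_)
    rw [CompactlySupportedContinuousMap.add_apply, hg, lderiv_apply h X (hΨ η hη).1,
      lderiv_apply h X (hΨ η hη).1]

/-- The module action of a function is convolution from the left, which commutes with left-invariant
fields and keeps smoothness. -/
lemma smul_mem_graphSubmodule (h : IsExpGroup m) (X : ι → V) (A : ι → Matrix J J ℂ) (g : C_c(V, ℂ))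
    {p : Mod m J × Mod m J} (hp : p ∈ graphSubmodule h X A) :
    (incl m g • p.1, incl m g • p.2) ∈ graphSubmodule h X A := by
  rw [mem_graphSubmodule] at hp ⊢
  obtain ⟨f, hf, rfl⟩ := hp
  choose k hk1 hk2 hk3 using fun S => exists_smooth_conv h g (f S) (hf S)
  refine ⟨k, hk1, Prod.ext ?_ ?_⟩
  · exact WithCStarModule.ext fun S => (hk2 S).symm
  · refine WithCStarModule.ext fun S => ?_
    change incl m g * incl m _ = incl m _
    rw [incl_tupleOp, incl_tupleOp, Finset.mul_sum]
    refine Finset.sum_congr rfl fun p _ => ?_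
    rw [hk3, mul_smul_comm]

lemma smul_mem_closure_graph (h : IsExpGroup m) (X : ι → V) (A : ι → Matrix J J ℂ) (a : CStar m)
    {p : Mod m J × Mod m J} (hp : p ∈ graphSubmodule h X A) :
    (a • p.1, a • p.2) ∈ (graphSubmodule h X A).topologicalClosure := by
  have hc : ∀ x : Mod m J, Continuous fun a : CStar m => a • x := fun x =>
    continuous_mod_smul.comp (by fun_prop : Continuous fun a : CStar m => (a, x))
  refine (denseRange_incl h).induction_on a ?_ fun g => ?_
  · exact (graphSubmodule h X A).isClosed_topologicalClosure.preimage ((hc p.1).prodMk (hc p.2))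
  · exact Submodule.le_topologicalClosure _ (smul_mem_graphSubmodule h X A g hp)

/-- Mollify: `g * Ψ η` is smooth and approximates `g` in the C*-norm. -/
lemma dense_domain_graphSubmodule (h : IsExpGroup m) (X : ι → V) (A : ι → Matrix J J ℂ) :
    Dense {x | ∃ y, (x, y) ∈ graphSubmodule h X A} := by
  obtain ⟨Ψ, hΨ, hΨ1, -⟩ := exists_approxUnit h
  intro x
  rw [Metric.mem_closure_iff]
  intro ε hε
  set N : ℝ := Fintype.card J + 1 with hN
  have hN0 : 0 < N := by positivity
  have h1 : ∀ S, ∃ f : C_c(V, ℂ), ContDiff ℝ ∞ f ∧ ‖x S - incl m f‖ ≤ ε / 2 / N := by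
    intro S
    obtain ⟨g, hg⟩ := Metric.denseRange_iff.1 (denseRange_incl h) (x S) (ε / 2 / N / 2) (by positivity)
    obtain ⟨η, hη1, hη⟩ := ((hΨ1 (incl m g) (ε / 2 / N / 2) (by positivity)).and
      self_mem_nhdsWithin).exists
    obtain ⟨k, hk, hk2, -⟩ := exists_smooth_conv h g (Ψ η) (hΨ η hη).1
    refine ⟨k, hk, ?_⟩
    rw [hk2]
    have e : x S - incl m g * incl m (Ψ η) = (x S - incl m g) - (incl m g * incl m (Ψ η) - incl m g) := by abel
    rw [e]
    rw [dist_eq_norm] at hg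
    exact (norm_sub_le _ _).trans ((add_le_add hg.le hη1).trans (by linarith))
  choose f hf1 hf2 using h1
  refine ⟨toMod m f, ⟨_, (mem_graphSubmodule h X A _).2 ⟨f, hf1, rfl⟩⟩, ?_⟩
  rw [dist_eq_norm]
  refine (WithCStarModule.pi_norm_le_sum_norm _).trans_lt ?_
  refine (Finset.sum_le_sum fun S _ => (hf2 S : ‖(x - toMod m f) S‖ ≤ _)).trans_lt ?_
  rw [Finset.sum_const, Finset.card_univ, nsmul_eq_mul, mul_div_assoc', div_lt_iff₀ hN0]
  nlinarith

/-- The zero-order term `ilψ` grows with `l`, whereas the self-adjoint part of `Xψ`, the only part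
of the derivative left in `c - c*`, is bounded uniformly in the mollifier. Hence `submodule_eq_top`
applies for large `|l|`, of either sign. -/
lemma exists_dense_range (h : IsExpGroup m) (X : ι → V) {A : ι → Matrix J J ℂ} (hA : ∀ a, (A a).conjTranspose = -A a) :
    ∃ l₀ : ℝ, 1 ≤ l₀ ∧ ∀ l : ℝ, l₀ ≤ |l| →
      Dense {w : Mod m J | ∃ p ∈ graphSubmodule h X A, w = p.2 + (Complex.I * l) • p.1} := by
  classical
  obtain ⟨Ψ, hΨ, hΨ1, hF⟩ := exists_approxUnit h
  choose K hK0 hK using hF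
  -- The total entrywise size of `∑ A_a (X_a ψ + (X_a ψ)*)`; the threshold `C + 1` gives both `C <
  -- |l|` and `1 ≤ |l|`.
  set C : ℝ := ∑ i : J, ∑ j : J, ∑ a, ‖A a j i‖ * K (X a) with hC
  have hC0 : 0 ≤ C := Finset.sum_nonneg fun i _ => Finset.sum_nonneg fun j _ => Finset.sum_nonneg fun a _ =>
    mul_nonneg (norm_nonneg _) (hK0 _)
  refine ⟨C + 1, by linarith, fun l hl => ?_⟩
  set T : (Mod m J × Mod m J) →L[ℂ] Mod m J :=
    ContinuousLinearMap.snd ℂ _ _ + (Complex.I * l) • ContinuousLinearMap.fst ℂ _ _ with hT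
  have hTa : ∀ p, T p = p.2 + (Complex.I * l) • p.1 := fun p => rfl
  set R := (graphSubmodule h X A).map T.toLinearMap with hR
  have hset : {w : Mod m J | ∃ p ∈ graphSubmodule h X A, w = p.2 + (Complex.I * l) • p.1} = (R : Set (Mod m J)) := by
    ext w
    constructor
    · rintro ⟨p, hp, rfl⟩; exact ⟨p, hp, rfl⟩
    · rintro ⟨p, hp, rfl⟩; exact ⟨p, hp, rfl⟩
  rw [hset]
  have htop : R.topologicalClosure = ⊤ := by
    refine CStarDensity.submodule_eq_top (l := l) (C := C) R.topologicalClosure R.isClosed_topologicalClosure ?_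
      (by linarith) ?_
    · intro a x hx
      have hc : Continuous fun x : Mod m J => a • x :=
        continuous_mod_smul.comp (by fun_prop : Continuous fun x : Mod m J => (a, x))
      have h2 : ∀ x ∈ R, a • x ∈ R.topologicalClosure := by
        rintro _ ⟨p, hp, rfl⟩
        have h3 := smul_mem_closure_graph h X A a hp
        have h4 := map_mem_closure T.continuous h3 (t := (R : Set (Mod m J))) fun q hq => ⟨q, hq, rfl⟩
        have h5 : a • T p = T (a • p.1, a • p.2) := by
          rw [hTa, hTa]
          refine WithCStarModule.ext fun S => ?_
          change a * (p.2 S + (Complex.I * l) • p.1 S) = a * p.2 S + (Complex.I * l) • (a * p.1 S)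
          rw [mul_add, mul_smul_comm]
        exact h5 ▸ h4
      exact closure_minimal (s := (R : Set (Mod m J))) h2 (R.isClosed_topologicalClosure.preimage hc) hx
    · intro s δ hδ
      have h1 : ∀ᶠ η in 𝓝[>] (0 : ℝ), ∀ y ∈ s, ‖y * incl m (Ψ η) - y‖ ≤ δ := by
        rw [Filter.eventually_all_finset]
        exact fun y _ => hΨ1 y δ hδ
      obtain ⟨η, hη1, hη⟩ := (h1.and (Ioc_mem_nhdsGT (zero_lt_one' ℝ))).exists
      obtain ⟨hs, hstar, hnorm⟩ := hΨ η hη.1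
      set ψ := incl m (Ψ η) with hψ
      set D := fun a => incl m (lderiv h (X a) (Ψ η)) with hD
      have hsingle : ∀ i S : J, ContDiff ℝ ∞ ((Pi.single i (Ψ η) : J → C_c(V, ℂ)) S) := by
        intro i S
        by_cases hi : S = i
        · subst hi; rw [Pi.single_eq_same]; exact hs
        · rw [Pi.single_eq_of_ne hi]; exact contDiff_const
      have h0 : ∀ X : V, incl m (lderiv h X (0 : C_c(V, ℂ))) = 0 := fun X => by
        have := lderiv_smul h X 0 (f := (0 : C_c(V, ℂ))) contDiff_const
        rw [zero_smul, zero_smul] at this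
        rw [this]; exact map_zero (inclₗ m)
      -- Row `i` of `c` is the image under `σ + il` of the tuple with `Ψ η` in place `i` and zero
      -- elsewhere.
      refine ⟨ψ, hstar, hnorm, hη1, fun i S => (∑ a, A a S i • D a) + (Complex.I * l) • (if i = S then ψ else 0),
        fun i => ?_, ?_⟩
      · refine Submodule.le_topologicalClosure _ ⟨_, (mem_graphSubmodule h X A _).2
          ⟨Pi.single i (Ψ η), hsingle i, rfl⟩, ?_⟩
        change T _ = _
        rw [hTa]
        refine WithCStarModule.ext fun S => ?_
        change incl m _ + (Complex.I * l) • incl m _ = _ + _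
        rw [incl_tupleOp]
        congr 1
        · rw [Fintype.sum_prod_type]
          refine Finset.sum_congr rfl fun a _ => ?_
          rw [Finset.sum_eq_single i]
          · simp only [Pi.single_eq_same]; rfl
          · intro j _ hj
            simp only [Pi.single_eq_of_ne hj, h0, smul_zero]
          · simp
        · by_cases hi : i = S
          · subst hi; simp [hψ]
          · simp only [Pi.single_eq_of_ne (Ne.symm hi), if_neg hi]
            congr 1; exact map_zero (inclₗ m)
      · have hA' : ∀ a S S', star (A a S S') = -A a S' S := fun a S S' => by
          have := congrFun (congrFun (hA a) S') S
          simpa using this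
        have hle : ∀ i j, ‖((∑ a, A a j i • D a) + (Complex.I * l) • (if i = j then ψ else 0)) -
            star ((∑ a, A a i j • D a) + (Complex.I * l) • (if j = i then ψ else 0)) -
            (2 * l * Complex.I) • (if i = j then ψ else 0)‖ ≤ ∑ a, ‖A a j i‖ * K (X a) := by
          intro i j
          have e1 : star (if j = i then ψ else (0 : CStar m)) = if i = j then ψ else 0 := by
            by_cases hi : i = j
            · simp [hi, hstar]
            · simp [hi, Ne.symm hi]
          -- Since `A_a` is skew-Hermitian, the adjoint of the transposed entry contributes `+ A_a j
          -- i • (D a)*`, and the terms in `l` cancel exactly.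
          have e2 : ((∑ a, A a j i • D a) + (Complex.I * l) • (if i = j then ψ else 0)) -
            star ((∑ a, A a i j • D a) + (Complex.I * l) • (if j = i then ψ else 0)) -
            (2 * l * Complex.I) • (if i = j then ψ else 0) = ∑ a, A a j i • (D a + star (D a)) := by
            have e3 : star (Complex.I * (l : ℂ)) = -(Complex.I * l) := by simp
            rw [star_add, star_sum, star_smul, e1, e3]
            simp only [star_smul, hA', neg_smul, Finset.sum_neg_distrib, smul_add, Finset.sum_add_distrib]
            module
          rw [e2]
          refine (norm_sum_le _ _).trans (Finset.sum_le_sum fun a _ => ?_)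
          rw [norm_smul]
          exact mul_le_mul_of_nonneg_left (hK (X a) η hη.1 hη.2) (norm_nonneg _)
        refine (Finset.sum_le_sum fun i _ => Finset.sum_le_sum fun j _ => hle i j).trans ?_
        rw [← hC]; linarith
  rw [← Submodule.dense_iff_topologicalClosure_eq_top] at htop
  exact htop

theorem exists_regular_closure_opGraph (h : IsExpGroup m) (X : ι → V) {A : ι → Matrix J J ℂ}
    (hA : ∀ a, (A a).conjTranspose = -A a) :
    (∃ l₀ : ℝ, 1 ≤ l₀ ∧ ∀ l : ℝ, l₀ ≤ l →
      Dense {w : Mod m J | ∃ p ∈ opGraph m (∑ a, X a ⊗ₜ[ℝ] A a), w = p.2 + (Complex.I * l) • p.1} ∧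
      Dense {w : Mod m J | ∃ p ∈ opGraph m (∑ a, X a ⊗ₜ[ℝ] A a), w = p.2 - (Complex.I * l) • p.1}) ∧
    ∃ T : Mod m J →ₗ.[ℂ] Mod m J,
      (T.graph : Set (Mod m J × Mod m J)) = closure (opGraph m (∑ a, X a ⊗ₜ[ℝ] A a)) ∧
      HilbertModule.IsSelfAdjointOp (CStar m) T ∧ HilbertModule.IsRegularOp (CStar m) T := by
  obtain ⟨l₀, hl₀, hd⟩ := exists_dense_range h X hA
  have hp : ∀ l : ℝ, l₀ ≤ l →
      Dense {w : Mod m J | ∃ p ∈ graphSubmodule h X A, w = p.2 + (Complex.I * l) • p.1} := fun l hl =>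
    hd l (hl.trans (le_abs_self l))
  have hm : ∀ l : ℝ, l₀ ≤ l →
      Dense {w : Mod m J | ∃ p ∈ graphSubmodule h X A, w = p.2 - (Complex.I * l) • p.1} := fun l hl => by
    have := hd (-l) (by rw [abs_neg]; exact hl.trans (le_abs_self l))
    refine this.mono ?_
    rintro w ⟨p, hp, rfl⟩
    exact ⟨p, hp, by push_cast; module⟩
  refine ⟨⟨l₀, hl₀, fun l hl => ⟨hp l hl, hm l hl⟩⟩, ?_⟩
  refine HilbertModule.exists_regular_closure (graphSubmodule h X A)
    (fun p hp q hq => inner_graphSubmodule h X hA hp hq) (dense_domain_graphSubmodule h X A) (fun a => ?_)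
    (fun a p hp => smul_mem_closure_graph h X A a hp) hl₀ (hp l₀ le_rfl) (hm l₀ le_rfl)
  exact continuous_mod_smul.comp (by fun_prop : Continuous fun x : Mod m J => (a, x))

end GradedLie
end

noncomputable section

/-! ### Clifford multiplication is Hermitian -/

section Exterior
variable {W : Type*} [AddCommGroup W] [Module ℂ W] {d : ℕ}

lemma exteriorBasis_eq_prod (e : Module.Basis (Fin d) ℂ W) (s : Finset (Fin d)) :
    e.ExteriorAlgebra s = ((s.sort (· ≤ ·)).map fun i => ExteriorAlgebra.ι ℂ (e i)).prod := by
  rw [ExteriorAlgebra.basis_apply_ofCard e (rfl : s.card = s.card)]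
  rw [ExteriorAlgebra.ιMulti_family, ExteriorAlgebra.ιMulti_apply]
  congr 1
  refine List.ext_getElem (by simp) fun k h1 h2 => ?_
  simp only [List.getElem_ofFn, List.getElem_map, Function.comp_apply]
  congr 2

lemma ι_mul_exteriorBasis_of_lt (e : Module.Basis (Fin d) ℂ W) {s : Finset (Fin d)} {i : Fin d}
    (h : ∀ j ∈ s, i < j) : ExteriorAlgebra.ι ℂ (e i) * e.ExteriorAlgebra s = e.ExteriorAlgebra (insert i s) := by
  rw [exteriorBasis_eq_prod, exteriorBasis_eq_prod,
    Finset.sort_insert _ (fun j hj => (h j hj).le) (fun hi => lt_irrefl _ (h i hi)), List.map_cons, List.prod_cons]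

/-- The sign of the permutation sorting `i` into `s`. -/
def insertSign (i : Fin d) (s : Finset (Fin d)) : ℂ := (-1) ^ (s.filter (· < i)).card

/-- Peel off the smallest index `j` of the set: exchanging `e i` with `e j` costs one sign precisely
when `j < i`, which is what `insertSign` counts. -/
lemma ι_mul_exteriorBasis (e : Module.Basis (Fin d) ℂ W) (i : Fin d) (s : Finset (Fin d)) :
    ExteriorAlgebra.ι ℂ (e i) * e.ExteriorAlgebra s =
      if i ∈ s then 0 else insertSign i s • e.ExteriorAlgebra (insert i s) := by
  induction s using Finset.induction_on_min with
  | empty =>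
    rw [ι_mul_exteriorBasis_of_lt e (by simp)]
    simp [insertSign]
  | insert j t hj ih =>
    have hjt : j ∉ t := fun h => lt_irrefl _ (hj j h)
    rcases lt_trichotomy i j with hij | rfl | hij
    · have h1 : ∀ k ∈ insert j t, i < k := by
        intro k hk
        rcases Finset.mem_insert.1 hk with rfl | hk
        · exact hij
        · exact hij.trans (hj k hk)
      have h2 : i ∉ insert j t := fun h => lt_irrefl _ (h1 i h)
      rw [ι_mul_exteriorBasis_of_lt e h1, if_neg h2]
      have : (insert j t).filter (· < i) = ∅ := Finset.filter_eq_empty_iff.2 fun k hk => (h1 k hk).not_gt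
      simp [insertSign, this]
    · rw [if_pos (Finset.mem_insert_self _ _), ← ι_mul_exteriorBasis_of_lt e hj, ← mul_assoc,
        ExteriorAlgebra.ι_sq_zero, zero_mul]
    · rw [← ι_mul_exteriorBasis_of_lt e hj, ← mul_assoc,
        eq_neg_of_add_eq_zero_left (ExteriorAlgebra.ι_add_mul_swap (e i) (e j)), neg_mul, mul_assoc, ih]
      by_cases hit : i ∈ t
      · rw [if_pos hit, if_pos (Finset.mem_insert_of_mem hit)]; simp
      · have h2 : i ∉ insert j t := by simp [hit, hij.ne']
        rw [if_neg hit, if_neg h2, mul_smul_comm, ι_mul_exteriorBasis_of_lt e, Finset.insert_comm, ← neg_smul]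
        · congr 1
          rw [insertSign, insertSign, Finset.filter_insert, if_pos hij, Finset.card_insert_of_notMem, pow_succ]
          · ring
          · simp [hjt]
        · intro k hk
          rcases Finset.mem_insert.1 hk with rfl | hk
          · exact hij
          · exact hj k hk

/-- Contraction with a coordinate functional. -/
def contractCoord (e : Module.Basis (Fin d) ℂ W) (i : Fin d) : Module.End ℂ (ExteriorAlgebra ℂ W) :=
  CliffordAlgebra.contractLeft (Q := (0 : QuadraticForm ℂ W)) (e.coord i)

lemma contractCoord_ι_mul (e : Module.Basis (Fin d) ℂ W) (i j : Fin d) (x : ExteriorAlgebra ℂ W) :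
    contractCoord e i (ExteriorAlgebra.ι ℂ (e j) * x) =
      (if j = i then (1 : ℂ) else 0) • x - ExteriorAlgebra.ι ℂ (e j) * contractCoord e i x := by
  have := CliffordAlgebra.contractLeft_ι_mul (Q := (0 : QuadraticForm ℂ W)) (e.coord i) (e j) x
  refine this.trans ?_
  rw [Module.Basis.coord_apply, e.repr_self, Finsupp.single_apply]
  rfl

/-- The same induction with the antiderivation rule; the sign is that of exterior multiplication,
whence the adjointness below. -/
lemma contractCoord_exteriorBasis (e : Module.Basis (Fin d) ℂ W) (i : Fin d) (s : Finset (Fin d)) :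
    contractCoord e i (e.ExteriorAlgebra s) =
      if i ∈ s then insertSign i s • e.ExteriorAlgebra (s.erase i) else 0 := by
  induction s using Finset.induction_on_min with
  | empty =>
    have h1 : e.ExteriorAlgebra ∅ = 1 := by rw [exteriorBasis_eq_prod]; simp
    rw [h1]
    exact (CliffordAlgebra.contractLeft_one (Q := (0 : QuadraticForm ℂ W)) (e.coord i)).trans (by simp)
  | insert j t hj ih =>
    have hjt : j ∉ t := fun h => lt_irrefl _ (hj j h)
    rw [← ι_mul_exteriorBasis_of_lt e hj, contractCoord_ι_mul, ih]
    by_cases hij : j = i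
    · subst hij
      have : (insert j t).filter (· < j) = ∅ := Finset.filter_eq_empty_iff.2 fun k hk => by
        rcases Finset.mem_insert.1 hk with rfl | hk
        · exact lt_irrefl _
        · exact (hj k hk).not_gt
      simp [hjt, insertSign, this]
    · by_cases hit : i ∈ t
      · have hji : j < i := hj i hit
        rw [if_neg hij, if_pos hit, if_pos (Finset.mem_insert_of_mem hit), zero_smul, zero_sub, mul_smul_comm,
          ι_mul_exteriorBasis_of_lt e (fun k hk => hj k (Finset.mem_of_mem_erase hk)),
          Finset.erase_insert_of_ne hij, ← neg_smul]
        congr 1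
        rw [insertSign, insertSign, Finset.filter_insert, if_pos hji, Finset.card_insert_of_notMem, pow_succ]
        · ring
        · simp [hjt]
      · have : i ∉ insert j t := by simp [hit, Ne.symm hij]
        simp [hij, hit, this]

/-- Inserting `i` and erasing `i` are mutually inverse partial maps of index sets and carry the same
real sign, as `i` is not counted among the elements below `i`. -/
lemma toMatrix_contractCoord (e : Module.Basis (Fin d) ℂ W) (i : Fin d) :
    LinearMap.toMatrix e.ExteriorAlgebra e.ExteriorAlgebra (contractCoord e i) =
      (LinearMap.toMatrix e.ExteriorAlgebra e.ExteriorAlgebra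
        (LinearMap.mulLeft ℂ (ExteriorAlgebra.ι ℂ (e i)))).conjTranspose := by
  ext s t
  rw [Matrix.conjTranspose_apply, LinearMap.toMatrix_apply, LinearMap.toMatrix_apply, LinearMap.mulLeft_apply,
    contractCoord_exteriorBasis, ι_mul_exteriorBasis]
  have hsign : ∀ s, star (insertSign i s) = insertSign i s := fun s => by simp [insertSign]
  by_cases hs : i ∈ s
  · rw [if_pos hs, map_zero, Finsupp.zero_apply, star_zero]
    by_cases ht : i ∈ t
    · rw [if_pos ht, map_smul, Module.Basis.repr_self, Finsupp.smul_apply, Finsupp.single_eq_of_ne, smul_zero]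
      rintro rfl
      simp at hs
    · rw [if_neg ht, map_zero, Finsupp.zero_apply]
  · rw [if_neg hs, map_smul, Module.Basis.repr_self, Finsupp.smul_apply, Finsupp.single_apply]
    by_cases ht : i ∈ t
    · rw [if_pos ht, map_smul, Module.Basis.repr_self, Finsupp.smul_apply, Finsupp.single_apply]
      by_cases hst : insert i s = t
      · have h2 : t.erase i = s := by rw [← hst, Finset.erase_insert hs]
        rw [if_pos hst, if_pos h2, smul_eq_mul, smul_eq_mul, mul_one, mul_one, hsign, ← hst]
        rw [insertSign, insertSign, Finset.filter_insert, if_neg (lt_irrefl i)]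
      · have h2 : ¬ t.erase i = s := fun h => hst (by rw [← h, Finset.insert_erase ht])
        rw [if_neg hst, if_neg h2]; simp
    · rw [if_neg ht, if_neg]
      · simp
      · rintro rfl; simp at ht

end Exterior

section Cliff
variable {V : Type*} [NormedAddCommGroup V] [InnerProductSpace ℝ V] {d : ℕ}

/-- `cliff v` is a combination, with the real coefficients `⟪b i, v⟫`, of exterior multiplication by
a basis covector plus its adjoint. -/
lemma toMatrix_cliff_conjTranspose (b : OrthonormalBasis (Fin d) ℝ V) (v : V) :
    (LinearMap.toMatrix (formBasis b.toBasis) (formBasis b.toBasis) (cliff v)).conjTranspose =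
      LinearMap.toMatrix (formBasis b.toBasis) (formBasis b.toBasis) (cliff v) := by
  set e : Module.Basis (Fin d) ℂ (V →ₗ[ℝ] ℂ) := Module.Basis.ofEquivFun (b.toBasis.constr ℂ).symm with he
  have hform : formBasis b.toBasis = e.ExteriorAlgebra := rfl
  have heb : ∀ i j, e i (b j) = if j = i then 1 else 0 := by
    intro i j
    rw [he, Module.Basis.coe_ofEquivFun, LinearEquiv.symm_symm]
    have := b.toBasis.constr_basis ℂ (Pi.single i (1 : ℂ)) j
    rw [b.coe_toBasis] at this
    rw [this, Pi.single_apply]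
  have hco : ∀ i (l : V →ₗ[ℝ] ℂ), e.coord i l = l (b i) := by
    intro i l
    rw [Module.Basis.coord_apply]
    change (Module.Basis.ofEquivFun (b.toBasis.constr ℂ).symm).equivFun l i = _
    rw [Module.Basis.equivFun_ofEquivFun]
    simp
  have hflat : flat v = ∑ i, (inner ℝ (b i) v : ℂ) • e i := by
    refine b.toBasis.ext fun j => ?_
    rw [b.coe_toBasis, LinearMap.sum_apply]
    simp only [LinearMap.smul_apply, heb]
    simp [flat, real_inner_comm]
  have hev : evalAt v = ∑ i, (inner ℝ (b i) v : ℂ) • e.coord i := by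
    ext l
    rw [LinearMap.sum_apply]
    simp only [LinearMap.smul_apply, hco]
    change l v = _
    conv_lhs => rw [← b.sum_repr' v, map_sum]
    simp
  have hcl : cliff v = ∑ i, (inner ℝ (b i) v : ℂ) •
      (LinearMap.mulLeft ℂ (ExteriorAlgebra.ι ℂ (e i)) + contractCoord e i) := by
    rw [cliff, hflat, hev]
    simp only [smul_add, Finset.sum_add_distrib, map_sum, map_smul]
    congr 1
    · ext x; simp [Finset.sum_mul]
  rw [hcl, hform, map_sum, Matrix.conjTranspose_sum]
  refine Finset.sum_congr rfl fun i _ => ?_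
  rw [map_smul, map_add, toMatrix_contractCoord, Matrix.conjTranspose_smul, Matrix.conjTranspose_add,
    Matrix.conjTranspose_conjTranspose, add_comm]
  simp

end Cliff
end

noncomputable section

/-! ### The osculating Lie algebra is graded nilpotent -/

section Osculating
variable {E : Type*} [NormedAddCommGroup E] [NormedSpace ℝ E]
  {M : Type*} [TopologicalSpace M] [ChartedSpace E M] [IsManifold 𝓘(ℝ, E) ∞ M]

lemma SmoothVF.bracket [FiniteDimensional ℝ E] {X Y : Π y : M, TangentSpace 𝓘(ℝ, E) y} {x : M} (hX : SmoothVF X x)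
    (hY : SmoothVF Y x) : SmoothVF (VectorField.mlieBracket 𝓘(ℝ, E) X Y) x := by
  have : CompleteSpace E := FiniteDimensional.complete ℝ E
  have hM : IsManifold 𝓘(ℝ, E) ((⊤ : ℕ∞) + 1) M := by simpa using! (inferInstance : IsManifold 𝓘(ℝ, E) ∞ M)
  have hM' : IsManifold 𝓘(ℝ, E) (minSmoothness ℝ 2) M := by
    rw [minSmoothness_of_isRCLikeNormedField]
    exact IsManifold.of_le (n := ∞) (WithTop.coe_le_coe.2 (le_top : ((2 : ℕ) : ℕ∞) ≤ ⊤))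
  filter_upwards [hX, hY] with y h1 h2
  exact ContMDiffAt.mlieBracket_vectorField (n := ⊤) (m := ⊤) h1 h2 (by simp)

namespace Filtration
variable {n : ℕ} {𝓕 : Filtration E M n}

lemma IsSection.bracket [FiniteDimensional ℝ E] {i j : ℕ} {x : M} {X Y : Π y : M, TangentSpace 𝓘(ℝ, E) y}
    (hX : 𝓕.IsSection i x X) (hY : 𝓕.IsSection j x Y) :
    𝓕.IsSection (i + j) x (VectorField.mlieBracket 𝓘(ℝ, E) X Y) := by
  refine ⟨hX.1.bracket hY.1, ?_⟩
  filter_upwards [hX.1.eventually_nhds, hY.1.eventually_nhds, hX.2.eventually_nhds, hY.2.eventually_nhds]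
    with y h1 h2 h3 h4
  exact 𝓕.bracket i j y X Y h1 h2 h3 h4

variable (𝓕) (x : M)

open Classical in
/-- The class in degree `i + 1`, zero in degrees larger than `n`, of a vector of `H (i + 1)`. -/
def clsN (i : ℕ) (v : TangentSpace 𝓘(ℝ, E) x) : 𝓕.Gr x :=
  if h : ∃ _ : i < n, v ∈ 𝓕.H (i + 1) x then 𝓕.cls x ⟨i, h.1⟩ ⟨v, h.2⟩ else 0

lemma clsN_eq (i : Fin n) (v : 𝓕.H (i + 1) x) : 𝓕.clsN x i v = 𝓕.cls x i v := by
  rw [clsN, dif_pos ⟨i.2, v.2⟩]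

lemma clsN_of_le {i : ℕ} (h : n ≤ i) (v : TangentSpace 𝓘(ℝ, E) x) : 𝓕.clsN x i v = 0 := by
  rw [clsN, dif_neg]
  rintro ⟨h1, -⟩
  omega

lemma clsN_add {i : ℕ} {v w : TangentSpace 𝓘(ℝ, E) x} (hv : v ∈ 𝓕.H (i + 1) x) (hw : w ∈ 𝓕.H (i + 1) x) :
    𝓕.clsN x i (v + w) = 𝓕.clsN x i v + 𝓕.clsN x i w := by
  by_cases h : i < n
  · have h1 := 𝓕.clsN_eq x ⟨i, h⟩ (⟨v, hv⟩ + ⟨w, hw⟩)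
    rw [map_add, ← clsN_eq, ← clsN_eq] at h1
    exact h1
  · rw [clsN_of_le _ _ (not_lt.1 h), clsN_of_le _ _ (not_lt.1 h), clsN_of_le _ _ (not_lt.1 h), add_zero]

lemma clsN_neg {i : ℕ} {v : TangentSpace 𝓘(ℝ, E) x} (hv : v ∈ 𝓕.H (i + 1) x) :
    𝓕.clsN x i (-v) = -𝓕.clsN x i v := by
  by_cases h : i < n
  · have h1 := 𝓕.clsN_eq x ⟨i, h⟩ (-⟨v, hv⟩)
    rw [map_neg, ← clsN_eq] at h1
    exact h1
  · rw [clsN_of_le _ _ (not_lt.1 h), clsN_of_le _ _ (not_lt.1 h), neg_zero]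

/-- With classes extended by zero beyond degree `n` the bracket formula needs no case distinction,
so iterated brackets can be computed freely. -/
lemma osculatingBracket_clsN [FiniteDimensional ℝ E] {i j : ℕ} {X Y : Π y : M, TangentSpace 𝓘(ℝ, E) y} (hX : 𝓕.IsSection (i + 1) x X)
    (hY : 𝓕.IsSection (j + 1) x Y) :
    𝓕.osculatingBracket x (𝓕.clsN x i (X x)) (𝓕.clsN x j (Y x)) =
      𝓕.clsN x (i + j + 1) (VectorField.mlieBracket 𝓘(ℝ, E) X Y x) := by
  by_cases hi : i < n
  swap
  · rw [𝓕.clsN_of_le x (not_lt.1 hi), 𝓕.clsN_of_le x (by omega : n ≤ i + j + 1), map_zero, LinearMap.zero_apply]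
  by_cases hj : j < n
  swap
  · rw [𝓕.clsN_of_le x (not_lt.1 hj), 𝓕.clsN_of_le x (by omega : n ≤ i + j + 1), map_zero]
  have h1 := 𝓕.osculatingBracket_spec x ⟨i, hi⟩ ⟨j, hj⟩ X Y hX hY
  have e1 := 𝓕.clsN_eq x ⟨i, hi⟩ ⟨X x, hX.mem⟩
  have e2 := 𝓕.clsN_eq x ⟨j, hj⟩ ⟨Y x, hY.mem⟩
  rw [← e1, ← e2] at h1
  refine h1.trans ?_
  by_cases h : i + j + 1 < n
  · rw [dif_pos h, ← clsN_eq]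
  · rw [dif_neg h, clsN_of_le _ _ (not_lt.1 h)]

lemma degree_clsN (i : ℕ) (v : TangentSpace 𝓘(ℝ, E) x) :
    𝓕.degree x (𝓕.clsN x i v) = ((i : ℝ) + 1) • 𝓕.clsN x i v := by
  by_cases h : ∃ _ : i < n, v ∈ 𝓕.H (i + 1) x
  · rw [clsN, dif_pos h]
    refine funext fun j => ?_
    change ((j : ℝ) + 1) • (Pi.single (M := fun i : Fin n => 𝓕.GrPart x i) (⟨i, h.1⟩ : Fin n) _ : Π i : Fin n, 𝓕.GrPart x i) j =
      ((i : ℝ) + 1) • (Pi.single (M := fun i : Fin n => 𝓕.GrPart x i) (⟨i, h.1⟩ : Fin n) _ : Π i : Fin n, 𝓕.GrPart x i) j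
    by_cases hj : j = ⟨i, h.1⟩
    · subst hj; rfl
    · rw [Pi.single_eq_of_ne hj, smul_zero, smul_zero]
  · rw [clsN, dif_neg h, map_zero, smul_zero]

/-- Linear maps on `gr(H)_x` are determined by their values on classes of vector fields. -/
lemma gr_ext [FiniteDimensional ℝ E] {W : Type*} [AddCommGroup W] [Module ℝ W] {f g : 𝓕.Gr x →ₗ[ℝ] W}
    (h : ∀ (i : ℕ) (X : Π y : M, TangentSpace 𝓘(ℝ, E) y), 𝓕.IsSection (i + 1) x X →
      f (𝓕.clsN x i (X x)) = g (𝓕.clsN x i (X x))) : f = g := by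
  refine LinearMap.pi_ext' (φ := fun i : Fin n => 𝓕.GrPart x i) fun i => Submodule.linearMap_qext _ ?_
  ext v
  obtain ⟨ext, hext⟩ := 𝓕.exists_ext (i + 1) x
  have h1 := h i (ext v) (hext v).1
  rw [(hext v).2, clsN_eq] at h1
  exact h1

/-- The filtration of `gr(H)_x` by degree. -/
def degreeFiltration (i : ℕ) : Submodule ℝ (𝓕.Gr x) where
  carrier := {v | ∀ j : Fin n, (j : ℕ) + 1 < i → (v : Π i : Fin n, 𝓕.GrPart x i) j = 0}
  add_mem' := fun {v w} hv hw j hj => by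
    have := congrArg₂ (· + ·) (hv j hj) (hw j hj)
    simpa using! this
  zero_mem' := fun _ _ => rfl
  smul_mem' := fun c v hv j hj => by
    exact (congrArg (c • ·) (hv j hj)).trans (smul_zero c)

lemma clsN_mem_degreeFiltration {i k : ℕ} (h : k ≤ i + 1) (v : TangentSpace 𝓘(ℝ, E) x) :
    𝓕.clsN x i v ∈ 𝓕.degreeFiltration x k := by
  by_cases hi : ∃ _ : i < n, v ∈ 𝓕.H (i + 1) x
  · rw [clsN, dif_pos hi]
    intro j hj
    exact Pi.single_eq_of_ne (M := fun i : Fin n => 𝓕.GrPart x i) (i := ⟨i, hi.1⟩) (i' := j)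
      (by rintro rfl; simp at hj; omega) _
  · rw [clsN, dif_neg hi]; exact Submodule.zero_mem _

/-- The second clause picks the zero representative of a zero component, so that membership in a
filtration step survives the passage to representatives. -/
lemma exists_eq_sum_cls (v : 𝓕.Gr x) : ∃ w : Π i : Fin n, 𝓕.H (i + 1) x, v = ∑ i, 𝓕.cls x i (w i) ∧
    ∀ i, (v : Π i : Fin n, 𝓕.GrPart x i) i = 0 → w i = 0 := by
  have h1 : ∀ i : Fin n, ∃ w : 𝓕.H (i + 1) x, (Submodule.Quotient.mk w : 𝓕.GrPart x i) =
      (v : Π i : Fin n, 𝓕.GrPart x i) i ∧ ((v : Π i : Fin n, 𝓕.GrPart x i) i = 0 → w = 0) := by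
    intro i
    by_cases h0 : (v : Π i : Fin n, 𝓕.GrPart x i) i = 0
    · exact ⟨0, by rw [h0]; rfl, fun _ => rfl⟩
    · obtain ⟨w, hw⟩ := Submodule.Quotient.mk_surjective _ ((v : Π i : Fin n, 𝓕.GrPart x i) i)
      exact ⟨w, hw, fun h => (h0 h).elim⟩
  choose w hw1 hw2 using h1
  refine ⟨w, ?_, hw2⟩
  have h2 : (v : Π i : Fin n, 𝓕.GrPart x i) =
      ∑ i, Pi.single (M := fun i : Fin n => 𝓕.GrPart x i) i ((v : Π i : Fin n, 𝓕.GrPart x i) i) :=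
    (Finset.univ_sum_single (M := fun i : Fin n => 𝓕.GrPart x i) v).symm
  refine h2.trans (Finset.sum_congr rfl fun i _ => ?_)
  rw [← hw1]; rfl

/-- The identities are multilinear, so by `gr_ext` they need checking only on classes of sections,
where they are identities of brackets of vector fields. The index `j : Fin n` has degree `j + 1`, so
the filtration dies at `n + 1`. -/
lemma isFiltered_osculatingBracket [FiniteDimensional ℝ E] :
    GradedLie.IsFiltered (𝓕.osculatingBracket x) (𝓕.degree x) (𝓕.degreeFiltration x) (n + 1) where
  anti i j hij v hv k hk := hv k (hk.trans_le hij)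
  one := top_le_iff.1 fun v _ j hj => by omega
  bot := by
    rw [eq_bot_iff]
    intro v hv
    exact (Submodule.mem_bot ℝ).2 (funext fun j => hv j (by omega))
  bracket_mem {i j v w} hv hw := by
    obtain ⟨v', rfl, hv0⟩ := 𝓕.exists_eq_sum_cls x v
    obtain ⟨w', rfl, hw0⟩ := 𝓕.exists_eq_sum_cls x w
    rw [map_sum (𝓕.osculatingBracket x), LinearMap.sum_apply]
    refine Submodule.sum_mem _ fun a _ => ?_
    rw [map_sum]
    refine Submodule.sum_mem _ fun c _ => ?_
    by_cases ha : (a : ℕ) + 1 < i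
    · rw [hv0 a (hv a ha), map_zero, map_zero, LinearMap.zero_apply]; exact Submodule.zero_mem _
    by_cases hc : (c : ℕ) + 1 < j
    · rw [hw0 c (hw c hc), map_zero, map_zero]; exact Submodule.zero_mem _
    obtain ⟨e1, he1⟩ := 𝓕.exists_ext (a + 1) x
    obtain ⟨e2, he2⟩ := 𝓕.exists_ext (c + 1) x
    have := 𝓕.osculatingBracket_clsN x (he1 (v' a)).1 (he2 (w' c)).1
    rw [(he1 _).2, (he2 _).2, clsN_eq, clsN_eq] at this
    rw [this]
    exact 𝓕.clsN_mem_degreeFiltration x (by omega) _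
  degree_mem {i v} hv j hj := by
    change ((j : ℝ) + 1) • (v : Π i : Fin n, 𝓕.GrPart x i) j - (i : ℝ) • (v : Π i : Fin n, 𝓕.GrPart x i) j = 0
    rcases Nat.lt_or_ge (j + 1) i with h | h
    · rw [hv j h, smul_zero, smul_zero, sub_zero]
    · have : i = (j : ℕ) + 1 := by omega
      rw [this]; push_cast; exact sub_self _
  skew v w := by
    have h : 𝓕.osculatingBracket x = -(𝓕.osculatingBracket x).flip := by
      refine 𝓕.gr_ext x fun i X hX => 𝓕.gr_ext x fun j Y hY => ?_
      rw [LinearMap.neg_apply, LinearMap.neg_apply, LinearMap.flip_apply, osculatingBracket_clsN _ _ hX hY,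
        osculatingBracket_clsN _ _ hY hX, ← clsN_neg, ← VectorField.mlieBracket_swap_apply, add_comm j i]
      have := (hY.bracket hX).mem
      rwa [show j + 1 + (i + 1) = j + i + 1 + 1 by omega] at this
    exact congrArg (fun l => l v w) h
  jacobi u v w := by
    have : CompleteSpace E := FiniteDimensional.complete ℝ E
    have hM : IsManifold 𝓘(ℝ, E) (minSmoothness ℝ 3) M := by
      rw [minSmoothness_of_isRCLikeNormedField]
      exact IsManifold.of_le (n := ∞) (WithTop.coe_le_coe.2 (le_top : ((3 : ℕ) : ℕ∞) ≤ ⊤))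
    set B := 𝓕.osculatingBracket x with hB
    -- `f` is `(u, v, w) ↦ B u (B v w)`, and `g` is the other side of the Jacobi identity.
    let f : 𝓕.Gr x →ₗ[ℝ] 𝓕.Gr x →ₗ[ℝ] 𝓕.Gr x →ₗ[ℝ] 𝓕.Gr x :=
      (LinearMap.llcomp ℝ (𝓕.Gr x) (𝓕.Gr x) (𝓕.Gr x)).flip.flip.compl₁₂ B B
    let g : 𝓕.Gr x →ₗ[ℝ] 𝓕.Gr x →ₗ[ℝ] 𝓕.Gr x →ₗ[ℝ] 𝓕.Gr x := B.compr₂ B + f.flip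
    have h : f = g := by
      refine 𝓕.gr_ext x fun i X hX => 𝓕.gr_ext x fun j Y hY => 𝓕.gr_ext x fun k Z hZ => ?_
      change B (𝓕.clsN x i (X x)) (B (𝓕.clsN x j (Y x)) (𝓕.clsN x k (Z x))) =
        B (B (𝓕.clsN x i (X x)) (𝓕.clsN x j (Y x))) (𝓕.clsN x k (Z x)) +
          B (𝓕.clsN x j (Y x)) (B (𝓕.clsN x i (X x)) (𝓕.clsN x k (Z x)))
      have hb : ∀ {i j : ℕ} {X Y : Π y : M, TangentSpace 𝓘(ℝ, E) y}, 𝓕.IsSection (i + 1) x X →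
          𝓕.IsSection (j + 1) x Y →
          𝓕.IsSection (i + j + 1 + 1) x (VectorField.mlieBracket 𝓘(ℝ, E) X Y) := fun {i j X Y} hX hY => by
        have := hX.bracket hY
        rwa [show i + 1 + (j + 1) = i + j + 1 + 1 by omega] at this
      have hYZ := hb hY hZ
      have hXY := hb hX hY
      have hXZ := hb hX hZ
      rw [osculatingBracket_clsN _ _ hY hZ, osculatingBracket_clsN _ _ hX hY, osculatingBracket_clsN _ _ hX hZ,
        osculatingBracket_clsN _ _ hX hYZ, osculatingBracket_clsN _ _ hXY hZ, osculatingBracket_clsN _ _ hY hXZ]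
      have hsm : ∀ {X : Π y : M, TangentSpace 𝓘(ℝ, E) y}, SmoothVF X x →
          ContMDiffAt 𝓘(ℝ, E) 𝓘(ℝ, E).tangent (minSmoothness ℝ 2)
            (fun z => (⟨z, X z⟩ : TangentBundle 𝓘(ℝ, E) M)) x := fun h => by
        rw [minSmoothness_of_isRCLikeNormedField]
        exact h.self_of_nhds.of_le (WithTop.coe_le_coe.2 (le_top : ((2 : ℕ) : ℕ∞) ≤ ⊤))
      rw [VectorField.leibniz_identity_mlieBracket_apply (hsm hX.1) (hsm hY.1) (hsm hZ.1)]
      have e1 : i + j + 1 + k + 1 = i + (j + k + 1) + 1 := by omega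
      have e2 : j + (i + k + 1) + 1 = i + (j + k + 1) + 1 := by omega
      have m1 := (hb hXY hZ).mem
      have m2 := (hb hY hXZ).mem
      rw [e1] at m1
      rw [e2] at m2
      rw [e1, e2, clsN_add _ _ m1 m2]
    exact congrArg (fun l => l u v w) h
  der v w := by
    set B := 𝓕.osculatingBracket x with hB
    have h : B.compr₂ (𝓕.degree x) = B.comp (𝓕.degree x) + B.compl₂ (𝓕.degree x) := by
      refine 𝓕.gr_ext x fun i X hX => 𝓕.gr_ext x fun j Y hY => ?_
      change 𝓕.degree x (B (𝓕.clsN x i (X x)) (𝓕.clsN x j (Y x))) =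
        B (𝓕.degree x (𝓕.clsN x i (X x))) (𝓕.clsN x j (Y x)) +
          B (𝓕.clsN x i (X x)) (𝓕.degree x (𝓕.clsN x j (Y x)))
      rw [degree_clsN, degree_clsN, map_smul, map_smul, LinearMap.smul_apply, osculatingBracket_clsN _ _ hX hY,
        degree_clsN]
      push_cast
      module
    exact congrArg (fun l => l v w) h

lemma isExpGroup_grMul [FiniteDimensional ℝ E] : GradedLie.IsExpGroup (𝓕.grMul x) :=
  (𝓕.isFiltered_osculatingBracket x).isExpGroup_mul

end Filtration
end Osculating
end

noncomputable section

/-! ### Local sections of the bundle of exterior forms -/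

section FormPullback

lemma formPullback_comp {U V W : Type*} [AddCommGroup U] [Module ℝ U] [AddCommGroup V] [Module ℝ V]
    [AddCommGroup W] [Module ℝ W] (A : U →ₗ[ℝ] V) (B : V →ₗ[ℝ] W) (θ : ExteriorAlgebra ℂ (W →ₗ[ℝ] ℂ)) :
    formPullback A (formPullback B θ) = formPullback (B ∘ₗ A) θ := by
  have := ExteriorAlgebra.map_comp_map (R := ℂ) (LinearMap.lcomp ℂ ℂ B) (LinearMap.lcomp ℂ ℂ A)
  exact congrArg (fun l => l θ) this

lemma formPullback_id {V : Type*} [AddCommGroup V] [Module ℝ V] (θ : ExteriorAlgebra ℂ (V →ₗ[ℝ] ℂ)) :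
    formPullback LinearMap.id θ = θ := by
  have := ExteriorAlgebra.map_id (R := ℂ) (M := V →ₗ[ℝ] ℂ)
  exact congrArg (fun l => l θ) this

variable {E : Type*} [NormedAddCommGroup E] [NormedSpace ℝ E] [FiniteDimensional ℝ E]

/-- The coefficients of the pullback of a form along `A` are polynomials in `A`. -/
lemma contDiff_formPullback (θ : ExteriorAlgebra ℂ (E →ₗ[ℝ] ℂ)) (l : ExteriorAlgebra ℂ (E →ₗ[ℝ] ℂ) →ₗ[ℂ] ℂ) :
    ContDiff ℝ ∞ fun A : E →L[ℝ] E => l (formPullback A.toLinearMap θ) := by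
  induction θ using ExteriorAlgebra.induction generalizing l with
  | algebraMap r => simpa using! contDiff_const
  | ι m =>
    let T : (E →L[ℝ] E) →ₗ[ℝ] ℂ :=
      { toFun := fun A => l (formPullback A.toLinearMap (ExteriorAlgebra.ι ℂ m))
        map_add' := fun A B => by
          simp only [formPullback, ExteriorAlgebra.map_apply_ι]
          rw [← map_add l, ← map_add]
          congr 2
          ext v; simp
        map_smul' := fun c A => by
          simp only [formPullback, ExteriorAlgebra.map_apply_ι]
          have : (LinearMap.lcomp ℂ ℂ (c • A : E →L[ℝ] E).toLinearMap) m =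
              (c : ℂ) • (LinearMap.lcomp ℂ ℂ A.toLinearMap) m := by
            ext v; simp
          rw [this, map_smul, map_smul]; simp }
    exact (LinearMap.toContinuousLinearMap T).contDiff
  | mul a b ha hb =>
    set β := formBasis (Module.finBasis ℝ E) with hβ
    have h1 : ∀ A : E →L[ℝ] E, l (formPullback A.toLinearMap (a * b)) =
        ∑ S, ∑ T, β.coord S (formPullback A.toLinearMap a) * β.coord T (formPullback A.toLinearMap b) *
          l (β S * β T) := by
      intro A
      rw [map_mul]
      conv_lhs => rw [← β.sum_repr (formPullback A.toLinearMap a), ← β.sum_repr (formPullback A.toLinearMap b)]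
      rw [Finset.sum_mul_sum, map_sum]
      refine Finset.sum_congr rfl fun S _ => ?_
      rw [map_sum]
      refine Finset.sum_congr rfl fun T _ => ?_
      rw [smul_mul_smul_comm, map_smul]; rfl
    simp_rw [h1]
    exact ContDiff.sum fun S _ => ContDiff.sum fun T _ => ((ha _).mul (hb _)).mul contDiff_const
  | add a b ha hb =>
    simp only [map_add]
    exact (ha l).add (hb l)

end FormPullback

section LocalForm
variable {E : Type*} [NormedAddCommGroup E] [NormedSpace ℝ E]
  {M : Type*} [TopologicalSpace M] [ChartedSpace E M]

lemma contMDiffAt_mul_complex {f g : M → ℂ} {x : M} (hf : ContMDiffAt 𝓘(ℝ, E) 𝓘(ℝ, ℂ) ∞ f x)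
    (hg : ContMDiffAt 𝓘(ℝ, E) 𝓘(ℝ, ℂ) ∞ g x) : ContMDiffAt 𝓘(ℝ, E) 𝓘(ℝ, ℂ) ∞ (fun y => f y * g y) x :=
  (contDiff_mul (𝕜 := ℝ) (𝔸 := ℂ) (n := ∞)).contMDiff.contMDiffAt.comp x (hf.prodMk_space hg)

variable [IsManifold 𝓘(ℝ, E) ∞ M]

/-- The section of `Λ^*(M)` which is constant in the trivialisation at `x`, cut off by `χ`. -/
def localForm (x : M) (χ : M → ℝ) (θ : ExteriorAlgebra ℂ (E →ₗ[ℝ] ℂ)) (y : M) : FormAt E y :=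
  (χ y : ℂ) • formPullback
    ((trivializationAt E (TangentSpace 𝓘(ℝ, E) : M → Type _) x).continuousLinearMapAt ℝ y).toLinearMap θ

lemma SmoothForm.mul {s : Π y : M, FormAt E y} (hs : SmoothForm s) {f : M → ℂ}
    (hf : ContMDiff 𝓘(ℝ, E) 𝓘(ℝ, ℂ) ∞ f) : SmoothForm fun y => f y • s y := by
  intro y₀ l
  have h1 := contMDiffAt_mul_complex (hf y₀) (hs y₀ l)
  refine h1.congr_of_eventuallyEq (Filter.Eventually.of_forall fun y => ?_)
  simp only [map_smul, smul_eq_mul]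

variable [FiniteDimensional ℝ E]

/-- On the support of `χ` the coefficients in another trivialisation are polynomials in the smooth
coordinate change; off it the form vanishes locally. -/
lemma smoothForm_localForm {x : M} {χ : M → ℝ} (hχ : ContMDiff 𝓘(ℝ, E) 𝓘(ℝ, ℝ) ∞ χ)
    (hsupp : tsupport χ ⊆ (trivializationAt E (TangentSpace 𝓘(ℝ, E) : M → Type _) x).baseSet)
    (θ : ExteriorAlgebra ℂ (E →ₗ[ℝ] ℂ)) : SmoothForm (localForm x χ θ) := by
  intro y₀ l
  set e := trivializationAt E (TangentSpace 𝓘(ℝ, E) : M → Type _) x with he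
  set e' := trivializationAt E (TangentSpace 𝓘(ℝ, E) : M → Type _) y₀ with he'
  have hy₀ : y₀ ∈ e'.baseSet := FiberBundle.mem_baseSet_trivializationAt' y₀
  by_cases hy : y₀ ∈ tsupport χ
  · have h1 := contMDiffAt_coordChangeL (n := ∞) (IB := 𝓘(ℝ, E)) (e := e') (e' := e) hy₀ (hsupp hy)
    have h2 := (contDiff_formPullback θ l).contMDiff.contMDiffAt.comp y₀ h1
    have h3 : ContMDiffAt 𝓘(ℝ, E) 𝓘(ℝ, ℂ) ∞ (fun y => (χ y : ℂ)) y₀ :=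
      Complex.ofRealCLM.contDiff.contMDiff.contMDiffAt.comp y₀ (hχ y₀)
    refine (contMDiffAt_mul_complex h3 h2).congr_of_eventuallyEq ?_
    filter_upwards [e'.open_baseSet.mem_nhds hy₀, e.open_baseSet.mem_nhds (hsupp hy)] with y hy1 hy2
    rw [localForm, map_smul, map_smul, formPullback_comp, smul_eq_mul]
    congr 3
    refine congrArg formPullback (LinearMap.ext fun v => ?_)
    change e.continuousLinearMapAt ℝ y (e'.symmL ℝ y v) = e'.coordChangeL ℝ e y v
    rw [Bundle.Trivialization.coordChangeL_apply _ _ ⟨hy1, hy2⟩,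
      Bundle.Trivialization.continuousLinearMapAt_apply, Bundle.Trivialization.coe_linearMapAt_of_mem _ hy2,
      Bundle.Trivialization.symmL_apply _ hy1]
  · have h1 : (fun y => l (formPullback (e'.symmL ℝ y : E →ₗ[ℝ] _) (localForm x χ θ y))) =ᶠ[𝓝 y₀] fun _ => 0 := by
      filter_upwards [(isClosed_tsupport χ).isOpen_compl.mem_nhds hy] with y hy1
      rw [localForm, image_eq_zero_of_notMem_tsupport hy1]
      simp
    exact contMDiffAt_const.congr_of_eventuallyEq h1

/-- Connections and operators act on global smooth forms, so a form at `x` must be prolonged to one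
before they can be tested on it. -/
lemma exists_localForm [T2Space M] (x : M) (θ : FormAt E x) : ∃ (χ : M → ℝ) (θ' : ExteriorAlgebra ℂ (E →ₗ[ℝ] ℂ)),
    ContMDiff 𝓘(ℝ, E) 𝓘(ℝ, ℝ) ∞ χ ∧
    tsupport χ ⊆ (trivializationAt E (TangentSpace 𝓘(ℝ, E) : M → Type _) x).baseSet ∧
    localForm x χ θ' x = θ := by
  let f : SmoothBumpFunction 𝓘(ℝ, E) x := Classical.arbitrary _
  set e := trivializationAt E (TangentSpace 𝓘(ℝ, E) : M → Type _) x with he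
  have hx : x ∈ e.baseSet := FiberBundle.mem_baseSet_trivializationAt' x
  refine ⟨f, formPullback (e.symmL ℝ x).toLinearMap θ, f.contMDiff, f.tsupport_subset_chartAt_source, ?_⟩
  rw [localForm, formPullback_comp, f.eq_one]
  have : (e.symmL ℝ x).toLinearMap ∘ₗ (e.continuousLinearMapAt ℝ x).toLinearMap = LinearMap.id :=
    LinearMap.ext fun v => e.symmL_continuousLinearMapAt hx v
  rw [this, formPullback_id]
  simp

/-- A smooth function vanishing at `x` with prescribed derivative. -/
lemma exists_smooth_function [T2Space M] (x : M) (ξ : TangentSpace 𝓘(ℝ, E) x →ₗ[ℝ] ℝ) :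
    ∃ f : M → ℂ, ContMDiff 𝓘(ℝ, E) 𝓘(ℝ, ℂ) ∞ f ∧ f x = 0 ∧ ∀ v, dirDeriv f x v = ξ v := by
  let χ : SmoothBumpFunction 𝓘(ℝ, E) x := Classical.arbitrary _
  have hinv := isInvertible_mfderiv_extChartAt (I := 𝓘(ℝ, E)) (mem_extChartAt_source (I := 𝓘(ℝ, E)) x)
  obtain ⟨D, hD⟩ := hinv
  let l : E →L[ℝ] ℂ := LinearMap.toContinuousLinearMap (Complex.ofRealCLM.toLinearMap ∘ₗ ξ ∘ₗ D.symm.toLinearMap)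
  let g : M → ℂ := fun y => l (extChartAt 𝓘(ℝ, E) x y - extChartAt 𝓘(ℝ, E) x x)
  have hg : ContMDiffOn 𝓘(ℝ, E) 𝓘(ℝ, ℂ) ∞ g (chartAt E x).source := by
    intro y hy
    have h1 : ContMDiffAt 𝓘(ℝ, E) 𝓘(ℝ, E) ∞ (extChartAt 𝓘(ℝ, E) x) y := contMDiffAt_extChartAt' hy
    have h2 : ContDiff ℝ ∞ fun u : E => l (u - extChartAt 𝓘(ℝ, E) x x) := l.contDiff.comp (contDiff_id.sub contDiff_const)
    exact (h2.contMDiff.contMDiffAt.comp y h1).contMDiffWithinAt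
  refine ⟨fun y => χ y • g y, χ.contMDiff_smul hg, by simp [g], fun v => ?_⟩
  have h1 : (fun y => χ y • g y) =ᶠ[𝓝 x] g := by
    filter_upwards [χ.eventuallyEq_one] with y hy
    rw [hy]; simp
  rw [dirDeriv, h1.mfderiv_eq]
  have h2 : HasMFDerivAt 𝓘(ℝ, E) 𝓘(ℝ, E) (extChartAt 𝓘(ℝ, E) x) x D.toContinuousLinearMap := by
    have := (mdifferentiableAt_extChartAt (I := 𝓘(ℝ, E)) (ChartedSpace.mem_chart_source (H := E) x)).hasMFDerivAt
    rwa [← hD] at this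
  have h3 : HasFDerivAt (fun u : E => l (u - extChartAt 𝓘(ℝ, E) x x)) l (extChartAt 𝓘(ℝ, E) x x) :=
    l.hasFDerivAt.comp _ ((hasFDerivAt_id _).sub_const _)
  have h4 := h3.hasMFDerivAt.comp x h2
  have h5 : mfderiv 𝓘(ℝ, E) 𝓘(ℝ, ℂ) g x = l.comp D.toContinuousLinearMap := h4.mfderiv
  rw [h5]
  change ((ξ (D.symm (D v)) : ℝ) : ℂ) = ξ v
  rw [D.symm_apply_apply]

end LocalForm
end

noncomputable section

/-! ### The derivative along the orbits of a multiple of a form -/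

/-- The product of a differentiable function vanishing at `p` and a function continuous at `p`. -/
lemma HasFDerivWithinAt.mul_continuousWithinAt {F : Type*} [NormedAddCommGroup F] [NormedSpace ℝ F]
    {u r : F → ℂ} {u' : F →L[ℝ] ℂ} {s : Set F} {p : F} (hu : HasFDerivWithinAt u u' s p) (hp : u p = 0)
    (hr : ContinuousWithinAt r s p) : HasFDerivWithinAt (fun q => u q * r q) (r p • u') s p := by
  rw [hasFDerivWithinAt_iff_isLittleO] at hu ⊢
  have h1 : (fun q => (u q - u p - u' (q - p)) * r q) =o[𝓝[s] p] fun q => q - p := by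
    have := hu.norm_right.mul_isBigO (hr.norm.isBoundedUnder_le.isBigO_one ℝ : r =O[𝓝[s] p] fun _ => (1 : ℝ))
    simp only [mul_one] at this
    exact this.of_norm_right
  have h2 : (fun q => (r q - r p) * u' (q - p)) =o[𝓝[s] p] fun q => q - p := by
    have h3 : (fun q => r q - r p) =o[𝓝[s] p] fun _ => (1 : ℝ) := by
      rw [Asymptotics.isLittleO_one_iff]
      have := hr.tendsto.sub_const (r p)
      rwa [sub_self] at this
    have := h3.mul_isBigO (u'.isBigO_sub (𝓝[s] p) p).norm_right
    simp only [one_mul] at this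
    exact this.of_norm_right
  refine (h1.add h2).congr_left fun q => ?_
  simp only [hp, smul_apply, smul_eq_mul]
  ring

section
variable {E : Type*} [NormedAddCommGroup E] [NormedSpace ℝ E] {M : Type*} [TopologicalSpace M] [ChartedSpace E M]

/-- Since `f` vanishes at the point, `r` need only be continuous; for transported forms this spares
the differentiability in `g` of the action's differential. -/
lemma HasMFDerivAt.mul_continuousAt {f r : M → ℂ} {g : M} {D : TangentSpace 𝓘(ℝ, E) g →L[ℝ] ℂ}
    (hf : HasMFDerivAt 𝓘(ℝ, E) 𝓘(ℝ, ℂ) f g D) (h0 : f g = 0) (hr : ContinuousAt r g) (v : TangentSpace 𝓘(ℝ, E) g) :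
    dirDeriv (E' := E) (fun h => f h * r h) g v = r g * D v := by
  have h1 : HasFDerivWithinAt (f ∘ (extChartAt 𝓘(ℝ, E) g).symm) D (Set.range 𝓘(ℝ, E)) (extChartAt 𝓘(ℝ, E) g g) := hf.2
  have h2 : ContinuousAt (r ∘ (extChartAt 𝓘(ℝ, E) g).symm) (extChartAt 𝓘(ℝ, E) g g) := by
    refine ContinuousAt.comp ?_ (continuousAt_extChartAt_symm g)
    rwa [extChartAt_to_inv]
  have h3 := h1.mul_continuousWithinAt (by simpa using h0) h2.continuousWithinAt
  have h4 : HasMFDerivAt 𝓘(ℝ, E) 𝓘(ℝ, ℂ) (fun h => f h * r h) g (r g • D) := by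
    refine ⟨hf.1.mul hr, ?_⟩
    have h5 : (r ∘ (extChartAt 𝓘(ℝ, E) g).symm) (extChartAt 𝓘(ℝ, E) g g) = r g := by simp
    rw [h5] at h3
    exact h3
  rw [dirDeriv, h4.mfderiv]
  rfl

lemma formPullback_mfderiv_of_eq_id {φ : M → M} (hφ : φ = id) (s : Π y : M, FormAt E y) (x : M) :
    (formPullback (mfderiv 𝓘(ℝ, E) 𝓘(ℝ, E) φ x).toLinearMap (s (φ x)) : FormAt E x) = s x := by
  subst hφ
  rw [mfderiv_id]
  exact formPullback_id _

lemma transport_one {G : Type*} [Group G] [MulAction G M] (s : Π y : M, FormAt E y) (x : M) : LieMetric.transport s x (1 : G) = s x :=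
  formPullback_mfderiv_of_eq_id (funext fun y => one_smul G y) s x

end

section OrbitDeriv
variable {E : Type*} [NormedAddCommGroup E] [NormedSpace ℝ E]
  {M : Type*} [TopologicalSpace M] [ChartedSpace E M] [IsManifold 𝓘(ℝ, E) ∞ M]
  {F : Type*} [NormedAddCommGroup F] [NormedSpace ℝ F]
  {G : Type*} [TopologicalSpace G] [ChartedSpace F G] [Group G] [LieGroup 𝓘(ℝ, F) ∞ G] [MulAction G M]

variable (hsmooth : ContMDiff (𝓘(ℝ, F).prod 𝓘(ℝ, E)) 𝓘(ℝ, E) ∞ (fun p : G × M => p.1 • p.2))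
include hsmooth

lemma continuousAt_mfderiv_smul (x : M) : ContinuousAt (fun g : G =>
    (((trivializationAt E (TangentSpace 𝓘(ℝ, E) : M → Type _) x).continuousLinearMapAt ℝ (g • x)).comp
      (mfderiv 𝓘(ℝ, E) 𝓘(ℝ, E) (fun y : M => g • y) x) : E →L[ℝ] E)) 1 := by
  have h1 := ContMDiffAt.mfderiv (I := 𝓘(ℝ, E)) (I' := 𝓘(ℝ, E)) (J := 𝓘(ℝ, F)) (m := 0) (n := ∞) (x₀ := (1 : G))
    (fun (g : G) (y : M) => g • y) (fun _ => x) (hsmooth (1, x)) contMDiffAt_const (by simp)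
  have h2 := h1.continuousAt
  set e := trivializationAt E (TangentSpace 𝓘(ℝ, E) : M → Type _) x with he
  have hx : x ∈ e.baseSet := FiberBundle.mem_baseSet_trivializationAt' x
  have he1 : trivializationAt E (TangentSpace 𝓘(ℝ, E) : M → Type _) ((1 : G) • x) = e := by rw [one_smul]
  -- `inTangentCoordinates` also trivialises the source at `x`; composing with `c` undoes this.
  obtain ⟨c, hc⟩ : ∃ c : E →L[ℝ] E, c = e.continuousLinearMapAt ℝ x := ⟨_, rfl⟩
  have h3 : ContinuousAt (fun g : G => (inTangentCoordinates 𝓘(ℝ, E) 𝓘(ℝ, E) (fun _ => x) (fun g : G => g • x)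
      (fun g => mfderiv 𝓘(ℝ, E) 𝓘(ℝ, E) (fun y : M => g • y) x) 1 g).comp c) 1 :=
    h2.clm_comp continuousAt_const
  refine h3.congr (Filter.Eventually.of_forall fun g => ?_)
  refine ContinuousLinearMap.ext fun v => ?_
  simp only [inTangentCoordinates, ContinuousLinearMap.inCoordinates, he1, hc]
  exact congrArg (fun w : TangentSpace 𝓘(ℝ, E) x => e.continuousLinearMapAt ℝ (g • x)
    (mfderiv 𝓘(ℝ, E) 𝓘(ℝ, E) (fun y : M => g • y) x w)) (e.symmL_continuousLinearMapAt hx v)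

variable [FiniteDimensional ℝ E]

lemma continuousAt_transport_localForm (x : M) {χ : M → ℝ} (hχ : Continuous χ)
    (θ : ExteriorAlgebra ℂ (E →ₗ[ℝ] ℂ)) (l : FormAt E x →ₗ[ℂ] ℂ) :
    ContinuousAt (fun g : G => l (LieMetric.transport (localForm x χ θ) x g)) 1 := by
  have h1 := (contDiff_formPullback θ l).continuous.continuousAt.comp (continuousAt_mfderiv_smul hsmooth x)
  have hc : ContinuousAt (fun g : G => (χ (g • x) : ℂ)) 1 := by
    have h2 : Continuous fun g : G => g • x := hsmooth.continuous.comp (by fun_prop : Continuous fun g : G => (g, x))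
    exact (Complex.continuous_ofReal.comp (hχ.comp h2)).continuousAt
  refine (hc.mul h1).congr (Filter.Eventually.of_forall fun g => ?_)
  have h3 : LieMetric.transport (localForm x χ θ) x g = (χ (g • x) : ℂ) • formPullback
      (((trivializationAt E (TangentSpace 𝓘(ℝ, E) : M → Type _) x).continuousLinearMapAt ℝ (g • x)).toLinearMap ∘ₗ
        (mfderiv 𝓘(ℝ, E) 𝓘(ℝ, E) (fun y : M => g • y) x).toLinearMap) θ := by
    change formPullback _ ((χ (g • x) : ℂ) • formPullback _ θ) = _
    rw [map_smul, formPullback_comp]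
  refine Eq.trans ?_ (congrArg l h3).symm
  rw [map_smul]
  rfl

/-- The product rule at a zero of `f`: only the derivative of `f` along the orbit survives, that is
the principal symbol. -/
lemma orbitDeriv_smul_localForm [FiniteDimensional ℝ F] (γ : LieMetric E M F G) (x : M) {χ : M → ℝ} (hχ : Continuous χ)
    (θ : ExteriorAlgebra ℂ (E →ₗ[ℝ] ℂ)) {f : M → ℂ} (hf : ContMDiff 𝓘(ℝ, E) 𝓘(ℝ, ℂ) ∞ f) (h0 : f x = 0)
    (v : γ.Fiber x) : γ.orbitDeriv x (fun y => f y • localForm x χ θ y) v =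
      dirDeriv f x (γ.orbitDiff x v) • localForm x χ θ x := by
  set β := formBasis (Module.finBasis ℝ (TangentSpace 𝓘(ℝ, E) x)) with hβ
  have horb : MDifferentiableAt 𝓘(ℝ, F) 𝓘(ℝ, E) (fun g : G => g • x) 1 := by
    have h2 : ContMDiff 𝓘(ℝ, F) 𝓘(ℝ, E) ∞ fun g : G => g • x :=
      hsmooth.comp (contMDiff_id.prodMk contMDiff_const)
    exact h2.mdifferentiableAt (by simp)
  -- Stated for `y = x` because the chain rule needs the base point `1 • x`, which equals `x` only
  -- propositionally.
  have hfx : ∀ y : M, y = x → HasMFDerivAt 𝓘(ℝ, E) 𝓘(ℝ, ℂ) f y (mfderiv 𝓘(ℝ, E) 𝓘(ℝ, ℂ) f x : E →L[ℝ] ℂ) := by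
    rintro _ rfl
    exact (hf.mdifferentiableAt (by simp)).hasMFDerivAt
  have hF := (hfx _ (one_smul G x)).comp (1 : G) horb.hasMFDerivAt
  have h1 : ∀ S, dirDeriv (E' := F) (fun g : G =>
      β.repr (LieMetric.transport (fun y => f y • localForm x χ θ y) x g) S) 1 v =
      β.repr (localForm x χ θ x) S * dirDeriv f x (γ.orbitDiff x v) := by
    intro S
    have h2 := HasMFDerivAt.mul_continuousAt (r := fun g : G => β.coord S (LieMetric.transport (localForm x χ θ) x g))
      hF (by simp [h0]) (continuousAt_transport_localForm hsmooth x hχ θ (β.coord S)) v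
    rw [transport_one] at h2
    refine Eq.trans ?_ h2
    congr 1
    ext g
    have h3 : LieMetric.transport (fun y => f y • localForm x χ θ y) x g =
        f (g • x) • LieMetric.transport (localForm x χ θ) x g :=
      map_smul (formPullback (mfderiv 𝓘(ℝ, E) 𝓘(ℝ, E) (fun y : M => g • y) x).toLinearMap) _ _
    rw [h3, map_smul]
    rfl
  refine (Finset.sum_congr rfl fun S _ => congrArg (fun c : ℂ => c • β S) (h1 S)).trans ?_
  conv_rhs => rw [← β.sum_repr (localForm x χ θ x), Finset.smul_sum]
  refine Finset.sum_congr rfl fun S _ => ?_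
  rw [smul_smul, mul_comm]

end OrbitDeriv
end

noncomputable section

/-! ### The H-cosymbol of the orbital Dirac operator -/

section Cosymbol
variable {E : Type*} [NormedAddCommGroup E] [NormedSpace ℝ E] [FiniteDimensional ℝ E]
  {M : Type*} [TopologicalSpace M] [T2Space M] [ChartedSpace E M] [IsManifold 𝓘(ℝ, E) ∞ M]
  [Bundle.RiemannianBundle (fun x : M => TangentSpace 𝓘(ℝ, E) x)]
  {F : Type*} [NormedAddCommGroup F] [NormedSpace ℝ F] [FiniteDimensional ℝ F]
  {G : Type*} [TopologicalSpace G] [ChartedSpace F G] [Group G] [LieGroup 𝓘(ℝ, F) ∞ G] [MulAction G M]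

/-- The unit vectors `(f'_x f'_x^*)^{-1/2} f'_x v_k` tangent to the orbit. -/
def LieMetric.orbitFrame (γ : LieMetric E M F G) (x : M) (k : Fin (Module.finrank ℝ (γ.Fiber x))) :
    TangentSpace 𝓘(ℝ, E) x :=
  ‖γ.orbitDiff x (γ.singularBasis x k)‖⁻¹ • γ.orbitDiff x (γ.singularBasis x k)

/-- If `D_G = ∑ Φ_j ∇_{X_j} + Ψ` at `x`, then `∑ ξ(X_j) Φ_j` is the principal symbol of `D_G` at the covector `ξ`. -/
lemma sum_smul_eq_of_orbitalDirac (hsmooth : ContMDiff (𝓘(ℝ, F).prod 𝓘(ℝ, E)) 𝓘(ℝ, E) ∞ (fun p : G × M => p.1 • p.2))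
    (γ : LieMetric E M F G) (x : M) (C : FormConnection E M) {m : ℕ} (X : Fin m → TangentSpace 𝓘(ℝ, E) x)
    (Φ : Fin m → Module.End ℂ (FormAt E x)) (Ψ : Module.End ℂ (FormAt E x))
    (hP : ∀ s : Π y : M, FormAt E y, SmoothForm s →
      γ.orbitalDirac s x = ∑ j, Φ j (C.nabla x (X j) s) + Ψ (s x)) (ξ : TangentSpace 𝓘(ℝ, E) x →ₗ[ℝ] ℝ) :
    ∑ j, (ξ (X j) : ℂ) • Φ j = (-Complex.I) • ∑ k, (ξ (γ.orbitDiff x (γ.singularBasis x k)) : ℂ) •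
      (cliff (γ.orbitFrame x k) : Module.End ℂ (FormAt E x)) := by
  -- Test on `f` times a prolongation of `θ`, where `f` vanishes at `x` with differential `ξ`; the
  -- terms of order zero disappear on both sides.
  refine LinearMap.ext fun θ => ?_
  obtain ⟨χ, θ', hχ, hsupp, hθ⟩ := exists_localForm x θ
  obtain ⟨f, hf, h0, hd⟩ := exists_smooth_function x ξ
  have hs := smoothForm_localForm hχ hsupp θ'
  have h1 := hP _ (hs.mul hf)
  have h2 : ∀ j, C.nabla x (X j) (fun y => f y • localForm x χ θ' y) = (ξ (X j) : ℂ) • θ := by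
    intro j
    rw [C.leibniz x (X j) f _ hf hs, h0, hd, hθ]
    exact (congrArg (_ + ·) (zero_smul ℂ _)).trans (add_zero _)
  have h3 : ∀ k, γ.orbitDeriv x (fun y => f y • localForm x χ θ' y) (γ.singularBasis x k) =
      (ξ (γ.orbitDiff x (γ.singularBasis x k)) : ℂ) • θ := by
    intro k
    rw [orbitDeriv_smul_localForm hsmooth γ x hχ.continuous θ' hf h0, hd, hθ]
  rw [LieMetric.orbitalDirac] at h1
  simp only [h2, h3, h0, zero_smul, map_zero, add_zero, map_smul] at h1
  simp only [LinearMap.sum_apply, LinearMap.smul_apply]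
  exact h1.symm

namespace Filtration
variable {n : ℕ} (𝓕 : Filtration E M n)

/-- The coefficients of the H-cosymbol of the orbital Dirac operator are skew-Hermitian. -/
lemma exists_toMatrixSymbol_eq
    (hsmooth : ContMDiff (𝓘(ℝ, F).prod 𝓘(ℝ, E)) 𝓘(ℝ, E) ∞ (fun p : G × M => p.1 • p.2))
    (γ : LieMetric E M F G) (x : M) (k : Fin n) (σ : 𝓕.Gr x ⊗[ℝ] Module.End ℂ (FormAt E x))
    (hσ : 𝓕.HasHCosymbol γ.orbitalDirac x k σ)
    {d : ℕ} (b : OrthonormalBasis (Fin d) ℝ (TangentSpace 𝓘(ℝ, E) x)) :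
    ∃ (X : Fin d → 𝓕.Gr x) (A : Fin d → Matrix (Finset (Fin d)) (Finset (Fin d)) ℂ),
      (∀ a, (A a).conjTranspose = -A a) ∧ 𝓕.toMatrixSymbol x b σ = ∑ a, X a ⊗ₜ[ℝ] A a := by
  obtain ⟨C, m, X, hX, Φ, Ψ, hP, rfl⟩ := hσ
  have hsym := sum_smul_eq_of_orbitalDirac hsmooth γ x C (fun j => X j x) (fun j => Φ j x) (Ψ x) hP.self_of_nhds
  -- A projection onto `H (k + 1)` extends the class map to all of `T_x M`, so that the `X_j` can be
  -- expanded in the basis `b`, whose vectors need not lie in `H (k + 1)`.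
  obtain ⟨pr, hpr⟩ := LinearMap.exists_leftInverse_of_injective (𝓕.H (k + 1) x).subtype (Submodule.ker_subtype _)
  set Q : TangentSpace 𝓘(ℝ, E) x →ₗ[ℝ] 𝓕.Gr x := 𝓕.cls x k ∘ₗ pr with hQ
  have hQX : ∀ v : 𝓕.H (k + 1) x, 𝓕.cls x k v = Q v := fun v => by
    have := LinearMap.congr_fun hpr v
    exact congrArg (𝓕.cls x k) this.symm
  set μ := LinearMap.toMatrix (formBasis b.toBasis) (formBasis b.toBasis) with hμ
  let ξ : Fin d → TangentSpace 𝓘(ℝ, E) x →ₗ[ℝ] ℝ := fun a => b.toBasis.coord a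
  -- The matrix `A_a` is the principal symbol at the covector dual to `b a`: `-i` times a real
  -- combination of Hermitian matrices, hence skew-Hermitian, although the individual `Φ_j` need not
  -- be.
  refine ⟨fun a => Q (b a), fun a => μ (∑ j, (ξ a (X j x) : ℂ) • Φ j x), fun a => ?_, ?_⟩
  · beta_reduce
    rw [hsym (ξ a), map_smul, map_sum, Matrix.conjTranspose_smul, Matrix.conjTranspose_sum]
    simp only [map_smul, Matrix.conjTranspose_smul, hμ, toMatrix_cliff_conjTranspose]
    simp
  · have h1 : ∀ j, 𝓕.cls x k ⟨X j x, (hX j).mem⟩ = ∑ a, ξ a (X j x) • Q (b a) := by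
      intro j
      rw [hQX]
      refine (congrArg Q (b.toBasis.sum_repr (X j x)).symm).trans ?_
      rw [map_sum]
      refine Finset.sum_congr rfl fun a _ => ?_
      rw [map_smul, b.coe_toBasis]; rfl
    have h2 : ∑ j, 𝓕.cls x k ⟨X j x, (hX j).mem⟩ ⊗ₜ[ℝ] Φ j x =
        ∑ a, Q (b a) ⊗ₜ[ℝ] ∑ j, ξ a (X j x) • Φ j x := by
      simp_rw [h1, TensorProduct.sum_tmul, TensorProduct.tmul_sum, TensorProduct.smul_tmul]
      rw [Finset.sum_comm]
    have h3 : ∀ a, ∑ j, ξ a (X j x) • Φ j x = ∑ j, (ξ a (X j x) : ℂ) • Φ j x := fun a =>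
      Finset.sum_congr rfl fun j _ => (algebraMap_smul ℂ (ξ a (X j x)) (Φ j x)).symm
    rw [h2, map_sum]
    simp_rw [h3]
    rfl

end Filtration
end Cosymbol
end


theorem theorem4
    {E : Type*} [NormedAddCommGroup E] [NormedSpace ℝ E] [FiniteDimensional ℝ E]
    {M : Type*} [EMetricSpace M] [ChartedSpace E M] [IsManifold 𝓘(ℝ, E) ∞ M]
    [Bundle.RiemannianBundle (fun x : M => TangentSpace 𝓘(ℝ, E) x)]
    [IsContMDiffRiemannianBundle 𝓘(ℝ, E) ∞ E (fun x : M => TangentSpace 𝓘(ℝ, E) x)]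
    [IsRiemannianManifold 𝓘(ℝ, E) M] [CompleteSpace M]
    {F : Type*} [NormedAddCommGroup F] [NormedSpace ℝ F] [FiniteDimensional ℝ F]
    {G : Type*} [TopologicalSpace G] [ChartedSpace F G] [Group G] [LieGroup 𝓘(ℝ, F) ∞ G]
    [MulAction G M] [ProperSMul G M]
    (hsmooth : ContMDiff (𝓘(ℝ, F).prod 𝓘(ℝ, E)) 𝓘(ℝ, E) ∞ (fun p : G × M => p.1 • p.2))
    (hisom : ∀ (g : G) (x : M) (v w : TangentSpace 𝓘(ℝ, E) x),
      inner ℝ (mfderiv 𝓘(ℝ, E) 𝓘(ℝ, E) (fun y : M => g • y) x v)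
        (mfderiv 𝓘(ℝ, E) 𝓘(ℝ, E) (fun y : M => g • y) x w) = inner ℝ v w)
    {n : ℕ} (𝓕 : Filtration E M n)
    (hinv : ∀ (g : G) (i : ℕ) (x : M), ∀ v ∈ 𝓕.H i x,
      mfderiv 𝓘(ℝ, E) 𝓘(ℝ, E) (fun y : M => g • y) x v ∈ 𝓕.H i (g • x))
    (γ : LieMetric E M F G) (x : M) (k : Fin n)
    (σ : 𝓕.Gr x ⊗[ℝ] Module.End ℂ (FormAt E x))
    (hσ : 𝓕.HasHCosymbol γ.orbitalDirac x k σ)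
    {d : ℕ} (b : OrthonormalBasis (Fin d) ℝ (TangentSpace 𝓘(ℝ, E) x)) :
    (∃ l₀ : ℝ, 1 ≤ l₀ ∧ ∀ l : ℝ, l₀ ≤ l →
      Dense {w : 𝓕.HMod x d | ∃ p ∈ 𝓕.cosymbolGraph x b σ, w = p.2 + (Complex.I * l) • p.1} ∧
      Dense {w : 𝓕.HMod x d | ∃ p ∈ 𝓕.cosymbolGraph x b σ, w = p.2 - (Complex.I * l) • p.1}) ∧
    ∃ T : 𝓕.HMod x d →ₗ.[ℂ] 𝓕.HMod x d,
      (T.graph : Set (𝓕.HMod x d × 𝓕.HMod x d)) = closure (𝓕.cosymbolGraph x b σ) ∧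
      HilbertModule.IsSelfAdjointOp (GradedLie.CStar (𝓕.grMul x)) T ∧
      HilbertModule.IsRegularOp (GradedLie.CStar (𝓕.grMul x)) T := by
  obtain ⟨X, A, hA, h⟩ := 𝓕.exists_toMatrixSymbol_eq hsmooth γ x k σ hσ b
  have h1 := GradedLie.exists_regular_closure_opGraph (𝓕.isExpGroup_grMul x) X hA
  rw [← h] at h1
  exact h1
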